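/- Consider a downlink cellular network with a user at the origin. For $\lambda>0$ the base stations (BSs) form a homogeneous Poisson point process in $\mathbb{R}^2$ of intensity $\lambda$; $r_i$ is the distance of the $i$-th BS from the origin. The link from each BS has a small-scale fading power $h_i\ge 0$ with an arbitrary law of mean one and a path loss $L(r_i)$, where $L\ge 0$ may be random (for example LoS/NLoS); fadings and link states are independent over the BSs, of each other and of the BS locations. The path loss is physically feasible: $L(0)=L_0$ is a finite constant, $0\le L(r)\le L_0$ almost surely for every $r\ge 0$, and $\gamma=\mathbb{E}\big[\int_0^\infty rL(r)\,dr\big]\in(0,\infty)$. Suppose there are $r_0\ge 0$, $\zeta>0$, $\lambda_c\ge 0$ and a positive, decreasing, differentiable function $\tilde L$ on $[r_0,\infty)$ such that 1. $\tilde L(r)\le L(r)$ (almost surely) for all $r\ge r_0$; 2. $\dfrac{r\tilde L(r)}{-\tilde L'(r)}\ge\zeta$ for all $r\ge r_0$ (the quotient is read as $+\infty$ where $\tilde L'(r)=0$); 3. $\displaystyle\int_{r_0}^\infty \frac{r}{\tilde L(r)^2}e^{-\pi\lambda_0r^2}\,dr<\infty$ for all $\lambda_0>\lambda_c$. Then there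 is a constant $\lambda_c'\ge 0$ such that for all $\lambda_0\ge\lambda_c'$ $$\int_0^\infty\!\!\int_0^\infty 2\pi\lambda_0\, r\,t\,\exp\Big(-\pi\lambda_0r^2-2\pi\lambda_0\int_r^\infty x\,\mathbb{E}\big[1-e^{-htL(x)}\big]dx\Big)\,dr\,dt<\infty ,$$ where the expectation is over the fading $h$ and over $L$. Moreover, if $L(r)\to L_0$ in probability as $r\downarrow 0$, then for every noise power $N_0\ge 0$ the average area spectral efficiency saturates: $$\lim_{\lambda\to\infty}\lambda\,\mathbb{E}\big[\log_2(1+\mathrm{SINR})\big]=\frac{L_0}{2\pi\ln(2)\,\gamma},\qquad \mathrm{SINR}=\frac{h_*L(r_*)}{\sum_{r_i>r_*}h_iL(r_i)+N_0},$$ where $r_*$ and $h_*$ are the distance and the fading of the BS closest to the origin. -/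

import Mathlib

open MeasureTheory ProbabilityTheory Filter Topology Set

noncomputable section

namespace CellularNetwork

/-- The Euclidean plane in which the base stations are located; the user sits at the origin. -/
abbrev Plane : Type := EuclideanSpace ℝ (Fin 2)

/-- `μ` is the law of a small-scale fading power gain: a probability measure on `[0, ∞)` with mean
one, otherwise arbitrary. -/
structure IsFadingLaw (μ : Measure ℝ) : Prop where
  prob : IsProbabilityMeasure μ
  nonneg : ∀ᵐ h ∂μ, 0 ≤ h
  integrable : Integrable (fun h : ℝ => h) μ
  mean_one : ∫ h, h ∂μ = 1

section PathLoss

variable {S : Type*} [MeasurableSpace S]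

/-- `γ = E[∫₀^∞ r L(r) dr]`, where `L r s` is the path loss at distance `r` when the link is in the
(random) state `s`, which has law `ν`. -/
def gamma (ν : Measure S) (L : ℝ → S → ℝ) : ℝ :=
  ∫ s, (∫ r in Ioi (0 : ℝ), r * L r s) ∂ν

/-- Physically feasible path loss, possibly random: a link is in a random state with law `ν` (for
instance LoS or NLoS, or a uniform variable that decides between the two in dependence on the
distance), and a link of length `r` in state `s` has path loss `L r s`. The values of `L` at
negative distances play no role. A path loss that is deterministic with the distance is one that
does not depend on `s`. -/
structure IsFeasiblePathLoss (ν : Measure S) (L : ℝ → S → ℝ) (L₀ : ℝ) : Prop where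
  prob : IsProbabilityMeasure ν
  measurable : Measurable (Function.uncurry L)
  nonneg : ∀ r, 0 ≤ r → ∀ᵐ s ∂ν, 0 ≤ L r s
  at_zero : ∀ᵐ s ∂ν, L 0 s = L₀
  le_at_zero : ∀ r, 0 ≤ r → ∀ᵐ s ∂ν, L r s ≤ L₀
  integrable : Integrable (fun p : S × ℝ => p.2 * L p.2 p.1)
    (ν.prod (volume.restrict (Ioi (0 : ℝ))))
  gamma_pos : 0 < gamma ν L

/-- The integral
`∫₀^∞ ∫₀^∞ 2πλ r t exp(-πλ r² - 2πλ ∫_r^∞ x E[1 - exp(-h t L(x))] dx) dr dt` in `[0, ∞]`,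
the expectation being over the fading `h` and, independently, over the link state. -/
def momentIntegral (μ : Measure ℝ) (ν : Measure S) (L : ℝ → S → ℝ) (lam : ℝ) : ENNReal :=
  ∫⁻ t in Ioi (0 : ℝ), ∫⁻ r in Ioi (0 : ℝ),
    ENNReal.ofReal (2 * Real.pi * lam * r * t *
      Real.exp (-(Real.pi * lam * r ^ 2) - 2 * Real.pi * lam *
        ∫ x in Ioi r, x * (∫ p : ℝ × S, (1 - Real.exp (-(p.1 * t * L x p.2))) ∂(μ.prod ν))))

/-- The first sufficient condition: the integral above is finite for all intensities `lam ≥ lamc`,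
for some constant `lamc ≥ 0`. -/
def FirstCondition (μ : Measure ℝ) (ν : Measure S) (L : ℝ → S → ℝ) : Prop :=
  ∃ lamc : ℝ, 0 ≤ lamc ∧ ∀ lam : ℝ, lamc ≤ lam → momentIntegral μ ν L lam < ⊤

end PathLoss

section Network

variable {Ω : Type*} [MeasurableSpace Ω] {S : Type*} [MeasurableSpace S]

/-- The number of points of the (enumerated) point configuration `X · ω` that lie in `B`. -/
def pointCount (X : ℕ → Ω → Plane) (B : Set Plane) (ω : Ω) : ℕ∞ :=
  {i : ℕ | X i ω ∈ B}.encard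

/-- The random points `X 0, X 1, …` enumerate a homogeneous Poisson point process of intensity
`lam` in the plane: the number of points in a set of finite area has the Poisson law with mean
`lam` times the area, and the numbers of points in disjoint sets are independent. -/
structure IsPoissonProcess (P : Measure Ω) (X : ℕ → Ω → Plane) (lam : ℝ) : Prop where
  measurable : ∀ i, Measurable (X i)
  count_law : ∀ B : Set Plane, MeasurableSet B → volume B < ⊤ → ∀ k : ℕ,
    P {ω | pointCount X B ω = k} =
      poissonMeasure (lam.toNNReal * (volume B).toNNReal) {k}
  count_indep : ∀ (n : ℕ) (B : Fin n → Set Plane), (∀ j, MeasurableSet (B j)) →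
    (∀ j, volume (B j) < ⊤) → Pairwise (fun j k => Disjoint (B j) (B k)) →
    iIndepFun (fun j => pointCount X (B j)) P

/-- The downlink network of intensity `lam`: the base stations `X i` form a homogeneous Poisson
point process, and the link from `X i` to the user at the origin has fading `h i` with law `μ` and
state `σ i` with law `ν`; the `h i` and `σ i` are all independent, and independent of the `X i`. -/
structure IsNetwork (μ : Measure ℝ) (ν : Measure S) (lam : ℝ) (P : Measure Ω)
    (X : ℕ → Ω → Plane) (h : ℕ → Ω → ℝ) (σ : ℕ → Ω → S) : Prop where
  prob : IsProbabilityMeasure P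
  poisson : IsPoissonProcess P X lam
  mark_law : ∀ i, HasLaw (fun ω => (h i ω, σ i ω)) (μ.prod ν) P
  mark_indep : iIndepFun (fun i ω => (h i ω, σ i ω)) P
  indep : IndepFun (fun ω i => X i ω) (fun ω i => (h i ω, σ i ω)) P

/-- The index of the serving base station, the one that is closest to the origin (almost surely
there is exactly one such). -/
def servingIndex (X : ℕ → Ω → Plane) (ω : Ω) : ℕ :=
  sInf {i : ℕ | ∀ j, ‖X i ω‖ ≤ ‖X j ω‖}

/-- The received power `hᵢ L(rᵢ)` from base station `i`, with `rᵢ = ‖X i‖`. -/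
def receivedPower (L : ℝ → S → ℝ) (X : ℕ → Ω → Plane) (h : ℕ → Ω → ℝ) (σ : ℕ → Ω → S)
    (i : ℕ) (ω : Ω) : ℝ :=
  h i ω * L ‖X i ω‖ (σ i ω)

/-- The interference: the sum, in `[0, ∞]`, of the received powers of all base stations that are
farther away than the serving one. -/
def interference (L : ℝ → S → ℝ) (X : ℕ → Ω → Plane) (h : ℕ → Ω → ℝ) (σ : ℕ → Ω → S)
    (ω : Ω) : ENNReal :=
  ∑' i : {i : ℕ // ‖X (servingIndex X ω) ω‖ < ‖X i ω‖},
    ENNReal.ofReal (receivedPower L X h σ i ω)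

/-- The signal to interference plus noise ratio with noise power `N₀` (for a physically feasible
path loss the interference has a finite mean, hence is almost surely finite). -/
def sinr (L : ℝ → S → ℝ) (N₀ : ℝ) (X : ℕ → Ω → Plane) (h : ℕ → Ω → ℝ) (σ : ℕ → Ω → S)
    (ω : Ω) : ℝ :=
  receivedPower L X h σ (servingIndex X ω) ω / ((interference L X h σ ω).toReal + N₀)

/-- The average area spectral efficiency `λ E[log₂(1 + SINR)]`, in `[0, ∞]`. -/
def averageASE (L : ℝ → S → ℝ) (N₀ lam : ℝ) (P : Measure Ω)
    (X : ℕ → Ω → Plane) (h : ℕ → Ω → ℝ) (σ : ℕ → Ω → S) : ENNReal :=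
  ENNReal.ofReal lam * ∫⁻ ω, ENNReal.ofReal (Real.logb 2 (1 + sinr L N₀ X h σ ω)) ∂P

end Network

end CellularNetwork

end

open MeasureTheory ProbabilityTheory Filter Topology Set

noncomputable section

namespace CellularNetwork

/-! ### The exponential of minus an extended nonnegative real -/

section ExpNeg

/-! Write `φ_t(x) = E[1 - exp(-h t L(x))]` and let `I` be the interference. Everything rests on the
joint law of the serving link and `I`: given the positions, the marks are independent, so averaging
over them replaces each interfering link by the factor `1 - φ_t`; the Laplace functional of the
Poisson process then gives the density `2πλ r exp(-πλr² - 2πλ ∫_r^∞ x φ_t(x) dx)` for the serving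
distance weighted by `exp(-t I)` (`IsNetwork.lintegral_serving_interference`). Combined with `log(1
+ a/b) = ∫₀^∞ exp(-t b) (1 - exp(-t a)) / t dt`, it turns the spectral efficiency into a double
integral (`IsNetwork.averageASE_eq`).

First condition. Let `c = E[1 - exp(-h)]`, which is positive. If `t L̃(x) ≥ 1` then `φ_t(x) ≥ c`.
The ratio hypothesis says that `log L̃(r) + r²/(2ζ)` is nondecreasing, so for `r ≥ r₀` with `t L̃(r)
≥ 1` the inequality `t L̃ ≥ 1` persists from `r` up to `R`, where `R² = r² + 2ζ log(t L̃(r))`. Hence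
`∫_r^∞ x φ_t(x) dx ≥ c ζ log(t L̃(r))`, and for large `λ` the exponential decays at least like `(t
L̃(r))⁻³`. The integral over `t` is then at most a constant times `L̃(r)⁻²`, and the remaining
integral over `r` is the one assumed finite.

Saturation. Substitute `t = s/λ` and `r = ρ/√λ`. The integrand tends to `L₀ · 2πρ exp(-πρ² - 2πsγ)`,
whose integral is `L₀/(2πγ)`; the base of the logarithm supplies `ln 2`. Since `λ (1 - exp(-y/λ))`
is nondecreasing in `λ`, so is the scaled exponent (`scaledExponent_mono`). Thus its exponential at
one fixed intensity, with the bound `φ_t/t ≤ L₀`, dominates the integrand at all larger intensities,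
and the first condition makes this majorant integrable (`tendsto_lintegral_scaledIntegrand`). -/

/-- `exp (-a)` for `a ∈ [0, ∞]`, with `exp (-∞) = 0`. -/
def expNeg (a : ENNReal) : ENNReal := EReal.exp (-(a : EReal))

@[simp] lemma expNeg_zero : expNeg 0 = 1 := by simp [expNeg]

@[simp] lemma expNeg_top : expNeg ⊤ = 0 := by simp [expNeg]

lemma expNeg_ofReal {x : ℝ} (hx : 0 ≤ x) :
    expNeg (ENNReal.ofReal x) = ENNReal.ofReal (Real.exp (-x)) := by
  rw [expNeg, EReal.coe_ennreal_ofReal, max_eq_left hx, ← EReal.coe_neg, EReal.exp_coe]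

lemma expNeg_add (a b : ENNReal) : expNeg (a + b) = expNeg a * expNeg b := by
  rw [expNeg, EReal.coe_ennreal_add, EReal.neg_add (by simp) (by simp), sub_eq_add_neg,
    EReal.exp_add]
  rfl

lemma continuous_expNeg : Continuous expNeg :=
  ENNReal.continuous_exp.comp (continuous_neg.comp continuous_coe_ennreal_ereal)

lemma measurable_expNeg : Measurable expNeg := continuous_expNeg.measurable

@[fun_prop]
lemma _root_.Measurable.expNeg {α : Type*} [MeasurableSpace α] {f : α → ENNReal}
    (hf : Measurable f) : Measurable (fun a => expNeg (f a)) := measurable_expNeg.comp hf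

lemma expNeg_antitone : Antitone expNeg := fun _ _ hab =>
  EReal.exp_monotone (EReal.neg_le_neg_iff.2 (EReal.coe_ennreal_le_coe_ennreal_iff.2 hab))

lemma expNeg_le_one (a : ENNReal) : expNeg a ≤ 1 := by
  simpa using expNeg_antitone (bot_le : (0 : ENNReal) ≤ a)

lemma expNeg_ne_top (a : ENNReal) : expNeg a ≠ ⊤ :=
  ((expNeg_le_one a).trans_lt ENNReal.one_lt_top).ne

lemma expNeg_sum {ι : Type*} (s : Finset ι) (f : ι → ENNReal) :
    expNeg (∑ i ∈ s, f i) = ∏ i ∈ s, expNeg (f i) := by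
  classical
  induction s using Finset.induction_on with
  | empty => simp
  | insert a s ha ih => rw [Finset.sum_insert ha, Finset.prod_insert ha, expNeg_add, ih]

lemma tendsto_prod_expNeg (f : ℕ → ENNReal) :
    Tendsto (fun n => ∏ i ∈ Finset.range n, expNeg (f i)) atTop (𝓝 (expNeg (∑' i, f i))) := by
  simp_rw [← expNeg_sum]
  exact (continuous_expNeg.tendsto _).comp (ENNReal.tendsto_nat_tsum f)

lemma expNeg_nat_mul (n : ℕ) (c : ENNReal) : expNeg (c * n) = expNeg c ^ n := by
  have := expNeg_sum (Finset.range n) (fun _ => c)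
  simpa [mul_comm] using this

end ExpNeg

/-! ### The Laplace functional of a Poisson process -/

section LaplaceFunctional

/-- The generating function of the Poisson law at `expNeg c`, summed by the exponential series. The
value `c = ⊤` is included on purpose: it yields the void probability. -/
lemma lintegral_expNeg_poissonMeasure (a : NNReal) (c : ENNReal) :
    ∫⁻ k : ℕ, expNeg (c * k) ∂(poissonMeasure a) = expNeg (a * (1 - expNeg c)) := by
  obtain ⟨z, hz⟩ : ∃ z : NNReal, (z : ENNReal) = expNeg c :=
    ⟨_, ENNReal.coe_toNNReal (expNeg_ne_top c)⟩
  have hz1 : z ≤ 1 := by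
    have := expNeg_le_one c
    rw [← hz] at this
    exact_mod_cast this
  have hz1' : (z : ℝ) ≤ 1 := by exact_mod_cast hz1
  have hs : HasSum (fun n : ℕ => Real.exp (-a) * (((a : ℝ) * z) ^ n / n.factorial))
      (Real.exp (-a) * Real.exp (a * z)) := by
    have := (NormedSpace.expSeries_div_hasSum_exp ((a : ℝ) * z)).mul_left (Real.exp (-a))
    rwa [← Real.exp_eq_exp_ℝ] at this
  have h1 : (a : ENNReal) * (1 - expNeg c) = ENNReal.ofReal (a * (1 - z)) := by
    rw [← hz, ENNReal.ofReal_mul (NNReal.coe_nonneg a), ENNReal.ofReal_sub _ (NNReal.coe_nonneg z)]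
    simp
  rw [h1, expNeg_ofReal (mul_nonneg (NNReal.coe_nonneg a) (by linarith)), lintegral_countable']
  have h2 : ∀ n : ℕ, expNeg (c * n) * poissonMeasure a {n} =
      ENNReal.ofReal (Real.exp (-a) * (((a : ℝ) * z) ^ n / n.factorial)) := by
    intro n
    rw [expNeg_nat_mul, ← hz, poissonMeasure_singleton, ← ENNReal.ofReal_coe_nnreal,
      ← ENNReal.ofReal_pow (NNReal.coe_nonneg z), ← ENNReal.ofReal_mul (by positivity)]
    congr 1
    rw [mul_pow]
    ring
  simp_rw [h2]
  rw [← ENNReal.ofReal_tsum_of_nonneg (fun n => by positivity) hs.summable, hs.tsum_eq,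
    ← Real.exp_add]
  congr 2
  ring

variable {Ω : Type*} [MeasurableSpace Ω] {P : Measure Ω} {X : ℕ → Ω → Plane} {lam : ℝ}

lemma coe_pointCount {Ω : Type*} (X : ℕ → Ω → Plane) (B : Set Plane) (ω : Ω) :
    ((pointCount X B ω : ℕ∞) : ENNReal) = ∑' i, B.indicator (fun _ => (1 : ENNReal)) (X i ω) := by
  rw [pointCount, ← ENNReal.tsum_set_one, tsum_subtype {i : ℕ | X i ω ∈ B} (fun _ => (1 : ENNReal))]
  rfl

lemma measurable_pointCount (hX : ∀ i, Measurable (X i)) {B : Set Plane} (hB : MeasurableSet B) :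
    Measurable (pointCount X B) := by
  refine measurable_to_countable' fun k => ?_
  have h : Measurable (fun ω => ((pointCount X B ω : ℕ∞) : ENNReal)) := by
    simp_rw [coe_pointCount]
    exact Measurable.tsum fun i => (measurable_const.indicator hB).comp (hX i)
  have : pointCount X B ⁻¹' {k} =
      (fun ω => ((pointCount X B ω : ℕ∞) : ENNReal)) ⁻¹' {(k : ENNReal)} := by
    ext ω
    simp
  rw [this]
  exact h (measurableSet_singleton _)

/-- `count_law` only speaks of finite counts. The count `⊤` has probability zero because the Poisson
masses on `ℕ` already add up to one. -/
lemma IsPoissonProcess.map_pointCount [IsProbabilityMeasure P] (hX : IsPoissonProcess P X lam)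
    {B : Set Plane} (hB : MeasurableSet B) (hBf : volume B < ⊤) :
    P.map (pointCount X B) =
      (poissonMeasure (lam.toNNReal * (volume B).toNNReal)).map (fun k : ℕ => (k : ℕ∞)) := by
  have hm := measurable_pointCount hX.measurable hB
  have hc : Measurable (fun k : ℕ => (k : ℕ∞)) := measurable_from_top
  have hnat : ∀ k : ℕ, P.map (pointCount X B) {(k : ℕ∞)} =
      (poissonMeasure (lam.toNNReal * (volume B).toNNReal)).map (fun k : ℕ => (k : ℕ∞))
        {(k : ℕ∞)} := by
    intro k
    rw [Measure.map_apply hm (measurableSet_singleton _),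
      Measure.map_apply hc (measurableSet_singleton _)]
    have h1 : (fun k : ℕ => (k : ℕ∞)) ⁻¹' {(k : ℕ∞)} = {k} := by
      ext j
      simp
    rw [h1]
    exact hX.count_law B hB hBf k
  have := Measure.isProbabilityMeasure_map (μ := P) hm.aemeasurable
  have := Measure.isProbabilityMeasure_map
    (μ := poissonMeasure (lam.toNNReal * (volume B).toNNReal)) hc.aemeasurable
  set m₁ := P.map (pointCount X B)
  set m₂ := (poissonMeasure (lam.toNNReal * (volume B).toNNReal)).map (fun k : ℕ => (k : ℕ∞))
  have hfin : m₁ (range (fun k : ℕ => (k : ℕ∞))) = m₂ (range (fun k : ℕ => (k : ℕ∞))) := by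
    have hr : range (fun k : ℕ => (k : ℕ∞)) = ⋃ k : ℕ, {(k : ℕ∞)} := by
      ext j
      simp
    have hd : Pairwise (Function.onFun Disjoint fun k : ℕ => ({(k : ℕ∞)} : Set ℕ∞)) := by
      intro i j hij
      simpa [Function.onFun] using hij
    rw [hr, measure_iUnion hd (fun _ => measurableSet_singleton _),
      measure_iUnion hd (fun _ => measurableSet_singleton _)]
    exact tsum_congr hnat
  refine Measure.ext_of_singleton fun k => ?_
  induction k with
  | top =>
    have ht : ({⊤} : Set ℕ∞) = (range (fun k : ℕ => (k : ℕ∞)))ᶜ := by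
      ext j
      induction j <;> simp
    rw [ht, prob_compl_eq_one_sub MeasurableSet.of_discrete,
      prob_compl_eq_one_sub MeasurableSet.of_discrete, hfin]
  | coe k => exact hnat k

lemma IsPoissonProcess.lintegral_expNeg_pointCount [IsProbabilityMeasure P]
    (hX : IsPoissonProcess P X lam) {B : Set Plane} (hB : MeasurableSet B) (hBf : volume B < ⊤)
    (c : ENNReal) :
    ∫⁻ ω, expNeg (c * (pointCount X B ω : ℕ∞)) ∂P =
      expNeg (ENNReal.ofReal lam * volume B * (1 - expNeg c)) := by
  have hm := measurable_pointCount hX.measurable hB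
  have h1 : ∫⁻ ω, expNeg (c * (pointCount X B ω : ℕ∞)) ∂P =
      ∫⁻ k : ℕ∞, expNeg (c * (k : ENNReal)) ∂(P.map (pointCount X B)) := by
    rw [lintegral_map measurable_from_top hm]
  rw [h1, hX.map_pointCount hB hBf, lintegral_map measurable_from_top measurable_from_top]
  have h2 := lintegral_expNeg_poissonMeasure (lam.toNNReal * (volume B).toNNReal) c
  simp only [ENNReal.coe_mul, ENNReal.coe_toNNReal hBf.ne] at h2
  simpa [ENNReal.ofReal] using h2

lemma IsPoissonProcess.lintegral_expNeg_sum_pointCount [IsProbabilityMeasure P]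
    (hX : IsPoissonProcess P X lam) {ι : Type*} (s : Finset ι) (B : ι → Set Plane)
    (c : ι → ENNReal) (hB : ∀ j ∈ s, MeasurableSet (B j)) (hBf : ∀ j ∈ s, volume (B j) < ⊤)
    (hd : (s : Set ι).PairwiseDisjoint B) :
    ∫⁻ ω, expNeg (∑ j ∈ s, c j * (pointCount X (B j) ω : ℕ∞)) ∂P =
      expNeg (ENNReal.ofReal lam * ∑ j ∈ s, (1 - expNeg (c j)) * volume (B j)) := by
  -- `count_indep` is stated for families indexed by `Fin n`, so the sum is transported there.
  have key : ∀ F : ι → ENNReal, ∑ j ∈ s, F j = ∑ j : Fin s.card, F (s.equivFin.symm j) := by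
    intro F
    rw [← Finset.sum_coe_sort s, ← s.equivFin.symm.sum_comp]
  simp_rw [key, expNeg_sum]
  rw [lintegral_prod_eq_prod_lintegral_of_indepFun (X := fun (j : Fin s.card) ω =>
    expNeg (c (s.equivFin.symm j) * (pointCount X (B (s.equivFin.symm j)) ω : ℕ∞)))]
  · rw [Finset.mul_sum, expNeg_sum]
    refine Finset.prod_congr rfl fun j _ => ?_
    rw [hX.lintegral_expNeg_pointCount (hB _ (s.equivFin.symm j).2) (hBf _ (s.equivFin.symm j).2)]
    congr 1
    ring
  · have := hX.count_indep s.card (fun j => B (s.equivFin.symm j))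
      (fun j => hB _ (s.equivFin.symm j).2) (fun j => hBf _ (s.equivFin.symm j).2)
      (fun j k hjk => hd (s.equivFin.symm j).2 (s.equivFin.symm k).2 (by
        intro h
        exact hjk (s.equivFin.symm.injective (Subtype.ext h))))
    exact this.comp (fun j k => expNeg (c (s.equivFin.symm j) * ((k : ℕ∞) : ENNReal)))
      (fun j => measurable_from_top)
  · intro j
    have hm := measurable_pointCount hX.measurable (hB _ (s.equivFin.symm j).2)
    exact Measurable.comp (g := fun k : ℕ∞ => expNeg (c (s.equivFin.symm j) * (k : ENNReal)))
      measurable_from_top hm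

/-- A simple function is constant on disjoint level sets, so its sum over the points is a weighted
sum of independent counts. -/
lemma IsPoissonProcess.lintegral_expNeg_tsum_simpleFunc [IsProbabilityMeasure P]
    (hX : IsPoissonProcess P X lam) (f : SimpleFunc Plane ENNReal)
    (hf : volume (Function.support f) < ⊤) :
    ∫⁻ ω, expNeg (∑' i, f (X i ω)) ∂P =
      expNeg (ENNReal.ofReal lam * ∫⁻ x, (1 - expNeg (f x))) := by
  classical
  -- The value zero is left out: its level set has infinite area, and it contributes nothing to
  -- either side.
  set s := f.range.filter (· ≠ 0) with hs
  have hsum : ∀ ω, ∑' i, f (X i ω) = ∑ c ∈ s, c * (pointCount X (f ⁻¹' {c}) ω : ℕ∞) := by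
    intro ω
    simp_rw [coe_pointCount, ← ENNReal.tsum_mul_left]
    rw [← Summable.tsum_finsetSum (fun _ _ => ENNReal.summable)]
    refine tsum_congr fun i => ?_
    by_cases h0 : f (X i ω) = 0
    · rw [h0, Finset.sum_eq_zero]
      intro c hc
      have : c ≠ 0 := (Finset.mem_filter.1 hc).2
      simp [h0, this.symm]
    · rw [Finset.sum_eq_single_of_mem (f (X i ω))]
      · simp
      · simp [hs, h0]
      · intro c _ hc
        simp [hc.symm]
  simp_rw [hsum]
  rw [hX.lintegral_expNeg_sum_pointCount s (fun c => f ⁻¹' {c}) (fun c => c)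
    (fun c _ => f.measurableSet_fiber c)]
  · congr 2
    have h1 : ∫⁻ x, (1 - expNeg (f x)) = (f.map (fun c => 1 - expNeg c)).lintegral volume := by
      rw [← SimpleFunc.lintegral_eq_lintegral]
      rfl
    rw [h1, SimpleFunc.map_lintegral, hs, Finset.sum_filter]
    refine Finset.sum_congr rfl fun c _ => ?_
    by_cases h0 : c = 0 <;> simp [h0]
  · intro c hc
    have : c ≠ 0 := (Finset.mem_filter.1 hc).2
    refine (measure_mono ?_).trans_lt hf
    intro x hx
    simp only [mem_preimage, mem_singleton_iff] at hx
    simpa [hx] using this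
  · intro c _ d _ hcd
    refine Set.disjoint_left.2 fun x hx hx' => hcd ?_
    simp only [mem_preimage, mem_singleton_iff] at hx hx'
    exact hx.symm.trans hx'

/-- The Laplace functional of a homogeneous Poisson process. -/
theorem IsPoissonProcess.lintegral_expNeg_tsum [IsProbabilityMeasure P]
    (hX : IsPoissonProcess P X lam) {v : Plane → ENNReal} (hv : Measurable v) :
    ∫⁻ ω, expNeg (∑' i, v (X i ω)) ∂P =
      expNeg (ENNReal.ofReal lam * ∫⁻ x, (1 - expNeg (v x))) := by
  -- Restricting the approximations to growing balls gives supports of finite area and keeps the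
  -- increasing convergence to `v`.
  set f : ℕ → SimpleFunc Plane ENNReal := fun n =>
    (SimpleFunc.eapprox v n).restrict (Metric.ball 0 n) with hf
  have hfa : ∀ n x, f n x =
      (Metric.ball (0 : Plane) n).indicator (SimpleFunc.eapprox v n) x := fun n x => by
    rw [hf]
    exact SimpleFunc.restrict_apply _ measurableSet_ball x
  have hmono : ∀ x, Monotone fun n => f n x := by
    intro x m n hmn
    simp only [hfa]
    refine (indicator_le_indicator_of_subset (Metric.ball_subset_ball
      (Nat.cast_le.2 hmn)) (fun _ => bot_le) x).trans ?_
    exact indicator_le_indicator (SimpleFunc.monotone_eapprox v hmn x)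
  have hlim : ∀ x, Tendsto (fun n => f n x) atTop (𝓝 (v x)) := by
    intro x
    have h1 : Tendsto (fun n => SimpleFunc.eapprox v n x) atTop (𝓝 (v x)) := by
      rw [← SimpleFunc.iSup_eapprox_apply hv x]
      exact tendsto_atTop_iSup fun m n hmn => SimpleFunc.monotone_eapprox v hmn x
    refine h1.congr' ?_
    obtain ⟨N, hN⟩ := exists_nat_gt ‖x‖
    filter_upwards [eventually_ge_atTop N] with n hn
    have : x ∈ Metric.ball (0 : Plane) n := by
      rw [mem_ball_zero_iff]
      exact hN.trans_le (by exact_mod_cast hn)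
    rw [hfa, indicator_of_mem this]
  have hsupp : ∀ n, volume (Function.support (f n)) < ⊤ := by
    intro n
    refine (measure_mono ?_).trans_lt (measure_ball_lt_top (x := (0 : Plane)) (r := (n : ℝ)))
    intro x hx
    by_contra hx'
    exact hx (by rw [hfa, indicator_of_notMem hx'])
  have htsum : ∀ ω, Tendsto (fun n => ∑' i, f n (X i ω)) atTop (𝓝 (∑' i, v (X i ω))) := by
    intro ω
    -- The sum is an integral against counting measure, so monotone convergence applies to it.
    simp_rw [← lintegral_count]
    exact lintegral_tendsto_of_tendsto_of_monotone (fun n => by fun_prop)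
      (ae_of_all _ fun i => hmono _) (ae_of_all _ fun i => hlim _)
  have hleft : Tendsto (fun n => ∫⁻ ω, expNeg (∑' i, f n (X i ω)) ∂P) atTop
      (𝓝 (∫⁻ ω, expNeg (∑' i, v (X i ω)) ∂P)) := by
    refine tendsto_lintegral_of_dominated_convergence (fun _ => 1) (fun n => ?_)
      (fun n => ae_of_all _ fun ω => expNeg_le_one _) (by simp)
      (ae_of_all _ fun ω => (continuous_expNeg.tendsto _).comp (htsum ω))
    exact (Measurable.tsum fun i => (f n).measurable.comp (hX.measurable i)).expNeg
  have hright : Tendsto (fun n => expNeg (ENNReal.ofReal lam * ∫⁻ x, (1 - expNeg (f n x)))) atTop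
      (𝓝 (expNeg (ENNReal.ofReal lam * ∫⁻ x, (1 - expNeg (v x))))) := by
    refine (continuous_expNeg.tendsto _).comp (ENNReal.Tendsto.const_mul ?_ (by simp))
    refine lintegral_tendsto_of_tendsto_of_monotone
      (fun n => ((f n).measurable.expNeg.const_sub 1).aemeasurable)
      (ae_of_all _ fun x m n hmn => tsub_le_tsub_left (expNeg_antitone (hmono x hmn)) 1)
      (ae_of_all _ fun x => ?_)
    exact ENNReal.Tendsto.sub tendsto_const_nhds ((continuous_expNeg.tendsto _).comp (hlim x))
      (by simp)
  refine tendsto_nhds_unique hleft (hright.congr fun n => ?_)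
  rw [hX.lintegral_expNeg_tsum_simpleFunc (f n) (hsupp n)]

end LaplaceFunctional

/-! ### Radial integration in the plane -/

section Radial

lemma ofReal_max_zero (x : ℝ) : ENNReal.ofReal (max x 0) = ENNReal.ofReal x := by
  rcases le_total x 0 with h | h <;> simp [h, ENNReal.ofReal_of_nonpos]

lemma volume_closedBall_plane (r : ℝ) :
    volume (Metric.closedBall (0 : Plane) r) = ENNReal.ofReal (Real.pi * (max r 0) ^ 2) := by
  rw [EuclideanSpace.volume_closedBall_fin_two, ENNReal.ofReal_mul Real.pi_nonneg,
    ENNReal.ofReal_pow (le_max_right _ _), mul_comm, ofReal_max_zero]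

lemma setLIntegral_Ioc_two_pi_mul {a b : ℝ} (ha : 0 ≤ a) (hab : a ≤ b) :
    ∫⁻ r in Ioc a b, ENNReal.ofReal (2 * Real.pi * r) =
      ENNReal.ofReal (Real.pi * b ^ 2 - Real.pi * a ^ 2) := by
  rw [← ofReal_integral_eq_lintegral_ofReal]
  · rw [← intervalIntegral.integral_of_le hab, intervalIntegral.integral_const_mul, integral_id]
    congr 1
    ring
  · exact (Continuous.integrableOn_Icc (by fun_prop)).mono_set Ioc_subset_Icc_self
  · filter_upwards [ae_restrict_mem measurableSet_Ioc] with r hr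
    have : 0 ≤ r := ha.trans hr.1.le
    have := Real.pi_pos
    simp only [Pi.zero_apply]
    positivity

/-- Half-open intervals determine the measure, and their preimages are annuli. The maxima with `0`
below take care of negative endpoints, for which the balls are empty. -/
lemma map_norm_volume_plane :
    (volume : Measure Plane).map (fun x => ‖x‖) =
      (volume.restrict (Ioi (0 : ℝ))).withDensity (fun r => ENNReal.ofReal (2 * Real.pi * r)) := by
  have hpre : ∀ a b : ℝ, (fun x : Plane => ‖x‖) ⁻¹' Ioc a b =
      Metric.closedBall (0 : Plane) b \ Metric.closedBall 0 a := by
    intro a b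
    ext x
    simp [and_comm]
  have hm : Measurable (fun x : Plane => ‖x‖) := measurable_norm
  have hval : ∀ a b : ℝ, a < b → (volume : Measure Plane).map (fun x => ‖x‖) (Ioc a b) =
      ENNReal.ofReal (Real.pi * (max b 0) ^ 2) - ENNReal.ofReal (Real.pi * (max a 0) ^ 2) := by
    intro a b hab
    rw [Measure.map_apply hm measurableSet_Ioc, hpre,
      measure_sdiff (Metric.closedBall_subset_closedBall hab.le)
        measurableSet_closedBall.nullMeasurableSet measure_closedBall_lt_top.ne,
      volume_closedBall_plane, volume_closedBall_plane]
  refine Measure.ext_of_Ioc' _ _ (fun a b hab => ?_) fun a b hab => ?_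
  · rw [hval a b hab]
    finiteness
  · rw [hval a b hab, withDensity_apply _ measurableSet_Ioc, Measure.restrict_restrict
      measurableSet_Ioc, Ioc_inter_Ioi]
    have hpa : 0 ≤ Real.pi * (max a 0) ^ 2 := by have := Real.pi_pos; positivity
    rw [← ENNReal.ofReal_sub _ hpa]
    rcases le_or_gt b 0 with hb | hb
    · rw [Ioc_eq_empty (by simp [hb])]
      simp [hb, hab.le.trans hb]
    · rw [max_eq_left hb.le, ← setLIntegral_Ioc_two_pi_mul (le_max_right _ _) (max_le hab.le hb.le)]

lemma lintegral_norm_plane {f : ℝ → ENNReal} (hf : Measurable f) :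
    ∫⁻ x : Plane, f ‖x‖ = ∫⁻ r in Ioi (0 : ℝ), ENNReal.ofReal (2 * Real.pi * r) * f r := by
  rw [← lintegral_map hf measurable_norm, map_norm_volume_plane,
    lintegral_withDensity_eq_lintegral_mul _ (by fun_prop) hf]
  rfl

end Radial

/-! ### The serving base station -/

section Serving

variable {Ω : Type*} [MeasurableSpace Ω] {P : Measure Ω} {X : ℕ → Ω → Plane} {lam : ℝ}

/-- The distance of the serving base station. -/
def servingDist {Ω : Type*} (X : ℕ → Ω → Plane) (ω : Ω) : ℝ := ‖X (servingIndex X ω) ω‖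

lemma measurable_servingIndex (hX : ∀ i, Measurable (X i)) : Measurable (servingIndex X) := by
  have hA : ∀ i, MeasurableSet {ω | ∀ j, ‖X i ω‖ ≤ ‖X j ω‖} := fun i => by
    rw [ofPred_forall]
    exact MeasurableSet.iInter fun j => measurableSet_le (hX i).norm (hX j).norm
  refine measurable_to_countable' fun n => ?_
  -- The value `n` means that `n` is a minimizer and no smaller index is. For `n = 0` there is also
  -- the event that no minimizer exists, because `sInf ∅ = 0`.
  have : servingIndex X ⁻¹' {n} =
      ({ω | ∀ j, ‖X n ω‖ ≤ ‖X j ω‖} ∩ ⋂ m ∈ Finset.range n, {ω | ∀ j, ‖X m ω‖ ≤ ‖X j ω‖}ᶜ) ∪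
      (if n = 0 then ⋂ i, {ω | ∀ j, ‖X i ω‖ ≤ ‖X j ω‖}ᶜ else ∅) := by
    ext ω
    set s : Set ℕ := {i | ∀ j, ‖X i ω‖ ≤ ‖X j ω‖} with hs
    have hmem : ∀ i, (∀ j, ‖X i ω‖ ≤ ‖X j ω‖) ↔ i ∈ s := fun i => Iff.rfl
    have h1 : servingIndex X ω = sInf s := rfl
    simp only [mem_preimage, mem_singleton_iff, h1, mem_union, mem_inter_iff, mem_ofPred_eq,
      mem_iInter, Finset.mem_range, mem_compl_iff, hmem]
    constructor
    · rintro rfl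
      rcases s.eq_empty_or_nonempty with he | hne
      · right
        rw [he, Nat.sInf_empty, if_pos rfl, mem_iInter]
        exact fun i hi => notMem_empty i (he ▸ hi)
      · exact Or.inl ⟨Nat.sInf_mem hne, fun m hm => Nat.notMem_of_lt_sInf hm⟩
    · rintro (⟨h2, h3⟩ | h2)
      · refine le_antisymm (Nat.sInf_le h2) ?_
        by_contra! hlt
        exact h3 _ hlt (Nat.sInf_mem ⟨n, h2⟩)
      · split_ifs at h2 with hn
        · have : s = ∅ := by
            ext i
            simpa [hmem] using mem_iInter.1 h2 i
          simp [this, hn]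
        · exact h2.elim
  rw [this]
  refine ((hA n).inter (Finset.measurableSet_biInter _ fun m _ => (hA m).compl)).union ?_
  split_ifs
  · exact MeasurableSet.iInter fun i => (hA i).compl
  · exact MeasurableSet.empty

lemma measurable_comp_servingIndex {β : Type*} [MeasurableSpace β] (hX : ∀ i, Measurable (X i))
    {f : ℕ → Ω → β} (hf : ∀ i, Measurable (f i)) :
    Measurable (fun ω => f (servingIndex X ω) ω) := by
  have h : Measurable (fun p : Ω × ℕ => f p.2 p.1) := measurable_from_prod_countable_left hf
  exact h.comp (measurable_id.prodMk (measurable_servingIndex hX))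

lemma measurable_servingDist (hX : ∀ i, Measurable (X i)) : Measurable (servingDist X) :=
  measurable_comp_servingIndex (f := fun i ω => ‖X i ω‖) hX fun i => (hX i).norm

lemma IsPoissonProcess.ae_pointCount_lt_top [IsProbabilityMeasure P]
    (hX : IsPoissonProcess P X lam) {B : Set Plane} (hB : MeasurableSet B) (hBf : volume B < ⊤) :
    ∀ᵐ ω ∂P, pointCount X B ω < ⊤ := by
  have hm := measurable_pointCount hX.measurable hB
  have h := hX.map_pointCount hB hBf
  have h0 : P (pointCount X B ⁻¹' {⊤}) = 0 := by
    rw [← Measure.map_apply hm (measurableSet_singleton _), h,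
      Measure.map_apply measurable_from_top (measurableSet_singleton _)]
    have : (fun k : ℕ => (k : ℕ∞)) ⁻¹' {⊤} = ∅ := by
      ext j
      simp
    rw [this, measure_empty]
  refine (measure_eq_zero_iff_ae_notMem.1 h0).mono fun ω hω => ?_
  exact lt_top_iff_ne_top.2 hω

/-- Almost surely some base station is closest to the origin. -/
lemma IsPoissonProcess.ae_forall_servingDist_le [IsProbabilityMeasure P]
    (hX : IsPoissonProcess P X lam) : ∀ᵐ ω ∂P, ∀ j, servingDist X ω ≤ ‖X j ω‖ := by
  have h : ∀ᵐ ω ∂P, ∀ n : ℕ, pointCount X (Metric.ball 0 n) ω < ⊤ :=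
    ae_all_iff.2 fun n => hX.ae_pointCount_lt_top measurableSet_ball measure_ball_lt_top
  filter_upwards [h] with ω hω
  obtain ⟨N, hN⟩ := exists_nat_gt ‖X 0 ω‖
  have hfin : {i : ℕ | X i ω ∈ Metric.ball (0 : Plane) N}.Finite := encard_lt_top_iff.1 (hω N)
  have h0 : 0 ∈ {i : ℕ | X i ω ∈ Metric.ball (0 : Plane) N} := by simpa using hN
  obtain ⟨i, hi, hmin⟩ := exists_min_image _ (fun i => ‖X i ω‖) hfin ⟨0, h0⟩
  have hne : {i : ℕ | ∀ j, ‖X i ω‖ ≤ ‖X j ω‖}.Nonempty := by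
    refine ⟨i, fun j => ?_⟩
    by_cases hj : X j ω ∈ Metric.ball (0 : Plane) N
    · exact hmin j hj
    · have h1 : (N : ℝ) ≤ ‖X j ω‖ := by simpa using hj
      have h2 : ‖X i ω‖ < N := by simpa using hi
      linarith
  exact Nat.sInf_mem hne

/-- With `a` the mean, `exp(-a) ≥ 1 - a` gives `1 - (1 + a) exp(-a) ≤ a²`. The quadratic order beats
the number of cells in a partition into cells of equal small area. -/
lemma IsPoissonProcess.measure_two_le_pointCount [IsProbabilityMeasure P]
    (hX : IsPoissonProcess P X lam) {B : Set Plane} (hB : MeasurableSet B) (hBf : volume B < ⊤) :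
    P {ω | 2 ≤ pointCount X B ω} ≤ (ENNReal.ofReal lam * volume B) ^ 2 := by
  set a : NNReal := lam.toNNReal * (volume B).toNNReal with ha
  have hm := measurable_pointCount hX.measurable hB
  have h0 : P {ω | pointCount X B ω = 0} = ENNReal.ofReal (Real.exp (-a)) := by
    have := hX.count_law B hB hBf 0
    rw [poissonMeasure_singleton, ← ha] at this
    simpa using this
  have h1 : P {ω | pointCount X B ω = 1} = ENNReal.ofReal (Real.exp (-a) * a) := by
    have := hX.count_law B hB hBf 1
    rw [poissonMeasure_singleton, ← ha] at this
    simpa using this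
  have hms : ∀ k : ℕ∞, MeasurableSet {ω | pointCount X B ω = k} := fun k =>
    hm (measurableSet_singleton k)
  have hset : {ω | 2 ≤ pointCount X B ω} =
      ({ω | pointCount X B ω = 0} ∪ {ω | pointCount X B ω = 1})ᶜ := by
    ext ω
    simp only [mem_ofPred_eq, mem_compl_iff, mem_union, not_or]
    generalize pointCount X B ω = n
    induction n with
    | top => simp
    | coe n =>
      norm_cast
      omega
  have hd : Disjoint {ω | pointCount X B ω = 0} {ω | pointCount X B ω = 1} := by
    refine Set.disjoint_left.2 fun ω h h' => ?_
    simp only [mem_ofPred_eq] at h h'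
    simp [h] at h'
  have hav : ENNReal.ofReal lam * volume B = ENNReal.ofReal (a : ℝ) := by
    rw [ENNReal.ofReal_coe_nnreal, ha, ENNReal.coe_mul, ENNReal.coe_toNNReal hBf.ne]
    rfl
  rw [hset, prob_compl_eq_one_sub ((hms 0).union (hms 1)), measure_union hd (hms 1), h0, h1,
    ← ENNReal.ofReal_add (by positivity) (by positivity), hav, ← ENNReal.ofReal_pow (by positivity),
    ← ENNReal.ofReal_one, ← ENNReal.ofReal_sub _ (by positivity)]
  refine ENNReal.ofReal_le_ofReal ?_
  have h2 : 1 - (a : ℝ) ≤ Real.exp (-a) := by linarith [Real.add_one_le_exp (-(a : ℝ))]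
  have h3 : (0 : ℝ) ≤ a := a.2
  nlinarith

/-- Almost surely the base stations have pairwise different distances. -/
lemma IsPoissonProcess.ae_injective_norm [IsProbabilityMeasure P]
    (hX : IsPoissonProcess P X lam) : ∀ᵐ ω ∂P, Function.Injective fun i => ‖X i ω‖ := by
  have key : ∀ N : ℕ, 0 < N → P {ω | ∃ i j, i ≠ j ∧ ‖X i ω‖ = ‖X j ω‖ ∧ ‖X i ω‖ < N} = 0 := by
    intro N hN
    have hNpos : (0 : ℝ) < N := by exact_mod_cast hN
    have hbound : ∀ n : ℕ, P {ω | ∃ i j, i ≠ j ∧ ‖X i ω‖ = ‖X j ω‖ ∧ ‖X i ω‖ < N} ≤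
        ENNReal.ofReal ((max lam 0 * (Real.pi * N ^ 2)) ^ 2 / ((n : ℝ) + 1)) := by
      intro n
      -- The radii cut the disc of radius `N` into `n + 1` annuli of equal area. A tie puts two
      -- points in the same annulus, and the union bound over `n + 1` annuli is of order `1/(n +
      -- 1)`.
      set q : ℕ → ℝ := fun k => N * Real.sqrt (k / ((n : ℝ) + 1)) with hq
      have hn : (0 : ℝ) < (n : ℝ) + 1 := by positivity
      set B : ℕ → Set Plane := fun k => Metric.ball 0 (q (k + 1)) \ Metric.ball 0 (q k) with hB
      have hqm : Monotone q := by
        intro k l hkl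
        simp only [hq]
        have : (k : ℝ) ≤ l := by exact_mod_cast hkl
        gcongr
      have hq0 : ∀ k, 0 ≤ q k := fun k => by positivity
      have hqsq : ∀ k, q k ^ 2 = N ^ 2 * (k / ((n : ℝ) + 1)) := fun k => by
        simp only [hq]
        rw [mul_pow, Real.sq_sqrt (by positivity)]
      have hvb : ∀ k, volume (Metric.ball (0 : Plane) (q k)) =
          ENNReal.ofReal (Real.pi * (N ^ 2 * (k / ((n : ℝ) + 1)))) := fun k => by
        rw [← Measure.addHaar_closedBall_eq_addHaar_ball, volume_closedBall_plane,
          max_eq_left (hq0 k), hqsq]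
      have hvol : ∀ k, volume (B k) = ENNReal.ofReal (Real.pi * N ^ 2 / ((n : ℝ) + 1)) := by
        intro k
        rw [hB, measure_sdiff (Metric.ball_subset_ball (hqm k.le_succ))
          measurableSet_ball.nullMeasurableSet (by finiteness), hvb, hvb,
          ← ENNReal.ofReal_sub _ (by positivity)]
        congr 1
        push_cast
        field_simp
        ring
      have hsub : {ω | ∃ i j, i ≠ j ∧ ‖X i ω‖ = ‖X j ω‖ ∧ ‖X i ω‖ < N} ⊆
          ⋃ k ∈ Finset.range (n + 1), {ω | 2 ≤ pointCount X (B k) ω} := by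
        rintro ω ⟨i, j, hij, heq, hlt⟩
        have hex : ∃ k, ‖X i ω‖ < q (k + 1) := by
          refine ⟨n, ?_⟩
          simp only [hq]
          push_cast
          rw [div_self hn.ne', Real.sqrt_one, mul_one]
          exact hlt
        classical
        set k := Nat.find hex with hk
        have hk1 : ‖X i ω‖ < q (k + 1) := Nat.find_spec hex
        have hk2 : q k ≤ ‖X i ω‖ := by
          rcases Nat.eq_zero_or_pos k with h0 | hpos
          · rw [h0]
            simp [hq]
          · have := Nat.find_min hex (m := k - 1) (by omega)
            rw [Nat.sub_add_cancel hpos] at this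
            exact not_lt.1 this
        have hkn : k ≤ n := by
          refine Nat.find_min' hex ?_
          simp only [hq]
          push_cast
          rw [div_self hn.ne', Real.sqrt_one, mul_one]
          exact hlt
        simp only [mem_iUnion, Finset.mem_range]
        refine ⟨k, by omega, ?_⟩
        have hpair : ({i, j} : Set ℕ) ⊆ {l | X l ω ∈ B k} := by
          rintro l (rfl | rfl)
          · simp [hB, hk1, hk2]
          · simp [hB, ← heq, hk1, hk2]
        have := encard_le_encard hpair
        rwa [encard_pair hij] at this
      refine (measure_mono hsub).trans ((measure_biUnion_finset_le _ _).trans ?_)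
      have hone : ∀ k ∈ Finset.range (n + 1), P {ω | 2 ≤ pointCount X (B k) ω} ≤
          ENNReal.ofReal ((max lam 0 * (Real.pi * N ^ 2 / ((n : ℝ) + 1))) ^ 2) := by
        intro k _
        refine (hX.measure_two_le_pointCount (measurableSet_ball.diff measurableSet_ball) ?_).trans
          (le_of_eq ?_)
        · rw [hvol k]
          exact ENNReal.ofReal_lt_top
        · rw [hvol k, ENNReal.ofReal_pow (by positivity), ENNReal.ofReal_mul (le_max_right _ _),
            ofReal_max_zero]
      refine (Finset.sum_le_sum hone).trans (le_of_eq ?_)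
      rw [Finset.sum_const, Finset.card_range, nsmul_eq_mul, ← ENNReal.ofReal_natCast,
        ← ENNReal.ofReal_mul (by positivity)]
      congr 1
      push_cast
      field_simp
    have hlim : Tendsto (fun n : ℕ =>
        ENNReal.ofReal ((max lam 0 * (Real.pi * N ^ 2)) ^ 2 / ((n : ℝ) + 1))) atTop (𝓝 0) := by
      rw [← ENNReal.ofReal_zero]
      refine ENNReal.tendsto_ofReal ?_
      have := (tendsto_one_div_add_atTop_nhds_zero_nat (𝕜 := ℝ)).const_mul
        ((max lam 0 * (Real.pi * N ^ 2)) ^ 2)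
      simpa [div_eq_mul_inv] using this
    exact le_antisymm (ge_of_tendsto' hlim hbound) bot_le
  have hall : ∀ᵐ ω ∂P, ∀ N : ℕ, 0 < N →
      ¬ ∃ i j, i ≠ j ∧ ‖X i ω‖ = ‖X j ω‖ ∧ ‖X i ω‖ < N := by
    refine ae_all_iff.2 fun N => ?_
    by_cases hN : 0 < N
    · exact (measure_eq_zero_iff_ae_notMem.1 (key N hN)).mono fun ω hω _ => hω
    · exact ae_of_all _ fun ω h => absurd h hN
  filter_upwards [hall] with ω hω i j hij
  by_contra hne
  obtain ⟨N, hN⟩ := exists_nat_gt ‖X i ω‖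
  have hN0 : 0 < N := by
    have : (0 : ℝ) < N := (norm_nonneg _).trans_lt hN
    exact_mod_cast this
  exact hω N hN0 ⟨i, j, hne, hij, hN⟩

end Serving

/-! ### The joint law of the nearest distance and of a shot noise -/

section Tail

/-- The fundamental theorem of calculus for `exp (-∫ k)` with `k` bounded and measurable. -/
lemma integral_mul_exp_neg_integral {k : ℝ → ℝ} {a b M : ℝ} (hab : a ≤ b)
    (hk : Measurable k) (hk0 : ∀ x ∈ Icc a b, 0 ≤ k x) (hkM : ∀ x ∈ Icc a b, k x ≤ M) :
    ∫ x in a..b, k x * Real.exp (-∫ y in a..x, k y) =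
      1 - Real.exp (-∫ y in a..b, k y) := by
  have hM : 0 ≤ M := (hk0 a (left_mem_Icc.2 hab)).trans (hkM a (left_mem_Icc.2 hab))
  have hint : ∀ x ∈ Icc a b, ∀ y ∈ Icc a b, IntervalIntegrable k volume x y := by
    intro x hx y hy
    have hsub : uIcc x y ⊆ Icc a b := by
      rw [← uIcc_of_le hab] at hx hy ⊢
      exact uIcc_subset_uIcc hx hy
    refine (intervalIntegrable_const (c := M)).mono_fun hk.aestronglyMeasurable ?_
    filter_upwards [ae_restrict_mem measurableSet_uIoc] with z hz
    have hz' := hsub (uIoc_subset_uIcc hz)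
    rw [Real.norm_of_nonneg (hk0 z hz'), Real.norm_of_nonneg hM]
    exact hkM z hz'
  have ha : a ∈ Icc a b := left_mem_Icc.2 hab
  have hb : b ∈ Icc a b := right_mem_Icc.2 hab
  set F : ℝ → ℝ := fun x => ∫ y in a..x, k y with hF
  have hF0 : ∀ x ∈ Icc a b, 0 ≤ F x := fun x hx =>
    intervalIntegral.integral_nonneg hx.1 fun y hy => hk0 y ⟨hy.1, hy.2.trans hx.2⟩
  have hFle : ∀ x ∈ Icc a b, ∀ y ∈ Icc a b, x ≤ y → F x ≤ F y ∧ F y - F x ≤ M * (y - x) := by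
    intro x hx y hy hxy
    have h1 : F y - F x = ∫ z in x..y, k z :=
      intervalIntegral.integral_interval_sub_left (hint a ha y hy) (hint a ha x hx)
    have h2 : 0 ≤ ∫ z in x..y, k z := intervalIntegral.integral_nonneg hxy fun z hz =>
      hk0 z ⟨hx.1.trans hz.1, hz.2.trans hy.2⟩
    have h3 : ∫ z in x..y, k z ≤ ∫ z in x..y, M :=
      intervalIntegral.integral_mono_on hxy (hint x hx y hy) intervalIntegrable_const fun z hz =>
        hkM z ⟨hx.1.trans hz.1, hz.2.trans hy.2⟩
    rw [intervalIntegral.integral_const, smul_eq_mul] at h3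
    constructor <;> linarith
  -- `k` is only measurable, so `exp(-F)` need not be differentiable everywhere. Being Lipschitz it
  -- is absolutely continuous, and an almost everywhere derivative suffices.
  have hlip : LipschitzOnWith M.toNNReal (fun x => Real.exp (-F x)) (uIcc a b) := by
    rw [uIcc_of_le hab]
    have hord : ∀ x ∈ Icc a b, ∀ y ∈ Icc a b, x ≤ y →
        dist (Real.exp (-F x)) (Real.exp (-F y)) ≤ M * dist x y := by
      intro x hx y hy hxy
      obtain ⟨h1, h2⟩ := hFle x hx y hy hxy
      have h3 : Real.exp (-F y) ≤ Real.exp (-F x) := Real.exp_le_exp.2 (by linarith)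
      rw [Real.dist_eq, Real.dist_eq, abs_of_nonneg (by linarith), abs_sub_comm,
        abs_of_nonneg (by linarith)]
      refine le_trans ?_ h2
      have h4 : Real.exp (-F y) = Real.exp (-F x) * Real.exp (-(F y - F x)) := by
        rw [← Real.exp_add]
        congr 1
        ring
      have h5 := Real.add_one_le_exp (-(F y - F x))
      have h6 : Real.exp (-F x) ≤ 1 := Real.exp_le_one_iff.2 (by linarith [hF0 x hx])
      have h7 := Real.exp_pos (-F x)
      rw [h4]
      nlinarith
    refine LipschitzOnWith.of_dist_le_mul fun x hx y hy => ?_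
    rw [Real.coe_toNNReal _ hM]
    rcases le_total x y with h | h
    · exact hord x hx y hy h
    · rw [dist_comm, dist_comm x y]
      exact hord y hy x hx h
  have hac := hlip.absolutelyContinuousOnInterval
  have hder : ∀ᵐ x, x ∈ uIcc a b → HasDerivAt F (k x) x := by
    filter_upwards [(hint a ha b hb).ae_hasDerivAt_integral] with x hx h
    exact hx h a left_mem_uIcc
  have h1 := hac.integral_deriv_eq_sub
  have h2 : ∫ x in a..b, deriv (fun x => Real.exp (-F x)) x =
      ∫ x in a..b, -(k x * Real.exp (-F x)) := by
    refine intervalIntegral.integral_congr_ae ?_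
    filter_upwards [hder] with x hx h
    have h3 : HasDerivAt (fun x => Real.exp (-F x)) (Real.exp (-F x) * -k x) x :=
      (hx (uIoc_subset_uIcc h)).neg.exp
    rw [h3.deriv]
    ring
  rw [h2, intervalIntegral.integral_neg] at h1
  have h3 : F a = 0 := intervalIntegral.integral_same
  rw [h3, neg_zero, Real.exp_zero] at h1
  linarith

variable {w : ℝ → ℝ} {lam : ℝ}

/-- The exponent `πλr² + 2πλ ∫_r^∞ x (1 - w x) dx`. -/
def tailExponent (lam : ℝ) (w : ℝ → ℝ) (r : ℝ) : ℝ :=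
  Real.pi * lam * r ^ 2 + 2 * Real.pi * lam * ∫ x in Ioi r, x * (1 - w x)

lemma tailExponent_ge (hlam : 0 ≤ lam) (hw1 : ∀ x, w x ≤ 1) {r : ℝ} (hr : 0 ≤ r) :
    Real.pi * lam * r ^ 2 ≤ tailExponent lam w r := by
  have : 0 ≤ ∫ x in Ioi r, x * (1 - w x) := setIntegral_nonneg measurableSet_Ioi fun x hx =>
    mul_nonneg (hr.trans (le_of_lt hx)) (by linarith [hw1 x])
  have := Real.pi_pos
  rw [tailExponent]
  have : 0 ≤ 2 * Real.pi * lam * ∫ x in Ioi r, x * (1 - w x) := by positivity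
  linarith

/-- In `r`, the square contributes the derivative `2πλr` and the moving lower limit removes `2πλr(1
- w r)`, which leaves `2πλ r w r`. -/
lemma tailExponent_eq_add
    (hint : IntegrableOn (fun x => x * (1 - w x)) (Ioi 0)) {a r : ℝ} (ha : 0 ≤ a) (har : a ≤ r) :
    tailExponent lam w r = tailExponent lam w a + ∫ x in a..r, 2 * Real.pi * lam * x * w x := by
  have h1 : ∫ x in Ioi a, x * (1 - w x) =
      (∫ x in a..r, x * (1 - w x)) + ∫ x in Ioi r, x * (1 - w x) :=
    (intervalIntegral.integral_interval_add_Ioi (hint.mono_set (Ioi_subset_Ioi ha))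
      (hint.mono_set (Ioi_subset_Ioi (ha.trans har)))).symm
  have h2 : IntervalIntegrable (fun x => x * (1 - w x)) volume a r :=
    (intervalIntegrable_iff_integrableOn_Ioc_of_le har).2
      (hint.mono_set (Ioc_subset_Ioi_self.trans (Ioi_subset_Ioi ha)))
  have h3 : ∫ x in a..r, 2 * Real.pi * lam * x * w x =
      (∫ x in a..r, 2 * Real.pi * lam * x) -
        ∫ x in a..r, 2 * Real.pi * lam * (x * (1 - w x)) := by
    rw [← intervalIntegral.integral_sub (Continuous.intervalIntegrable (by fun_prop) _ _)
      (h2.const_mul _)]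
    congr 1
    ext x
    ring
  rw [h3, intervalIntegral.integral_const_mul, intervalIntegral.integral_const_mul, integral_id,
    tailExponent, tailExponent, h1]
  ring

lemma measurable_tailExponent (hw : Measurable w) : Measurable (tailExponent lam w) := by
  have h : Measurable fun r => ∫ x in Ioi r, x * (1 - w x) := by
    have h1 : (fun r => ∫ x in Ioi r, x * (1 - w x)) =
        fun r => ∫ x, {p : ℝ × ℝ | p.1 < p.2}.indicator (fun p => p.2 * (1 - w p.2)) (r, x) := by
      ext r
      rw [← integral_indicator measurableSet_Ioi]
      rfl
    rw [h1]
    have h2 : Measurable ({p : ℝ × ℝ | p.1 < p.2}.indicator (fun p => p.2 * (1 - w p.2))) :=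
      Measurable.indicator (by fun_prop) (measurableSet_lt measurable_fst measurable_snd)
    exact h2.stronglyMeasurable.integral_prod_right'.measurable
  unfold tailExponent
  fun_prop

/-- The integrand is minus the derivative of `exp(-tailExponent)`, which vanishes at infinity. -/
lemma setLIntegral_Ioi_tail (hlam : 0 < lam) (hw : Measurable w) (hw0 : ∀ x, 0 < w x)
    (hw1 : ∀ x, w x ≤ 1) (hint : IntegrableOn (fun x => x * (1 - w x)) (Ioi 0)) {a : ℝ}
    (ha : 0 ≤ a) :
    ∫⁻ r in Ioi a, ENNReal.ofReal
      (2 * Real.pi * lam * r * w r * Real.exp (-tailExponent lam w r)) =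
      ENNReal.ofReal (Real.exp (-tailExponent lam w a)) := by
  have hpi := Real.pi_pos
  set k : ℝ → ℝ := fun x => 2 * Real.pi * lam * x * w x with hk
  have hkm : Measurable k := by fun_prop
  have hk0 : ∀ x, 0 ≤ x → 0 ≤ k x := fun x hx => by
    have := (hw0 x).le
    positivity
  have hKm := measurable_tailExponent (lam := lam) hw
  have hfin : ∀ R, a ≤ R → ∫⁻ r in Ioc a R, ENNReal.ofReal
      (k r * Real.exp (-tailExponent lam w r)) =
      ENNReal.ofReal (Real.exp (-tailExponent lam w a) - Real.exp (-tailExponent lam w R)) := by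
    intro R hR
    have h1 := integral_mul_exp_neg_integral (k := k) (M := 2 * Real.pi * lam * R) hR hkm
      (fun x hx => hk0 x (ha.trans hx.1)) (fun x hx => by
        have hx0 := ha.trans hx.1
        have h2 : 2 * Real.pi * lam * x ≤ 2 * Real.pi * lam * R := by
          have := hx.2
          gcongr
        have h3 : 0 ≤ 2 * Real.pi * lam * x := by positivity
        simp only [hk]
        nlinarith [hw1 x])
    have h2 : ∀ x ∈ Icc a R, Real.exp (-tailExponent lam w x) =
        Real.exp (-tailExponent lam w a) * Real.exp (-∫ y in a..x, k y) := by
      intro x hx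
      rw [tailExponent_eq_add hint ha hx.1, ← Real.exp_add]
      congr 1
      ring
    rw [← ofReal_integral_eq_lintegral_ofReal]
    · rw [← intervalIntegral.integral_of_le hR]
      congr 1
      calc ∫ x in a..R, k x * Real.exp (-tailExponent lam w x)
          = ∫ x in a..R, Real.exp (-tailExponent lam w a) *
              (k x * Real.exp (-∫ y in a..x, k y)) := by
            refine intervalIntegral.integral_congr fun x hx => ?_
            rw [uIcc_of_le hR] at hx
            simp only [h2 x hx]
            ring
        _ = _ := by
            rw [intervalIntegral.integral_const_mul, h1, h2 R (right_mem_Icc.2 hR)]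
            ring
    · refine Measure.integrableOn_of_bounded (M := 2 * Real.pi * lam * R)
        (by simp) (by fun_prop) ?_
      filter_upwards [ae_restrict_mem measurableSet_Ioc] with x hx
      have hx0 := ha.trans hx.1.le
      rw [Real.norm_of_nonneg (mul_nonneg (hk0 x hx0) (Real.exp_pos _).le)]
      have h3 : Real.exp (-tailExponent lam w x) ≤ 1 := by
        refine Real.exp_le_one_iff.2 (neg_nonpos.2 (le_trans ?_ (tailExponent_ge hlam.le hw1 hx0)))
        positivity
      have h4 : k x ≤ 2 * Real.pi * lam * R := by
        have h2 : 2 * Real.pi * lam * x ≤ 2 * Real.pi * lam * R := by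
          have := hx.2
          gcongr
        have h3 : 0 ≤ 2 * Real.pi * lam * x := by positivity
        simp only [hk]
        nlinarith [hw1 x]
      calc k x * Real.exp (-tailExponent lam w x) ≤ k x * 1 := by
            have := hk0 x hx0
            gcongr
        _ ≤ _ := by rwa [mul_one]
    · filter_upwards [ae_restrict_mem measurableSet_Ioc] with x hx
      exact mul_nonneg (hk0 x (ha.trans hx.1.le)) (Real.exp_pos _).le
  have hcov : AECover (volume.restrict (Ioi a)) atTop fun n : ℕ => Iic (n : ℝ) :=
    aecover_Iic tendsto_natCast_atTop_atTop
  refine hcov.lintegral_eq_of_tendsto _ (by fun_prop) ?_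
  have hlim : Tendsto (fun n : ℕ => ENNReal.ofReal
      (Real.exp (-tailExponent lam w a) - Real.exp (-tailExponent lam w n))) atTop
      (𝓝 (ENNReal.ofReal (Real.exp (-tailExponent lam w a)))) := by
    refine ENNReal.tendsto_ofReal ?_
    have h1 : Tendsto (fun n : ℕ => tailExponent lam w n) atTop atTop := by
      refine tendsto_atTop_mono (fun n => tailExponent_ge hlam.le hw1 n.cast_nonneg) ?_
      have h2 : Tendsto (fun x : ℝ => x ^ 2) atTop atTop := tendsto_pow_atTop two_ne_zero
      exact (h2.comp tendsto_natCast_atTop_atTop).const_mul_atTop (by positivity)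
    have h2 := (Real.tendsto_exp_neg_atTop_nhds_zero.comp h1).const_sub
      (Real.exp (-tailExponent lam w a))
    simpa using h2
  refine hlim.congr' ?_
  obtain ⟨N, hN⟩ := exists_nat_ge a
  filter_upwards [eventually_ge_atTop N] with n hn
  have han : a ≤ n := hN.trans (by exact_mod_cast hn)
  rw [Measure.restrict_restrict measurableSet_Iic, inter_comm, Ioi_inter_Iic, hfin n han]

variable {Ω : Type*} [MeasurableSpace Ω] {P : Measure Ω} {X : ℕ → Ω → Plane}

/-- `-log w` as an element of `[0, ∞]`. -/
def negLog (w : ℝ → ℝ) (r : ℝ) : ENNReal := ENNReal.ofReal (-Real.log (w r))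

lemma measurable_negLog (hw : Measurable w) : Measurable (negLog w) := by
  unfold negLog
  fun_prop

lemma expNeg_negLog {r : ℝ} (hw0 : 0 < w r) (hw1 : w r ≤ 1) :
    expNeg (negLog w r) = ENNReal.ofReal (w r) := by
  rw [negLog, expNeg_ofReal (neg_nonneg.2 (Real.log_nonpos hw0.le hw1)), neg_neg,
    Real.exp_log hw0]

/-- Giving weight `⊤` to points nearer than `a` encodes the event `a ≤ servingDist`: one such point
makes `expNeg` of the sum vanish. The Laplace functional then sees `1` inside the disc, whence
`πλa²`, and `1 - w` outside. -/
lemma IsPoissonProcess.lintegral_indicator_expNeg_tsum [IsProbabilityMeasure P]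
    (hX : IsPoissonProcess P X lam) (hlam : 0 < lam) (hw : Measurable w) (hw0 : ∀ x, 0 < w x)
    (hw1 : ∀ x, w x ≤ 1) (hint : IntegrableOn (fun x => x * (1 - w x)) (Ioi 0)) {a : ℝ}
    (ha : 0 ≤ a) :
    ∫⁻ ω, {ω | a ≤ servingDist X ω}.indicator
      (fun ω => expNeg (∑' i, negLog w ‖X i ω‖)) ω ∂P =
      ENNReal.ofReal (Real.exp (-tailExponent lam w a)) := by
  have hpi := Real.pi_pos
  set v : ℝ → ENNReal := fun r => if r < a then ⊤ else negLog w r with hv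
  have hvm : Measurable v :=
    Measurable.ite measurableSet_Iio measurable_const (measurable_negLog hw)
  have h1 : ∫⁻ ω, {ω | a ≤ servingDist X ω}.indicator
      (fun ω => expNeg (∑' i, negLog w ‖X i ω‖)) ω ∂P =
      ∫⁻ ω, expNeg (∑' i, v ‖X i ω‖) ∂P := by
    refine lintegral_congr_ae ?_
    filter_upwards [hX.ae_forall_servingDist_le] with ω hω
    by_cases h : a ≤ servingDist X ω
    · rw [indicator_of_mem (s := {ω | a ≤ servingDist X ω}) h]
      congr 1
      refine tsum_congr fun i => ?_
      simp [hv, not_lt.2 (h.trans (hω i))]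
    · rw [indicator_of_notMem (s := {ω | a ≤ servingDist X ω}) h]
      have : ∑' i, v ‖X i ω‖ = ⊤ :=
        ENNReal.tsum_eq_top_of_eq_top ⟨servingIndex X ω, if_pos (not_le.1 h)⟩
      rw [this, expNeg_top]
  rw [h1, hX.lintegral_expNeg_tsum (v := fun x => v ‖x‖) (hvm.comp measurable_norm),
    lintegral_norm_plane (f := fun r => 1 - expNeg (v r)) (hvm.expNeg.const_sub 1),
    ← Ioc_union_Ioi_eq_Ioi ha, lintegral_union measurableSet_Ioi
      (Set.disjoint_left.2 fun x hx hx' => not_lt.2 hx.2 hx')]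
  have h2 : ∫⁻ r in Ioc 0 a, ENNReal.ofReal (2 * Real.pi * r) * (1 - expNeg (v r)) =
      ENNReal.ofReal (Real.pi * a ^ 2) := by
    have h3 : ∫⁻ r in Ioc 0 a, ENNReal.ofReal (2 * Real.pi * r) * (1 - expNeg (v r)) =
        ∫⁻ r in Ioc 0 a, ENNReal.ofReal (2 * Real.pi * r) := by
      -- Only the endpoint `r = a` fails the strict inequality in `v`; it is a null set.
      refine setLIntegral_congr_fun_ae measurableSet_Ioc ?_
      filter_upwards [Measure.ae_ne volume a] with r hr hr'
      simp [hv, lt_of_le_of_ne hr'.2 hr]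
    rw [h3, setLIntegral_Ioc_two_pi_mul le_rfl ha]
    simp
  have h3 : ∫⁻ r in Ioi a, ENNReal.ofReal (2 * Real.pi * r) * (1 - expNeg (v r)) =
      ENNReal.ofReal (2 * Real.pi * ∫ r in Ioi a, r * (1 - w r)) := by
    rw [← integral_const_mul, ofReal_integral_eq_lintegral_ofReal]
    · refine setLIntegral_congr_fun measurableSet_Ioi fun r hr => ?_
      have hr0 : 0 ≤ r := ha.trans (le_of_lt hr)
      have hva : v r = negLog w r := if_neg (not_lt.2 (le_of_lt hr))
      simp only [hva]
      rw [expNeg_negLog (hw0 r) (hw1 r), ← ENNReal.ofReal_one,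
        ← ENNReal.ofReal_sub _ (hw0 r).le, ← ENNReal.ofReal_mul (by positivity)]
      congr 1
      ring
    · exact (hint.mono_set (Ioi_subset_Ioi ha)).const_mul _
    · filter_upwards [ae_restrict_mem measurableSet_Ioi] with r hr
      have hr0 : 0 ≤ r := ha.trans (le_of_lt hr)
      have : 0 ≤ 1 - w r := by linarith [hw1 r]
      simp only [Pi.zero_apply]
      positivity
  have h4 : 0 ≤ ∫ x in Ioi a, x * (1 - w x) := setIntegral_nonneg measurableSet_Ioi fun x hx =>
    mul_nonneg (ha.trans (le_of_lt hx)) (by linarith [hw1 x])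
  rw [h2, h3, ← ENNReal.ofReal_add (by positivity) (by positivity),
    ← ENNReal.ofReal_mul hlam.le, expNeg_ofReal (by positivity), tailExponent]
  congr 3
  ring

/-- The joint law of the distance of the serving base station and of a shot noise of the other
base stations. -/
theorem IsPoissonProcess.lintegral_servingDist_expNeg [IsProbabilityMeasure P]
    (hX : IsPoissonProcess P X lam) (hlam : 0 < lam) (hw : Measurable w) (hw0 : ∀ x, 0 < w x)
    (hw1 : ∀ x, w x ≤ 1) (hint : IntegrableOn (fun x => x * (1 - w x)) (Ioi 0))
    {G : ℝ → ENNReal} (hG : Measurable G) :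
    ∫⁻ ω, G (servingDist X ω) *
      expNeg (∑' i, if servingDist X ω < ‖X i ω‖ then negLog w ‖X i ω‖ else 0) ∂P =
      ∫⁻ r in Ioi (0 : ℝ), G r * ENNReal.ofReal
        (2 * Real.pi * lam * r * Real.exp (-tailExponent lam w r)) := by
  have hpi := Real.pi_pos
  have hdm := measurable_servingDist hX.measurable
  have hKm := measurable_tailExponent (lam := lam) hw
  set S : Ω → ENNReal := fun ω => expNeg (∑' i, negLog w ‖X i ω‖) with hS
  have hSm : Measurable S :=
    (Measurable.tsum fun i => (measurable_negLog hw).comp (hX.measurable i).norm).expNeg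
  set D : ℝ → ENNReal := fun r => ENNReal.ofReal
    (2 * Real.pi * lam * r * w r * Real.exp (-tailExponent lam w r)) with hD
  have hDm : Measurable D := by fun_prop
  -- The law of the serving distance under `P` weighted by the full shot noise is identified by its
  -- tails, here and for the candidate density `D`.
  have hIci : ∀ a : ℝ, 0 ≤ a → (P.withDensity S).map (servingDist X) (Ici a) =
      ENNReal.ofReal (Real.exp (-tailExponent lam w a)) := by
    intro a ha
    have hms : MeasurableSet {ω | a ≤ servingDist X ω} := measurableSet_le measurable_const hdm
    rw [Measure.map_apply hdm measurableSet_Ici, withDensity_apply _ (hdm measurableSet_Ici),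
      ← hX.lintegral_indicator_expNeg_tsum hlam hw hw0 hw1 hint ha, lintegral_indicator hms]
    rfl
  have hIci' : ∀ a : ℝ, 0 ≤ a → ((volume.restrict (Ioi 0)).withDensity D) (Ici a) =
      ENNReal.ofReal (Real.exp (-tailExponent lam w a)) := by
    intro a ha
    rw [← setLIntegral_Ioi_tail hlam hw hw0 hw1 hint ha, withDensity_apply _ measurableSet_Ici,
      Measure.restrict_restrict measurableSet_Ici]
    refine setLIntegral_congr ((ae_eq_set_inter (ae_eq_refl _) Ioi_ae_eq_Ici).trans ?_)
    rw [Ici_inter_Ici, max_eq_left ha]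
    exact Ioi_ae_eq_Ici.symm
  have hneg : ∀ a : ℝ, a ≤ 0 → (P.withDensity S).map (servingDist X) (Ici a) =
      (P.withDensity S).map (servingDist X) (Ici 0) := by
    intro a ha
    rw [Measure.map_apply hdm measurableSet_Ici, Measure.map_apply hdm measurableSet_Ici]
    congr 1
    ext ω
    have : 0 ≤ servingDist X ω := norm_nonneg _
    simp [this, ha.trans this]
  have hneg' : ∀ a : ℝ, a ≤ 0 → ((volume.restrict (Ioi 0)).withDensity D) (Ici a) =
      ((volume.restrict (Ioi 0)).withDensity D) (Ici 0) := by
    intro a ha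
    rw [withDensity_apply _ measurableSet_Ici, withDensity_apply _ measurableSet_Ici,
      Measure.restrict_restrict measurableSet_Ici, Measure.restrict_restrict measurableSet_Ici]
    congr 2
    ext x
    simp only [mem_inter_iff, mem_Ici, mem_Ioi]
    constructor
    · rintro ⟨_, h⟩
      exact ⟨h.le, h⟩
    · rintro ⟨h, h'⟩
      exact ⟨ha.trans h, h'⟩
  have hfin : IsFiniteMeasure (P.withDensity S) := isFiniteMeasure_withDensity (by
    have : ∫⁻ ω, S ω ∂P ≤ ∫⁻ _, 1 ∂P := lintegral_mono fun ω => expNeg_le_one _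
    rw [lintegral_one, measure_univ] at this
    exact (this.trans_lt ENNReal.one_lt_top).ne)
  have hmeas : (P.withDensity S).map (servingDist X) = (volume.restrict (Ioi 0)).withDensity D := by
    refine Measure.ext_of_Ici _ _ fun a => ?_
    rcases le_total 0 a with ha | ha
    · rw [hIci a ha, hIci' a ha]
    · rw [hneg a ha, hneg' a ha, hIci 0 le_rfl, hIci' 0 le_rfl]
  -- The full shot noise contains the factor `w` of the serving station itself. It is divided out
  -- here, which is possible since `w > 0`.
  set H : ℝ → ENNReal := fun r => G r * (ENNReal.ofReal (w r))⁻¹ with hH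
  have hHm : Measurable H := hG.mul (by fun_prop)
  have hwr0 : ∀ r, ENNReal.ofReal (w r) ≠ 0 := fun r => (ENNReal.ofReal_pos.2 (hw0 r)).ne'
  have h1 : ∫⁻ r, H r ∂((P.withDensity S).map (servingDist X)) =
      ∫⁻ ω, G (servingDist X ω) *
        expNeg (∑' i, if servingDist X ω < ‖X i ω‖ then negLog w ‖X i ω‖ else 0) ∂P := by
    rw [lintegral_map hHm hdm, lintegral_withDensity_eq_lintegral_mul _ hSm
      (g := fun ω => H (servingDist X ω)) (hHm.comp hdm)]
    refine lintegral_congr_ae ?_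
    filter_upwards [hX.ae_forall_servingDist_le, hX.ae_injective_norm] with ω hω hinj
    -- Distances are almost surely distinct, so every station other than the serving one is strictly
    -- farther away and the sum loses exactly one term.
    have h2 : ∑' i, negLog w ‖X i ω‖ = negLog w (servingDist X ω) +
        ∑' i, if servingDist X ω < ‖X i ω‖ then negLog w ‖X i ω‖ else 0 := by
      have h3 : ∀ i, negLog w ‖X i ω‖ =
          (if i = servingIndex X ω then negLog w (servingDist X ω) else 0) +
          if servingDist X ω < ‖X i ω‖ then negLog w ‖X i ω‖ else 0 := by
        intro i
        by_cases hi : i = servingIndex X ω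
        · subst hi
          simp [servingDist]
        · have : servingDist X ω < ‖X i ω‖ :=
            lt_of_le_of_ne (hω i) fun h => hi (hinj h).symm
          simp [hi, this]
      rw [tsum_congr h3, ENNReal.tsum_add, tsum_ite_eq]
    simp only [Pi.mul_apply, hS, hH]
    rw [h2, expNeg_add, expNeg_negLog (hw0 _) (hw1 _)]
    have h4 := ENNReal.mul_inv_cancel (hwr0 (servingDist X ω)) ENNReal.ofReal_ne_top
    calc _ = (ENNReal.ofReal (w (servingDist X ω)) * (ENNReal.ofReal (w (servingDist X ω)))⁻¹) *
          (G (servingDist X ω) * expNeg (∑' i, if servingDist X ω < ‖X i ω‖ then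
            negLog w ‖X i ω‖ else 0)) := by ring
      _ = _ := by rw [h4, one_mul]
  rw [← h1, hmeas, lintegral_withDensity_eq_lintegral_mul _ hDm hHm]
  refine setLIntegral_congr_fun measurableSet_Ioi fun r hr => ?_
  have hr0 : 0 ≤ r := le_of_lt hr
  have h4 := ENNReal.mul_inv_cancel (hwr0 r) ENNReal.ofReal_ne_top
  have h5 : D r = ENNReal.ofReal (2 * Real.pi * lam * r * Real.exp (-tailExponent lam w r)) *
      ENNReal.ofReal (w r) := by
    rw [← ENNReal.ofReal_mul (by positivity)]
    simp only [hD]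
    congr 1
    ring
  simp only [Pi.mul_apply, hH]
  rw [h5]
  calc _ = (ENNReal.ofReal (w r) * (ENNReal.ofReal (w r))⁻¹) *
        (G r * ENNReal.ofReal (2 * Real.pi * lam * r * Real.exp (-tailExponent lam w r))) := by ring
    _ = _ := by rw [h4, one_mul]

end Tail

/-! ### The loss transform of a link -/

section LossTransform

variable {S : Type*} [MeasurableSpace S] {μ : Measure ℝ} {ν : Measure S} {L : ℝ → S → ℝ} {L₀ : ℝ}

/-- `E[1 - exp(-h t L(x))]`. -/
def lossTransform (μ : Measure ℝ) (ν : Measure S) (L : ℝ → S → ℝ) (t x : ℝ) : ℝ :=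
  ∫ p : ℝ × S, (1 - Real.exp (-(p.1 * t * L x p.2))) ∂(μ.prod ν)

/-- `E[L(x)]`. -/
def meanLoss (ν : Measure S) (L : ℝ → S → ℝ) (x : ℝ) : ℝ := ∫ s, L x s ∂ν

lemma IsFeasiblePathLoss.measurable_apply (hL : IsFeasiblePathLoss ν L L₀) (x : ℝ) :
    Measurable (L x) := hL.measurable.comp measurable_prodMk_left

lemma measurable_lossTransform_uncurry (hμ : IsFadingLaw μ) (hL : IsFeasiblePathLoss ν L L₀) :
    Measurable (fun q : ℝ × ℝ => lossTransform μ ν L q.1 q.2) := by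
  have := hμ.prob
  have := hL.prob
  have h1 : Measurable fun r : (ℝ × ℝ) × (ℝ × S) => L r.1.2 r.2.2 :=
    hL.measurable.comp ((measurable_snd.comp measurable_fst).prodMk
      (measurable_snd.comp measurable_snd))
  have h2 : Measurable fun r : (ℝ × ℝ) × (ℝ × S) =>
      1 - Real.exp (-(r.2.1 * r.1.1 * L r.1.2 r.2.2)) :=
    (((measurable_fst.comp measurable_snd).mul
      (measurable_fst.comp measurable_fst)).mul h1).neg.exp.const_sub 1
  exact (h2.stronglyMeasurable.integral_prod_right' (ν := μ.prod ν)).measurable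

lemma measurable_lossTransform (hμ : IsFadingLaw μ) (hL : IsFeasiblePathLoss ν L L₀) (t : ℝ) :
    Measurable (lossTransform μ ν L t) :=
  (measurable_lossTransform_uncurry hμ hL).comp measurable_prodMk_left

lemma ae_nonneg_fading_and_loss (hμ : IsFadingLaw μ) (hL : IsFeasiblePathLoss ν L L₀) {x : ℝ}
    (hx : 0 ≤ x) : ∀ᵐ p ∂(μ.prod ν), 0 ≤ p.1 ∧ 0 ≤ L x p.2 ∧ L x p.2 ≤ L₀ := by
  have := hμ.prob
  have := hL.prob
  filter_upwards [Measure.quasiMeasurePreserving_fst.ae hμ.nonneg,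
    Measure.quasiMeasurePreserving_snd.ae (hL.nonneg x hx),
    Measure.quasiMeasurePreserving_snd.ae (hL.le_at_zero x hx)] with p h1 h2 h3
  exact ⟨h1, h2, h3⟩

lemma integrable_loss (hL : IsFeasiblePathLoss ν L L₀) {x : ℝ} (hx : 0 ≤ x) :
    Integrable (L x) ν := by
  have := hL.prob
  refine Integrable.of_bound (hL.measurable_apply x).aestronglyMeasurable L₀ ?_
  filter_upwards [hL.nonneg x hx, hL.le_at_zero x hx] with s h1 h2
  rwa [Real.norm_of_nonneg h1]

lemma integrable_fading_mul_loss (hμ : IsFadingLaw μ) (hL : IsFeasiblePathLoss ν L L₀) {x : ℝ}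
    (hx : 0 ≤ x) : Integrable (fun p : ℝ × S => p.1 * L x p.2) (μ.prod ν) := by
  have := hμ.prob
  have := hL.prob
  exact hμ.integrable.mul_prod (integrable_loss hL hx)

lemma integral_fading_mul_loss (hμ : IsFadingLaw μ) (x : ℝ) [SFinite ν] :
    ∫ p : ℝ × S, p.1 * L x p.2 ∂(μ.prod ν) = meanLoss ν L x := by
  have := hμ.prob
  rw [integral_prod_mul (fun h : ℝ => h) (L x), hμ.mean_one, one_mul]
  rfl

lemma one_sub_exp_neg_le (y : ℝ) : 1 - Real.exp (-y) ≤ y := by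
  linarith [Real.add_one_le_exp (-y)]

lemma integrable_one_sub_exp (hμ : IsFadingLaw μ) (hL : IsFeasiblePathLoss ν L L₀) {t x : ℝ}
    (ht : 0 ≤ t) (hx : 0 ≤ x) :
    Integrable (fun p : ℝ × S => 1 - Real.exp (-(p.1 * t * L x p.2))) (μ.prod ν) := by
  have := hμ.prob
  have := hL.prob
  have hLm := hL.measurable_apply x
  refine Integrable.of_bound (C := 1) (by fun_prop) ?_
  filter_upwards [ae_nonneg_fading_and_loss hμ hL hx] with p hp
  have h1 : 0 ≤ p.1 * t * L x p.2 := mul_nonneg (mul_nonneg hp.1 ht) hp.2.1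
  have h2 : Real.exp (-(p.1 * t * L x p.2)) ≤ 1 := Real.exp_le_one_iff.2 (by linarith)
  have h3 := Real.exp_pos (-(p.1 * t * L x p.2))
  rw [Real.norm_of_nonneg (by linarith)]
  linarith

lemma lossTransform_nonneg (hμ : IsFadingLaw μ) (hL : IsFeasiblePathLoss ν L L₀) {t x : ℝ}
    (ht : 0 ≤ t) (hx : 0 ≤ x) : 0 ≤ lossTransform μ ν L t x := by
  have := hμ.prob
  have := hL.prob
  refine integral_nonneg_of_ae ?_
  filter_upwards [ae_nonneg_fading_and_loss hμ hL hx] with p hp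
  have h1 : 0 ≤ p.1 * t * L x p.2 := mul_nonneg (mul_nonneg hp.1 ht) hp.2.1
  have h2 : Real.exp (-(p.1 * t * L x p.2)) ≤ 1 := Real.exp_le_one_iff.2 (by linarith)
  simp only [Pi.zero_apply]
  linarith

lemma lossTransform_le (hμ : IsFadingLaw μ) (hL : IsFeasiblePathLoss ν L L₀) {t x : ℝ}
    (ht : 0 ≤ t) (hx : 0 ≤ x) : lossTransform μ ν L t x ≤ t * meanLoss ν L x := by
  have := hμ.prob
  have := hL.prob
  rw [← integral_fading_mul_loss (L := L) hμ x, ← integral_const_mul]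
  refine integral_mono (integrable_one_sub_exp hμ hL ht hx)
    ((integrable_fading_mul_loss hμ hL hx).const_mul t) fun p => ?_
  refine (one_sub_exp_neg_le _).trans (le_of_eq ?_)
  ring

lemma lintegral_expNeg_fading_mul_loss (hμ : IsFadingLaw μ) (hL : IsFeasiblePathLoss ν L L₀)
    {t x : ℝ} (ht : 0 ≤ t) (hx : 0 ≤ x) :
    ∫⁻ p : ℝ × S, expNeg (ENNReal.ofReal t * ENNReal.ofReal (p.1 * L x p.2)) ∂(μ.prod ν) =
      ENNReal.ofReal (1 - lossTransform μ ν L t x) := by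
  have := hμ.prob
  have := hL.prob
  have hint := integrable_one_sub_exp hμ hL ht hx
  have h1 : 1 - lossTransform μ ν L t x =
      ∫ p : ℝ × S, Real.exp (-(p.1 * t * L x p.2)) ∂(μ.prod ν) := by
    have h2 : ∫ p : ℝ × S, (1 - (1 - Real.exp (-(p.1 * t * L x p.2)))) ∂(μ.prod ν) =
        1 - lossTransform μ ν L t x := by
      rw [integral_sub (integrable_const _) hint]
      simp [lossTransform]
    rw [← h2]
    simp
  have h3 : Integrable (fun p : ℝ × S => Real.exp (-(p.1 * t * L x p.2))) (μ.prod ν) := by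
    refine ((integrable_const (1 : ℝ)).sub hint).congr (ae_of_all _ fun p => ?_)
    simp
  rw [h1, ofReal_integral_eq_lintegral_ofReal h3 (ae_of_all _ fun p => (Real.exp_pos _).le)]
  refine lintegral_congr_ae ?_
  filter_upwards [ae_nonneg_fading_and_loss hμ hL hx] with p hp
  have h4 : 0 ≤ p.1 * L x p.2 := mul_nonneg hp.1 hp.2.1
  rw [← ENNReal.ofReal_mul ht, expNeg_ofReal (mul_nonneg ht h4)]
  congr 3
  ring

/-- A positive integrand cannot have mean zero. Strictness matters because the Poisson identities
take the logarithm of `1 - lossTransform`. -/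
lemma lossTransform_lt_one (hμ : IsFadingLaw μ) (hL : IsFeasiblePathLoss ν L L₀)
    {t x : ℝ} (ht : 0 ≤ t) (hx : 0 ≤ x) : lossTransform μ ν L t x < 1 := by
  have := hμ.prob
  have := hL.prob
  have hLm := hL.measurable_apply x
  by_contra! h
  have h1 := lintegral_expNeg_fading_mul_loss hμ hL ht hx
  rw [ENNReal.ofReal_of_nonpos (sub_nonpos.2 h), lintegral_eq_zero_iff (by fun_prop)] at h1
  obtain ⟨p, hp⟩ := h1.exists
  replace hp : expNeg (ENNReal.ofReal t * ENNReal.ofReal (p.1 * L x p.2)) = 0 := hp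
  rw [← ENNReal.ofReal_mul ht] at hp
  rcases le_total 0 (t * (p.1 * L x p.2)) with h2 | h2
  · rw [expNeg_ofReal h2] at hp
    exact (ENNReal.ofReal_pos.2 (Real.exp_pos _)).ne' hp
  · rw [ENNReal.ofReal_of_nonpos h2] at hp
    simp at hp

lemma integrable_loss_prod_swap (hL : IsFeasiblePathLoss ν L L₀) :
    Integrable (fun p : ℝ × S => p.1 * L p.1 p.2) ((volume.restrict (Ioi (0 : ℝ))).prod ν) := by
  have := hL.prob
  exact hL.integrable.swap

lemma integrableOn_mul_meanLoss (hL : IsFeasiblePathLoss ν L L₀) :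
    IntegrableOn (fun x => x * meanLoss ν L x) (Ioi 0) := by
  have := hL.prob
  have h := (integrable_loss_prod_swap hL).integral_prod_left
  simpa only [integral_const_mul, meanLoss, IntegrableOn] using h

lemma integral_mul_meanLoss (hL : IsFeasiblePathLoss ν L L₀) :
    ∫ x in Ioi (0 : ℝ), x * meanLoss ν L x = gamma ν L := by
  have := hL.prob
  rw [gamma, integral_integral_swap hL.integrable]
  simp only [meanLoss, integral_const_mul]

lemma integrableOn_mul_lossTransform (hμ : IsFadingLaw μ) (hL : IsFeasiblePathLoss ν L L₀)
    {t : ℝ} (ht : 0 ≤ t) : IntegrableOn (fun x => x * lossTransform μ ν L t x) (Ioi 0) := by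
  have hm := measurable_lossTransform hμ hL t
  refine ((integrableOn_mul_meanLoss hL).const_mul t).mono' (by fun_prop) ?_
  filter_upwards [ae_restrict_mem measurableSet_Ioi] with x hx
  have hx0 : 0 ≤ x := le_of_lt hx
  have h1 := lossTransform_nonneg hμ hL ht hx0
  rw [Real.norm_of_nonneg (mul_nonneg hx0 h1)]
  calc x * lossTransform μ ν L t x ≤ x * (t * meanLoss ν L x) := by
        have := lossTransform_le hμ hL ht hx0
        gcongr
    _ = _ := by ring

end LossTransform

/-! ### Averaging over the marks -/

section Marks

variable {Ω : Type*} [MeasurableSpace Ω] {P : Measure Ω}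

/-- The serving index and the set of farther stations depend on positions only. With the positions
frozen, the integrand is an infinite product of functions of independent marks and can be averaged
factor by factor; the serving mark enters through `g` alone, since a station is not strictly farther
than itself. -/
lemma lintegral_serving_mark {M : Type*} [MeasurableSpace M] {π : Measure M}
    [IsProbabilityMeasure P] {X : ℕ → Ω → Plane} {Z : ℕ → Ω → M} (hX : ∀ i, Measurable (X i))
    (hZ : ∀ i, Measurable (Z i)) (hlaw : ∀ i, P.map (Z i) = π) (hind : iIndepFun Z P)
    (hXZ : IndepFun (fun ω i => X i ω) (fun ω i => Z i ω) P)
    {q : ℝ → M → ENNReal} (hq : Measurable (Function.uncurry q)) {v : ℝ → ENNReal}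
    (hv : ∀ r, 0 ≤ r → ∫⁻ m, expNeg (q r m) ∂π = expNeg (v r))
    {g : ℝ → M → ENNReal} (hg : Measurable (Function.uncurry g)) (hg1 : ∀ r m, g r m ≤ 1) :
    ∫⁻ ω, g (servingDist X ω) (Z (servingIndex X ω) ω) *
      expNeg (∑' i, if servingDist X ω < ‖X i ω‖ then q ‖X i ω‖ (Z i ω) else 0) ∂P =
    ∫⁻ ω, (∫⁻ m, g (servingDist X ω) m ∂π) *
      expNeg (∑' i, if servingDist X ω < ‖X i ω‖ then v ‖X i ω‖ else 0) ∂P := by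
  set Y : Ω → ℕ → Plane := fun ω i => X i ω with hY
  set W : Ω → ℕ → M := fun ω i => Z i ω with hW
  have hYm : Measurable Y := measurable_pi_iff.2 hX
  have hWm : Measurable W := measurable_pi_iff.2 hZ
  -- The coordinate process on sequence space: it turns the integrand into a measurable function of
  -- the position sequence and the mark sequence, so that Fubini can separate them.
  let C' : ℕ → ((ℕ → Plane) × (ℕ → M)) → Plane := fun i p => p.1 i
  have hC' : ∀ i, Measurable (C' i) := fun i => (measurable_pi_apply i).comp measurable_fst
  set F : (ℕ → Plane) × (ℕ → M) → ENNReal := fun p =>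
    g (servingDist C' p) (p.2 (servingIndex C' p)) *
      expNeg (∑' i, if servingDist C' p < ‖C' i p‖ then q ‖C' i p‖ (p.2 i) else 0) with hF
  have hFm : Measurable F := by
    refine Measurable.mul ?_ (Measurable.expNeg (Measurable.tsum fun i => ?_))
    · exact hg.comp ((measurable_servingDist hC').prodMk
        (measurable_comp_servingIndex (f := fun i p => p.2 i) hC'
          fun i => (measurable_pi_apply i).comp measurable_snd))
    · refine Measurable.ite (measurableSet_lt (measurable_servingDist hC') (hC' i).norm) ?_
        measurable_const
      exact hq.comp ((hC' i).norm.prodMk ((measurable_pi_apply i).comp measurable_snd))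
  have hprod := (indepFun_iff_map_prod_eq_prod_map_map hYm.aemeasurable hWm.aemeasurable).1 hXZ
  have := Measure.isProbabilityMeasure_map (μ := P) hWm.aemeasurable
  have h1 : ∫⁻ ω, g (servingDist X ω) (Z (servingIndex X ω) ω) *
      expNeg (∑' i, if servingDist X ω < ‖X i ω‖ then q ‖X i ω‖ (Z i ω) else 0) ∂P =
      ∫⁻ ω, ∫⁻ ω', F (Y ω, W ω') ∂P ∂P := by
    calc _ = ∫⁻ ω, F (Y ω, W ω) ∂P := rfl
      _ = ∫⁻ p, F p ∂(P.map fun ω => (Y ω, W ω)) := by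
          rw [lintegral_map hFm (hYm.prodMk hWm)]
      _ = ∫⁻ y, ∫⁻ z, F (y, z) ∂(P.map W) ∂(P.map Y) := by
          rw [hprod, lintegral_prod _ hFm.aemeasurable]
      _ = ∫⁻ ω, ∫⁻ z, F (Y ω, z) ∂(P.map W) ∂P := by
          rw [lintegral_map (hFm.lintegral_prod_right') hYm]
      _ = _ := by
          refine lintegral_congr fun ω => ?_
          rw [lintegral_map (f := fun z => F (Y ω, z)) (hFm.comp measurable_prodMk_left) hWm]
  rw [h1]
  refine lintegral_congr fun ω => ?_
  set s := servingIndex X ω with hs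
  set ρ := servingDist X ω with hρ
  have hρ0 : 0 ≤ ρ := norm_nonneg _
  set f : ℕ → M → ENNReal := fun i m =>
    (if i = s then g ρ m else 1) * expNeg (if ρ < ‖X i ω‖ then q ‖X i ω‖ m else 0) with hf
  have hgr : ∀ r, Measurable (g r) := fun r => hg.comp measurable_prodMk_left
  have hqr : ∀ r, Measurable (q r) := fun r => hq.comp measurable_prodMk_left
  have hfm : ∀ i, Measurable (f i) := by
    intro i
    have h2 := hgr ρ
    have h3 := hqr ‖X i ω‖
    simp only [hf]
    split_ifs <;> fun_prop
  have hf1 : ∀ i m, f i m ≤ 1 := fun i m => by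
    simp only [hf]
    refine mul_le_one' ?_ (expNeg_le_one _)
    split_ifs
    · exact hg1 _ _
    · exact le_rfl
  have hπ : IsProbabilityMeasure π := by
    rw [← hlaw 0]
    exact Measure.isProbabilityMeasure_map (hZ 0).aemeasurable
  have hfint : ∀ i, ∫⁻ ω', f i (Z i ω') ∂P =
      (if i = s then ∫⁻ m, g ρ m ∂π else 1) *
        expNeg (if ρ < ‖X i ω‖ then v ‖X i ω‖ else 0) := by
    intro i
    rw [← lintegral_map (hfm i) (hZ i), hlaw i]
    by_cases hi : i = s
    · have : ¬ ρ < ‖X i ω‖ := by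
        rw [hi]
        exact lt_irrefl _
      simp [hf, hi, hρ, servingDist, hs]
    · by_cases hlt : ρ < ‖X i ω‖
      · simp [hf, hi, hlt, hv _ (norm_nonneg _)]
      · simp [hf, hi, hlt]
  -- Multiplication by a constant `a` is continuous on `[0, ∞]` only for `a ≠ ⊤`; in both uses `a ≤
  -- 1`.
  have hprodlim : ∀ (a : ENNReal) (b : ℕ → ENNReal), Tendsto
      (fun n => ∏ i ∈ Finset.range n, (if i = s then a else 1) * expNeg (b i)) atTop
      (𝓝 (a * expNeg (∑' i, b i))) ∨ a = ⊤ := by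
    intro a b
    by_cases ha : a = ⊤
    · exact Or.inr ha
    left
    refine (ENNReal.Tendsto.const_mul (tendsto_prod_expNeg b) (Or.inr ha)).congr' ?_
    filter_upwards [eventually_gt_atTop s] with n hn
    rw [Finset.prod_mul_distrib, Finset.prod_ite_eq' _ s, if_pos (Finset.mem_range.2 hn)]
  have hl1 : Tendsto (fun n => ∫⁻ ω', ∏ i ∈ Finset.range n, f i (Z i ω') ∂P) atTop
      (𝓝 (∫⁻ ω', F (Y ω, W ω') ∂P)) := by
    refine tendsto_lintegral_of_dominated_convergence (fun _ => 1) (fun n => ?_)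
      (fun n => ae_of_all _ fun ω' => ?_) (by simp) (ae_of_all _ fun ω' => ?_)
    · exact Finset.measurable_fun_prod _ fun i _ => (hfm i).comp (hZ i)
    · exact Finset.prod_le_one' fun i _ => hf1 i _
    · have h2 := (hprodlim (g ρ (Z s ω'))
        (fun i => if ρ < ‖X i ω‖ then q ‖X i ω‖ (Z i ω') else 0)).resolve_right
          (ne_top_of_le_ne_top ENNReal.one_ne_top (hg1 _ _))
      refine h2.congr fun n => Finset.prod_congr rfl fun i _ => ?_
      by_cases hi : i = s
      · simp [hf, hi]
      · simp [hf, hi]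
  have hl2 := (hprodlim (∫⁻ m, g ρ m ∂π)
    (fun i => if ρ < ‖X i ω‖ then v ‖X i ω‖ else 0)).resolve_right (by
      have : ∫⁻ m, g ρ m ∂π ≤ ∫⁻ _, 1 ∂π := lintegral_mono fun m => hg1 ρ m
      rw [lintegral_one, measure_univ] at this
      exact ne_top_of_le_ne_top ENNReal.one_ne_top this)
  refine tendsto_nhds_unique hl1 (hl2.congr fun n => ?_)
  rw [lintegral_prod_eq_prod_lintegral_of_indepFun (X := fun i ω' => f i (Z i ω'))]
  · exact Finset.prod_congr rfl fun i _ => (hfint i).symm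
  · exact hind.comp f hfm
  · exact fun i => (hfm i).comp (hZ i)

end Marks

/-! ### Laplace transform of the interference -/

section NetworkLaplace

variable {Ω : Type*} [MeasurableSpace Ω] {S : Type*} [MeasurableSpace S]
  {μ : Measure ℝ} {ν : Measure S} {L : ℝ → S → ℝ} {L₀ lam : ℝ} {P : Measure Ω}
  {X : ℕ → Ω → Plane} {h : ℕ → Ω → ℝ} {σ : ℕ → Ω → S}

/-- `E[exp(-h t L(|x|))]`. -/
def linkLaplace (μ : Measure ℝ) (ν : Measure S) (L : ℝ → S → ℝ) (t x : ℝ) : ℝ :=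
  1 - lossTransform μ ν L t |x|

/-- The exponent `πλr² + 2πλ ∫_r^∞ x E[1 - exp(-h t L(x))] dx`. -/
def lossExponent (μ : Measure ℝ) (ν : Measure S) (L : ℝ → S → ℝ) (lam t r : ℝ) : ℝ :=
  Real.pi * lam * r ^ 2 + 2 * Real.pi * lam * ∫ x in Ioi r, x * lossTransform μ ν L t x

lemma tailExponent_linkLaplace (lam t : ℝ) {r : ℝ} (hr : 0 ≤ r) :
    tailExponent lam (linkLaplace μ ν L t) r = lossExponent μ ν L lam t r := by
  have : ∫ x in Ioi r, x * (1 - linkLaplace μ ν L t x) =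
      ∫ x in Ioi r, x * lossTransform μ ν L t x :=
    setIntegral_congr_fun measurableSet_Ioi fun x hx => by
      have hx0 : 0 ≤ x := hr.trans (le_of_lt hx)
      simp [linkLaplace, abs_of_nonneg hx0]
  rw [tailExponent, this, lossExponent]

lemma interference_eq_tsum {S : Type*} (L : ℝ → S → ℝ) {Ω : Type*} (X : ℕ → Ω → Plane) (h : ℕ → Ω → ℝ)
    (σ : ℕ → Ω → S) (ω : Ω) :
    interference L X h σ ω = ∑' i, if servingDist X ω < ‖X i ω‖ then
      ENNReal.ofReal (h i ω * L ‖X i ω‖ (σ i ω)) else 0 := by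
  refine (tsum_subtype {i : ℕ | ‖X (servingIndex X ω) ω‖ < ‖X i ω‖}
    (fun i => ENNReal.ofReal (receivedPower L X h σ i ω))).trans (tsum_congr fun i => ?_)
  simp only [indicator_apply, servingDist, receivedPower, mem_ofPred_eq]
  congr

/-- The marks may be replaced by a measurable modification. -/
lemma IsNetwork.exists_measurable_marks (hN : IsNetwork μ ν lam P X h σ) :
    ∃ Z : ℕ → Ω → ℝ × S, (∀ i, Measurable (Z i)) ∧ (∀ i, P.map (Z i) = μ.prod ν) ∧
      iIndepFun Z P ∧ IndepFun (fun ω i => X i ω) (fun ω i => Z i ω) P ∧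
      ∀ᵐ ω ∂P, ∀ i, (h i ω, σ i ω) = Z i ω := by
  have ham : ∀ i, AEMeasurable (fun ω => (h i ω, σ i ω)) P := fun i => (hN.mark_law i).aemeasurable
  refine ⟨fun i => (ham i).mk, fun i => (ham i).measurable_mk, fun i => ?_, ?_, ?_, ?_⟩
  · rw [← Measure.map_congr (ham i).ae_eq_mk, (hN.mark_law i).map_eq]
  · exact hN.mark_indep.congr fun i => (ham i).ae_eq_mk
  · refine hN.indep.congr (ae_eq_refl _) ?_
    filter_upwards [ae_all_iff.2 fun i => (ham i).ae_eq_mk] with ω hω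
    exact funext hω
  · exact ae_all_iff.2 fun i => (ham i).ae_eq_mk

/-- Averaging over the marks turns each interfering link into the deterministic weight `negLog w`
with `w = linkLaplace μ ν L t`; the Poisson identity for the nearest distance does the rest. -/
theorem IsNetwork.lintegral_serving_interference (hμ : IsFadingLaw μ)
    (hL : IsFeasiblePathLoss ν L L₀) (hlam : 0 < lam) (hN : IsNetwork μ ν lam P X h σ)
    {t : ℝ} (ht : 0 ≤ t) {g : ℝ → ℝ × S → ENNReal} (hg : Measurable (Function.uncurry g))
    (hg1 : ∀ r m, g r m ≤ 1) :
    ∫⁻ ω, g (servingDist X ω) (h (servingIndex X ω) ω, σ (servingIndex X ω) ω) *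
      expNeg (ENNReal.ofReal t * interference L X h σ ω) ∂P =
    ∫⁻ r in Ioi (0 : ℝ), (∫⁻ p, g r p ∂(μ.prod ν)) * ENNReal.ofReal
      (2 * Real.pi * lam * r * Real.exp (-lossExponent μ ν L lam t r)) := by
  have := hN.prob
  have := hμ.prob
  have := hL.prob
  obtain ⟨Z, hZm, hZlaw, hZind, hXZ, hZae⟩ := hN.exists_measurable_marks
  set w := linkLaplace μ ν L t with hw
  have hwm : Measurable w :=
    ((measurable_lossTransform hμ hL t).comp measurable_norm).const_sub 1
  -- Feasibility says nothing about negative distances; the absolute value in `linkLaplace` makes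
  -- these bounds hold on all of `ℝ`.
  have hw0 : ∀ x, 0 < w x := fun x => sub_pos.2 (lossTransform_lt_one hμ hL ht (abs_nonneg x))
  have hw1 : ∀ x, w x ≤ 1 := fun x => by
    have := lossTransform_nonneg hμ hL ht (abs_nonneg x)
    simp only [hw, linkLaplace]
    linarith
  have hint : IntegrableOn (fun x => x * (1 - w x)) (Ioi 0) := by
    refine (integrableOn_mul_lossTransform hμ hL ht).congr_fun (fun x hx => ?_) measurableSet_Ioi
    have hx0 : 0 ≤ x := le_of_lt hx
    simp [hw, linkLaplace, abs_of_nonneg hx0]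
  set q : ℝ → ℝ × S → ENNReal := fun r p =>
    ENNReal.ofReal t * ENNReal.ofReal (p.1 * L r p.2) with hq
  have hqm : Measurable (Function.uncurry q) := by
    have h1 : Measurable fun p : ℝ × (ℝ × S) => L p.1 p.2.2 :=
      hL.measurable.comp (measurable_fst.prodMk (measurable_snd.comp measurable_snd))
    exact (((measurable_fst.comp measurable_snd).mul h1).ennreal_ofReal).const_mul _
  have hv : ∀ r, 0 ≤ r → ∫⁻ m, expNeg (q r m) ∂(μ.prod ν) = expNeg (negLog w r) := by
    intro r hr
    rw [expNeg_negLog (hw0 r) (hw1 r)]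
    simp only [hq]
    rw [lintegral_expNeg_fading_mul_loss hμ hL ht hr]
    simp [hw, linkLaplace, abs_of_nonneg hr]
  have h1 := lintegral_serving_mark hN.poisson.measurable hZm hZlaw hZind hXZ hqm hv hg hg1
  have h2 := hN.poisson.lintegral_servingDist_expNeg hlam hwm hw0 hw1 hint
    (G := fun r => ∫⁻ m, g r m ∂(μ.prod ν)) hg.lintegral_prod_right'
  have h3 : ∫⁻ ω, g (servingDist X ω) (h (servingIndex X ω) ω, σ (servingIndex X ω) ω) *
      expNeg (ENNReal.ofReal t * interference L X h σ ω) ∂P =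
      ∫⁻ ω, g (servingDist X ω) (Z (servingIndex X ω) ω) *
      expNeg (∑' i, if servingDist X ω < ‖X i ω‖ then q ‖X i ω‖ (Z i ω) else 0) ∂P := by
    refine lintegral_congr_ae ?_
    filter_upwards [hZae] with ω hω
    rw [interference_eq_tsum, ← ENNReal.tsum_mul_left, hω]
    congr 2
    refine tsum_congr fun i => ?_
    rw [← hω i]
    simp [hq]
  rw [h3, h1, h2]
  refine setLIntegral_congr_fun measurableSet_Ioi fun r hr => ?_
  rw [hw, tailExponent_linkLaplace lam t (le_of_lt hr)]

/-- The sign of `L` is known almost surely at each fixed distance, with a null set that may depend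
on the distance, while the serving distance is random. Independence of marks and positions removes
this obstacle. -/
lemma IsNetwork.ae_receivedPower_nonneg (hμ : IsFadingLaw μ)
    (hL : IsFeasiblePathLoss ν L L₀) (hN : IsNetwork μ ν lam P X h σ) :
    ∀ᵐ ω ∂P, 0 ≤ receivedPower L X h σ (servingIndex X ω) ω := by
  have := hN.prob
  have := hμ.prob
  have := hL.prob
  set B : Set (ℝ × (ℝ × S)) := {p | p.2.1 * L p.1 p.2.2 < 0} with hB
  have hBm : MeasurableSet B := by
    have h1 : Measurable fun p : ℝ × (ℝ × S) => L p.1 p.2.2 :=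
      hL.measurable.comp (measurable_fst.prodMk (measurable_snd.comp measurable_snd))
    exact measurableSet_lt ((measurable_fst.comp measurable_snd).mul h1) measurable_const
  obtain ⟨Z, hZm, hZlaw, hZind, hXZ, hZae⟩ := hN.exists_measurable_marks
  set g : ℝ → ℝ × S → ENNReal := fun r p => B.indicator (fun _ => 1) (r, p) with hg
  have hgm : Measurable (Function.uncurry g) := measurable_const.indicator hBm
  -- Zero weights `q` and `v` switch the interference off; `g` is the indicator of a negative
  -- received power.
  have h1 := lintegral_serving_mark hN.poisson.measurable hZm hZlaw hZind hXZ
    (q := fun _ _ => 0) (v := fun _ => 0) measurable_const (fun r _ => by simp) hgm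
    (fun r m => indicator_le_self' (fun _ _ => zero_le_one) _)
  have h2 : ∀ ω, ∫⁻ m, g (servingDist X ω) m ∂(μ.prod ν) = 0 := by
    intro ω
    refine (lintegral_eq_zero_iff (hgm.comp measurable_prodMk_left)).2 ?_
    filter_upwards [ae_nonneg_fading_and_loss hμ hL (norm_nonneg (X (servingIndex X ω) ω))]
      with p hp
    have : (servingDist X ω, p) ∉ B := not_lt.2 (mul_nonneg hp.1 hp.2.1)
    change B.indicator (fun _ => (1 : ENNReal)) (servingDist X ω, p) = 0
    exact indicator_of_notMem this _
  simp only [h2, lintegral_zero, ite_self, tsum_zero, expNeg_zero, mul_one] at h1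
  have hgm' : Measurable fun ω => g (servingDist X ω) (Z (servingIndex X ω) ω) :=
    hgm.comp ((measurable_servingDist hN.poisson.measurable).prodMk
      (measurable_comp_servingIndex hN.poisson.measurable hZm))
  rw [lintegral_eq_zero_iff hgm'] at h1
  filter_upwards [h1, hZae] with ω hω hω'
  by_contra hlt
  rw [← hω'] at hω
  have : (servingDist X ω, (h (servingIndex X ω) ω, σ (servingIndex X ω) ω)) ∈ B := not_le.1 hlt
  simp only [hg, indicator_of_mem this] at hω
  exact one_ne_zero hω

end NetworkLaplace

/-! ### An integral formula for the logarithm -/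

section LogFormula

lemma lintegral_Ioi_exp_neg_mul {u : ℝ} (hu : 0 < u) :
    ∫⁻ t in Ioi (0 : ℝ), ENNReal.ofReal (Real.exp (-(t * u))) = ENNReal.ofReal u⁻¹ := by
  have h1 : ∀ t : ℝ, -(t * u) = -u * t := fun t => by ring
  simp_rw [h1]
  rw [← ofReal_integral_eq_lintegral_ofReal (integrableOn_exp_mul_Ioi (neg_lt_zero.2 hu) 0)
    (ae_of_all _ fun t => (Real.exp_pos _).le), integral_exp_mul_Ioi (neg_lt_zero.2 hu)]
  congr 1
  field_simp
  simp

/-- The logarithm is the integral of `1/u` over `[b, b + a]`, and `1/u = ∫₀^∞ exp(-t u) dt`; Tonelli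
exchanges the two integrals. -/
lemma ofReal_log_one_add_div {a b : ℝ} (ha : 0 ≤ a) (hb : 0 < b) :
    ENNReal.ofReal (Real.log (1 + a / b)) = ∫⁻ t in Ioi (0 : ℝ),
      ENNReal.ofReal (Real.exp (-(t * b)) * (1 - Real.exp (-(t * a))) / t) := by
  have hbab : b ≤ b + a := by linarith
  have h1 : ∀ t ∈ Ioi (0 : ℝ),
      ENNReal.ofReal (Real.exp (-(t * b)) * (1 - Real.exp (-(t * a))) / t) =
      ∫⁻ u in Ioc b (b + a), ENNReal.ofReal (Real.exp (-(t * u))) := by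
    intro t ht
    have ht0 : (0 : ℝ) < t := ht
    rw [← ofReal_integral_eq_lintegral_ofReal
      ((Continuous.integrableOn_Icc (by fun_prop)).mono_set Ioc_subset_Icc_self)
      (ae_of_all _ fun t => (Real.exp_pos _).le), ← intervalIntegral.integral_of_le hbab]
    congr 1
    have hder : ∀ u ∈ uIcc b (b + a),
        HasDerivAt (fun u => -(Real.exp (-(t * u)) / t)) (Real.exp (-(t * u))) u := by
      intro u _
      have h2 : HasDerivAt (fun u => -(t * u)) (-(t * 1)) u := ((hasDerivAt_id u).const_mul t).neg
      have h3 := (h2.exp.div_const t).neg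
      convert! h3 using 1
      rw [mul_one, mul_neg, neg_div, neg_neg, mul_div_assoc, div_self ht0.ne', mul_one]
    rw [intervalIntegral.integral_eq_sub_of_hasDerivAt hder
      (Continuous.intervalIntegrable (by fun_prop) _ _), mul_add, neg_add, Real.exp_add]
    ring
  rw [setLIntegral_congr_fun measurableSet_Ioi h1, lintegral_lintegral_swap (by fun_prop)]
  have h2 : ∫⁻ u in Ioc b (b + a), ∫⁻ t in Ioi (0 : ℝ), ENNReal.ofReal (Real.exp (-(t * u))) =
      ∫⁻ u in Ioc b (b + a), ENNReal.ofReal u⁻¹ :=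
    setLIntegral_congr_fun measurableSet_Ioc fun u hu =>
      lintegral_Ioi_exp_neg_mul (hb.trans hu.1)
  have hnot : (0 : ℝ) ∉ uIcc b (b + a) := by
    rw [uIcc_of_le hbab]
    exact fun h => not_le.2 hb h.1
  rw [h2, ← ofReal_integral_eq_lintegral_ofReal, ← intervalIntegral.integral_of_le hbab,
    integral_inv hnot]
  · congr 2
    field_simp
  · rw [← IntegrableOn, ← intervalIntegrable_iff_integrableOn_Ioc_of_le hbab]
    exact intervalIntegral.intervalIntegrable_inv (fun u hu h => hnot (h ▸ hu)) continuousOn_id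
  · filter_upwards [ae_restrict_mem measurableSet_Ioc] with u hu
    exact (inv_pos.2 (hb.trans hu.1)).le

end LogFormula

/-! ### The average area spectral efficiency as an integral -/

section SpectralEfficiency

variable {Ω : Type*} [MeasurableSpace Ω] {S : Type*} [MeasurableSpace S]
  {μ : Measure ℝ} {ν : Measure S} {L : ℝ → S → ℝ} {L₀ lam : ℝ} {P : Measure Ω}
  {X : ℕ → Ω → Plane} {h : ℕ → Ω → ℝ} {σ : ℕ → Ω → S}

/-- The Laplace transform of the interference. -/
def interferenceLaplace (μ : Measure ℝ) (ν : Measure S) (L : ℝ → S → ℝ) (lam t : ℝ) : ENNReal :=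
  ∫⁻ r in Ioi (0 : ℝ), ENNReal.ofReal
    (2 * Real.pi * lam * r * Real.exp (-lossExponent μ ν L lam t r))

lemma measurable_lossExponent (hμ : IsFadingLaw μ) (hL : IsFeasiblePathLoss ν L L₀) :
    Measurable (fun p : ℝ × ℝ => lossExponent μ ν L lam p.1 p.2) := by
  have h : Measurable fun p : ℝ × ℝ => ∫ x in Ioi p.2, x * lossTransform μ ν L p.1 x := by
    have h1 : (fun p : ℝ × ℝ => ∫ x in Ioi p.2, x * lossTransform μ ν L p.1 x) =
        fun p => ∫ x, {q : (ℝ × ℝ) × ℝ | q.1.2 < q.2}.indicator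
          (fun q => q.2 * lossTransform μ ν L q.1.1 q.2) (p, x) := by
      ext p
      rw [← integral_indicator measurableSet_Ioi]
      rfl
    rw [h1]
    have h2 : Measurable ({q : (ℝ × ℝ) × ℝ | q.1.2 < q.2}.indicator
        (fun q => q.2 * lossTransform μ ν L q.1.1 q.2)) := by
      refine Measurable.indicator (measurable_snd.mul ?_)
        (measurableSet_lt (measurable_snd.comp measurable_fst) measurable_snd)
      exact (measurable_lossTransform_uncurry hμ hL).comp
        ((measurable_fst.comp measurable_fst).prodMk measurable_snd)
    exact h2.stronglyMeasurable.integral_prod_right'.measurable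
  unfold lossExponent
  fun_prop

/-- Once `interferenceLaplace` is recognized as `E[exp(-t I)]`, this integral is the second inverse
moment `E[I⁻²]` of the interference. -/
lemma momentIntegral_eq :
    momentIntegral μ ν L lam =
      ∫⁻ t in Ioi (0 : ℝ), ENNReal.ofReal t * interferenceLaplace μ ν L lam t := by
  refine setLIntegral_congr_fun measurableSet_Ioi fun t ht => ?_
  have ht0 : (0 : ℝ) ≤ t := le_of_lt ht
  rw [interferenceLaplace, ← lintegral_const_mul' _ _ ENNReal.ofReal_ne_top]
  refine setLIntegral_congr_fun measurableSet_Ioi fun r hr => ?_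
  rw [← ENNReal.ofReal_mul ht0]
  simp only [lossExponent, lossTransform, neg_add']
  congr 1
  ring

lemma lintegral_rayleigh (hlam : 0 < lam) :
    ∫⁻ r in Ioi (0 : ℝ), ENNReal.ofReal
      (2 * Real.pi * lam * r * Real.exp (-(Real.pi * lam * r ^ 2))) = 1 := by
  have h := setLIntegral_Ioi_tail (w := fun _ => 1) hlam measurable_const (fun _ => one_pos)
    (fun _ => le_rfl) (by simp) le_rfl
  simpa [tailExponent] using h

lemma lossExponent_ge (hμ : IsFadingLaw μ) (hL : IsFeasiblePathLoss ν L L₀) (hlam : 0 ≤ lam)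
    {t r : ℝ} (ht : 0 ≤ t) (hr : 0 ≤ r) :
    Real.pi * lam * r ^ 2 ≤ lossExponent μ ν L lam t r := by
  have : 0 ≤ ∫ x in Ioi r, x * lossTransform μ ν L t x :=
    setIntegral_nonneg measurableSet_Ioi fun x hx =>
      mul_nonneg (hr.trans (le_of_lt hx)) (lossTransform_nonneg hμ hL ht (hr.trans (le_of_lt hx)))
  have := Real.pi_pos
  rw [lossExponent]
  have : 0 ≤ 2 * Real.pi * lam * ∫ x in Ioi r, x * lossTransform μ ν L t x := by positivity
  linarith

lemma integral_Ioi_mul_lossTransform_le (hμ : IsFadingLaw μ) (hL : IsFeasiblePathLoss ν L L₀)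
    {t r : ℝ} (ht : 0 ≤ t) (hr : 0 ≤ r) :
    ∫ x in Ioi r, x * lossTransform μ ν L t x ≤ t * gamma ν L := by
  have hint := integrableOn_mul_lossTransform hμ hL ht
  have h1 : ∫ x in Ioi r, x * lossTransform μ ν L t x ≤
      ∫ x in Ioi 0, x * lossTransform μ ν L t x := by
    refine setIntegral_mono_set hint ?_ (Ioi_subset_Ioi hr).eventuallyLE
    filter_upwards [ae_restrict_mem measurableSet_Ioi] with x hx
    exact mul_nonneg (le_of_lt hx) (lossTransform_nonneg hμ hL ht (le_of_lt hx))
  refine h1.trans ?_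
  rw [← integral_mul_meanLoss hL, ← integral_const_mul]
  refine setIntegral_mono_on hint ((integrableOn_mul_meanLoss hL).const_mul t) measurableSet_Ioi
    fun x hx => ?_
  have hx0 : 0 ≤ x := le_of_lt hx
  calc x * lossTransform μ ν L t x ≤ x * (t * meanLoss ν L x) := by
        have := lossTransform_le hμ hL ht hx0
        gcongr
    _ = _ := by ring

lemma interferenceLaplace_le_one (hμ : IsFadingLaw μ) (hL : IsFeasiblePathLoss ν L L₀)
    (hlam : 0 < lam) {t : ℝ} (ht : 0 ≤ t) : interferenceLaplace μ ν L lam t ≤ 1 := by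
  rw [← lintegral_rayleigh hlam]
  refine setLIntegral_mono' measurableSet_Ioi fun r hr => ?_
  have hr0 : 0 ≤ r := le_of_lt hr
  have := Real.pi_pos
  refine ENNReal.ofReal_le_ofReal (mul_le_mul_of_nonneg_left ?_ (by positivity))
  exact Real.exp_le_exp.2 (neg_le_neg (lossExponent_ge hμ hL hlam.le ht hr0))

/-- The bound `1 - exp(-y) ≤ y` replaces the loss integral by `t γ`. The result tends to one as `t →
0`, which excludes infinite interference. -/
lemma le_interferenceLaplace (hμ : IsFadingLaw μ) (hL : IsFeasiblePathLoss ν L L₀)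
    (hlam : 0 < lam) {t : ℝ} (ht : 0 ≤ t) :
    ENNReal.ofReal (Real.exp (-(2 * Real.pi * lam * (t * gamma ν L)))) ≤
      interferenceLaplace μ ν L lam t := by
  have hpi := Real.pi_pos
  rw [← mul_one (ENNReal.ofReal _), ← lintegral_rayleigh hlam,
    ← lintegral_const_mul' _ _ ENNReal.ofReal_ne_top]
  refine setLIntegral_mono' measurableSet_Ioi fun r hr => ?_
  have hr0 : 0 ≤ r := le_of_lt hr
  rw [← ENNReal.ofReal_mul (Real.exp_pos _).le]
  refine ENNReal.ofReal_le_ofReal ?_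
  have h1 : lossExponent μ ν L lam t r ≤
      Real.pi * lam * r ^ 2 + 2 * Real.pi * lam * (t * gamma ν L) := by
    have := integral_Ioi_mul_lossTransform_le hμ hL ht hr0
    rw [lossExponent]
    gcongr
  calc _ = 2 * Real.pi * lam * r *
        Real.exp (-(Real.pi * lam * r ^ 2 + 2 * Real.pi * lam * (t * gamma ν L))) := by
        rw [neg_add, Real.exp_add]
        ring
    _ ≤ _ := by gcongr

lemma IsNetwork.lintegral_expNeg_interference (hμ : IsFadingLaw μ)
    (hL : IsFeasiblePathLoss ν L L₀) (hlam : 0 < lam) (hN : IsNetwork μ ν lam P X h σ)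
    {t : ℝ} (ht : 0 ≤ t) :
    ∫⁻ ω, expNeg (ENNReal.ofReal t * interference L X h σ ω) ∂P =
      interferenceLaplace μ ν L lam t := by
  have := hμ.prob
  have := hL.prob
  have h1 := hN.lintegral_serving_interference hμ hL hlam ht (g := fun _ _ => 1)
    measurable_const (fun _ _ => le_rfl)
  simpa [interferenceLaplace] using h1

lemma measurable_interference (hL : IsFeasiblePathLoss ν L L₀) (hX : ∀ i, Measurable (X i))
    (hh : ∀ i, Measurable (h i)) (hσ : ∀ i, Measurable (σ i)) :
    Measurable (interference L X h σ) := by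
  have h1 : interference L X h σ = fun ω => ∑' i, if servingDist X ω < ‖X i ω‖ then
      ENNReal.ofReal (h i ω * L ‖X i ω‖ (σ i ω)) else 0 :=
    funext fun ω => interference_eq_tsum L X h σ ω
  rw [h1]
  refine Measurable.tsum fun i => Measurable.ite
    (measurableSet_lt (measurable_servingDist hX) (hX i).norm) ?_ measurable_const
  exact ((hh i).mul (hL.measurable.comp ((hX i).norm.prodMk (hσ i)))).ennreal_ofReal

lemma measurable_receivedPower_serving (hL : IsFeasiblePathLoss ν L L₀)
    (hX : ∀ i, Measurable (X i)) (hh : ∀ i, Measurable (h i)) (hσ : ∀ i, Measurable (σ i)) :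
    Measurable fun ω => receivedPower L X h σ (servingIndex X ω) ω :=
  measurable_comp_servingIndex hX fun i =>
    (hh i).mul (hL.measurable.comp ((hX i).norm.prodMk (hσ i)))

lemma IsNetwork.exists_measurable_network (hN : IsNetwork μ ν lam P X h σ) (L : ℝ → S → ℝ)
    (N₀ : ℝ) : ∃ (h' : ℕ → Ω → ℝ) (σ' : ℕ → Ω → S), (∀ i, Measurable (h' i)) ∧
      (∀ i, Measurable (σ' i)) ∧ IsNetwork μ ν lam P X h' σ' ∧
      averageASE L N₀ lam P X h σ = averageASE L N₀ lam P X h' σ' := by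
  obtain ⟨Z, hZm, hZlaw, hZind, hXZ, hZae⟩ := hN.exists_measurable_marks
  refine ⟨fun i ω => (Z i ω).1, fun i ω => (Z i ω).2, fun i => (hZm i).fst, fun i => (hZm i).snd,
    ⟨hN.prob, hN.poisson, fun i => ⟨(hZm i).aemeasurable, hZlaw i⟩, hZind, hXZ⟩, ?_⟩
  rw [averageASE, averageASE]
  congr 1
  refine lintegral_congr_ae ?_
  filter_upwards [hZae] with ω hω
  have h1 : ∀ i, h i ω = (Z i ω).1 := fun i => congrArg Prod.fst (hω i)
  have h2 : ∀ i, σ i ω = (Z i ω).2 := fun i => congrArg Prod.snd (hω i)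
  simp only [sinr, interference, receivedPower, h1, h2]

/-- `E[exp(-t I)] ≤ P(I < ∞)` for every `t > 0`, and the left side tends to one along `t = 1/(n +
1)`. -/
lemma IsNetwork.ae_interference_lt_top (hμ : IsFadingLaw μ)
    (hL : IsFeasiblePathLoss ν L L₀) (hlam : 0 < lam) (hN : IsNetwork μ ν lam P X h σ)
    (hI : Measurable (interference L X h σ)) : ∀ᵐ ω ∂P, interference L X h σ ω < ⊤ := by
  have := hN.prob
  have hms : MeasurableSet {ω | interference L X h σ ω < ⊤} := measurableSet_lt hI measurable_const
  have h1 : ∀ n : ℕ, ENNReal.ofReal (Real.exp (-(2 * Real.pi * lam *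
      (1 / ((n : ℝ) + 1) * gamma ν L)))) ≤ P {ω | interference L X h σ ω < ⊤} := by
    intro n
    have hn : (0 : ℝ) < 1 / ((n : ℝ) + 1) := by positivity
    refine (le_interferenceLaplace hμ hL hlam hn.le).trans ?_
    rw [← hN.lintegral_expNeg_interference hμ hL hlam hn.le, ← lintegral_indicator_one hms]
    refine lintegral_mono fun ω => ?_
    by_cases hω : interference L X h σ ω < ⊤
    · rw [indicator_of_mem (s := {ω | interference L X h σ ω < ⊤}) hω]
      exact expNeg_le_one _
    · rw [not_lt_top_iff.1 hω, ENNReal.mul_top (ENNReal.ofReal_pos.2 hn).ne', expNeg_top]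
      exact bot_le
  have h2 : Tendsto (fun n : ℕ => ENNReal.ofReal (Real.exp (-(2 * Real.pi * lam *
      (1 / ((n : ℝ) + 1) * gamma ν L))))) atTop (𝓝 1) := by
    have h3 := ((tendsto_one_div_add_atTop_nhds_zero_nat (𝕜 := ℝ)).mul_const
      (gamma ν L)).const_mul (2 * Real.pi * lam)
    have h4 := ENNReal.tendsto_ofReal ((Real.continuous_exp.tendsto _).comp h3.neg)
    simpa using h4
  have h5 : P {ω | interference L X h σ ω < ⊤} = 1 :=
    le_antisymm prob_le_one (le_of_tendsto' h2 h1)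
  exact (prob_compl_eq_zero_iff hms).2 h5

/-- `P(I = 0) ≤ E[exp(-t I)]` for all `t`, so an atom at zero would make the moment integral
diverge. Positivity is essential when `N₀ = 0`, where division by zero would silently give a ratio
of `0`. -/
lemma IsNetwork.ae_interference_pos (hμ : IsFadingLaw μ)
    (hL : IsFeasiblePathLoss ν L L₀) (hlam : 0 < lam) (hN : IsNetwork μ ν lam P X h σ)
    (hI : Measurable (interference L X h σ)) (hmom : momentIntegral μ ν L lam < ⊤) :
    ∀ᵐ ω ∂P, 0 < interference L X h σ ω := by
  have hms : MeasurableSet {ω | interference L X h σ ω = 0} := hI (measurableSet_singleton 0)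
  have h1 : ∀ t : ℝ, 0 ≤ t →
      P {ω | interference L X h σ ω = 0} ≤ interferenceLaplace μ ν L lam t := by
    intro t ht
    rw [← hN.lintegral_expNeg_interference hμ hL hlam ht, ← lintegral_indicator_one hms]
    refine lintegral_mono fun ω => ?_
    by_cases hω : interference L X h σ ω = 0
    · simp [hω]
    · rw [indicator_of_notMem (s := {ω | interference L X h σ ω = 0}) hω]
      exact bot_le
  have h0 : P {ω | interference L X h σ ω = 0} = 0 := by
    by_contra hne
    refine hmom.ne (top_le_iff.1 ?_)
    rw [momentIntegral_eq]
    calc (⊤ : ENNReal) = ∫⁻ _ in Ioi (1 : ℝ), P {ω | interference L X h σ ω = 0} := by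
          rw [setLIntegral_const, Real.volume_Ioi, ENNReal.mul_top hne]
      _ ≤ ∫⁻ t in Ioi (1 : ℝ), ENNReal.ofReal t * interferenceLaplace μ ν L lam t := by
          refine setLIntegral_mono' measurableSet_Ioi fun t ht => ?_
          have ht1 : (1 : ℝ) ≤ t := le_of_lt ht
          rw [← one_mul (P _)]
          exact mul_le_mul' (ENNReal.one_le_ofReal.2 ht1) (h1 t (by linarith))
      _ ≤ _ := lintegral_mono_set (Ioi_subset_Ioi zero_le_one)
  filter_upwards [measure_eq_zero_iff_ae_notMem.1 h0] with ω hω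
  exact pos_iff_ne_zero.2 hω

/-- The integral formula for the logarithm is applied with the serving power as `a` and `I + N₀` as
`b`. For fixed `t` the factor `1 - exp(-t a)` is a function of the serving link, so its mean against
`exp(-t I)` is known. -/
theorem IsNetwork.averageASE_eq (hμ : IsFadingLaw μ)
    (hL : IsFeasiblePathLoss ν L L₀) (hlam : 0 < lam) (hN : IsNetwork μ ν lam P X h σ)
    (hmom : momentIntegral μ ν L lam < ⊤) {N₀ : ℝ} (hN₀ : 0 ≤ N₀) :
    averageASE L N₀ lam P X h σ = ENNReal.ofReal lam * (ENNReal.ofReal (Real.log 2)⁻¹ *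
      ∫⁻ t in Ioi (0 : ℝ), ENNReal.ofReal (Real.exp (-(t * N₀)) / t) *
        ∫⁻ r in Ioi (0 : ℝ), ENNReal.ofReal (lossTransform μ ν L t r) * ENNReal.ofReal
          (2 * Real.pi * lam * r * Real.exp (-lossExponent μ ν L lam t r))) := by
  obtain ⟨h', σ', hh, hσ, hN', hASE⟩ := hN.exists_measurable_network L N₀
  rw [hASE]
  have := hN'.prob
  have := hμ.prob
  have := hL.prob
  have hX := hN'.poisson.measurable
  have hI := measurable_interference hL hX hh hσ
  have hR := measurable_receivedPower_serving hL hX hh hσ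
  set I := interference L X h' σ' with hIdef
  set R : Ω → ℝ := fun ω => receivedPower L X h' σ' (servingIndex X ω) ω with hRdef
  have hlog2 : 0 < Real.log 2 := Real.log_pos one_lt_two
  set g : ℝ → ℝ → ℝ × S → ENNReal := fun t r p =>
    1 - expNeg (ENNReal.ofReal t * ENNReal.ofReal (p.1 * L r p.2)) with hg
  have hgm : ∀ t, Measurable (Function.uncurry (g t)) := fun t => by
    have h1 : Measurable fun p : ℝ × (ℝ × S) => L p.1 p.2.2 :=
      hL.measurable.comp (measurable_fst.prodMk (measurable_snd.comp measurable_snd))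
    exact ((((measurable_fst.comp measurable_snd).mul h1).ennreal_ofReal).const_mul _).expNeg.const_sub
      1
  have hgint : ∀ t r, 0 ≤ t → 0 ≤ r →
      ∫⁻ p, g t r p ∂(μ.prod ν) = ENNReal.ofReal (lossTransform μ ν L t r) := by
    intro t r ht hr
    have hm : Measurable fun p : ℝ × S =>
        expNeg (ENNReal.ofReal t * ENNReal.ofReal (p.1 * L r p.2)) := by
      have := hL.measurable_apply r
      fun_prop
    simp only [hg]
    rw [lintegral_sub hm, lintegral_expNeg_fading_mul_loss hμ hL ht hr, lintegral_one,
      measure_univ, ← ENNReal.ofReal_one, ← ENNReal.ofReal_sub]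
    · congr 1
      ring
    · linarith [lossTransform_lt_one hμ hL ht hr]
    · rw [lintegral_expNeg_fading_mul_loss hμ hL ht hr]
      exact ENNReal.ofReal_ne_top
    · exact ae_of_all _ fun p => expNeg_le_one _
  have hpt : ∀ᵐ ω ∂P, ENNReal.ofReal (Real.logb 2 (1 + sinr L N₀ X h' σ' ω)) =
      ENNReal.ofReal (Real.log 2)⁻¹ * ∫⁻ t in Ioi (0 : ℝ),
        ENNReal.ofReal (Real.exp (-(t * N₀)) / t) *
          ((1 - expNeg (ENNReal.ofReal t * ENNReal.ofReal (R ω))) *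
            expNeg (ENNReal.ofReal t * I ω)) := by
    filter_upwards [hN'.ae_receivedPower_nonneg hμ hL,
      hN'.ae_interference_lt_top hμ hL hlam hI,
      hN'.ae_interference_pos hμ hL hlam hI hmom] with ω h1 h2 h3
    have h4 : 0 < (I ω).toReal := ENNReal.toReal_pos h3.ne' h2.ne
    have h5 : 0 < (I ω).toReal + N₀ := by linarith
    rw [Real.logb, div_eq_inv_mul, ENNReal.ofReal_mul (inv_nonneg.2 hlog2.le)]
    congr 1
    rw [sinr, ofReal_log_one_add_div h1 h5]
    refine setLIntegral_congr_fun measurableSet_Ioi fun t ht => ?_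
    have ht0 : (0 : ℝ) < t := ht
    have h6 : I ω = ENNReal.ofReal (I ω).toReal := (ENNReal.ofReal_toReal h2.ne).symm
    have h7 : ENNReal.ofReal t * I ω = ENNReal.ofReal (t * (I ω).toReal) := by
      rw [ENNReal.ofReal_mul ht0.le, ← h6]
    have h8 : 0 ≤ R ω := h1
    have h9 : 0 ≤ 1 - Real.exp (-(t * R ω)) := by
      have : Real.exp (-(t * R ω)) ≤ 1 :=
        Real.exp_le_one_iff.2 (neg_nonpos.2 (mul_nonneg ht0.le h8))
      linarith
    rw [h7, expNeg_ofReal (by positivity), ← ENNReal.ofReal_mul ht0.le,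
      expNeg_ofReal (by positivity), ← ENNReal.ofReal_one,
      ← ENNReal.ofReal_sub _ (Real.exp_pos _).le, ← ENNReal.ofReal_mul h9,
      ← ENNReal.ofReal_mul (by positivity)]
    congr 1
    rw [mul_add, neg_add, Real.exp_add]
    ring
  rw [averageASE, lintegral_congr_ae hpt, lintegral_const_mul' _ _ ENNReal.ofReal_ne_top,
    lintegral_lintegral_swap]
  · congr 2
    refine setLIntegral_congr_fun measurableSet_Ioi fun t ht => ?_
    have ht0 : (0 : ℝ) < t := ht
    rw [lintegral_const_mul' _ _ ENNReal.ofReal_ne_top]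
    congr 1
    refine (hN'.lintegral_serving_interference hμ hL hlam ht0.le (hgm t)
      (fun r m => tsub_le_self)).trans ?_
    refine setLIntegral_congr_fun measurableSet_Ioi fun r hr => ?_
    rw [hgint t r ht0.le (le_of_lt hr)]
  · refine Measurable.aemeasurable ?_
    have h1 : Measurable fun p : Ω × ℝ => R p.1 := hR.comp measurable_fst
    have h2 : Measurable fun p : Ω × ℝ => I p.1 := hI.comp measurable_fst
    simp only [Function.uncurry_def]
    fun_prop

end SpectralEfficiency

/-! ### The first sufficient condition -/

section FirstCondition

variable {S : Type*} [MeasurableSpace S] {μ : Measure ℝ} {ν : Measure S} {L : ℝ → S → ℝ} {L₀ : ℝ}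

lemma lintegral_Ioi_eq_mul_lintegral_comp_mul {a : ℝ} (ha : 0 < a) (f : ℝ → ENNReal) :
    ∫⁻ x in Ioi (0 : ℝ), f x = ENNReal.ofReal a * ∫⁻ x in Ioi (0 : ℝ), f (a * x) := by
  rw [← lintegral_indicator measurableSet_Ioi, ← lintegral_indicator measurableSet_Ioi]
  conv_lhs => rw [← Real.smul_map_volume_mul_left ha.ne', abs_of_pos ha]
  rw [lintegral_smul_measure, (measurableEmbedding_mulLeft₀ ha.ne').lintegral_map, smul_eq_mul]
  congr 1
  refine lintegral_congr fun x => ?_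
  simp only [indicator_apply, mem_Ioi, mul_pos_iff_of_pos_left ha]

/-- If the mean vanished, the fading would be almost surely zero, against its mean one. -/
lemma integral_one_sub_exp_neg_pos (hμ : IsFadingLaw μ) :
    0 < ∫ h, (1 - Real.exp (-h)) ∂μ := by
  have := hμ.prob
  have h0 : 0 ≤ᵐ[μ] fun h => 1 - Real.exp (-h) := by
    filter_upwards [hμ.nonneg] with h hh
    have : Real.exp (-h) ≤ 1 := Real.exp_le_one_iff.2 (by linarith)
    simp only [Pi.zero_apply]
    linarith
  have hint : Integrable (fun h => 1 - Real.exp (-h)) μ := by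
    refine Integrable.of_bound (C := 1) (by fun_prop) ?_
    filter_upwards [h0] with h hh
    rw [Real.norm_of_nonneg hh]
    linarith [Real.exp_pos (-h)]
  refine lt_of_le_of_ne (integral_nonneg_of_ae h0) fun heq => ?_
  have h1 := (integral_eq_zero_iff_of_nonneg_ae h0 hint).1 heq.symm
  have h2 : (fun h : ℝ => h) =ᵐ[μ] 0 := by
    filter_upwards [h1] with h hh
    have h3 : Real.exp (-h) = 1 := by
      simp only [Pi.zero_apply] at hh
      linarith
    simpa using h3
  have h4 := hμ.mean_one
  rw [integral_congr_ae h2] at h4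
  simp at h4

/-- Where `t L ≥ 1` the exponent `h t L` is at least `h`, so the bound depends on neither `t` nor
`x`. -/
lemma le_lossTransform (hμ : IsFadingLaw μ) (hL : IsFeasiblePathLoss ν L L₀) {t x c : ℝ}
    (ht : 0 ≤ t) (hx : 0 ≤ x) (hc : ∀ᵐ s ∂ν, c ≤ L x s) (htc : 1 ≤ t * c) :
    ∫ h, (1 - Real.exp (-h)) ∂μ ≤ lossTransform μ ν L t x := by
  have := hμ.prob
  have := hL.prob
  have h1 : ∫ h, (1 - Real.exp (-h)) ∂μ = ∫ p : ℝ × S, (1 - Real.exp (-p.1)) ∂(μ.prod ν) := by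
    rw [integral_fun_fst (fun h : ℝ => 1 - Real.exp (-h))]
    simp
  rw [h1]
  refine integral_mono_of_nonneg ?_ (integrable_one_sub_exp hμ hL ht hx) ?_
  · filter_upwards [ae_nonneg_fading_and_loss hμ hL hx] with p hp
    have : Real.exp (-p.1) ≤ 1 := Real.exp_le_one_iff.2 (by linarith [hp.1])
    simp only [Pi.zero_apply]
    linarith
  · filter_upwards [ae_nonneg_fading_and_loss hμ hL hx,
      Measure.quasiMeasurePreserving_snd.ae hc] with p hp hcp
    have h2 : p.1 ≤ p.1 * t * L x p.2 := by
      have h3 : t * c ≤ t * L x p.2 := by gcongr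
      nlinarith [hp.1]
    have h4 : Real.exp (-(p.1 * t * L x p.2)) ≤ Real.exp (-p.1) :=
      Real.exp_le_exp.2 (neg_le_neg h2)
    linarith

/-- The integrated form of the ratio hypothesis: `(log Lt)' ≥ -r/ζ`. -/
lemma log_add_sq_monotoneOn {Lt : ℝ → ℝ} {r₀ ζ : ℝ} (hζ : 0 < ζ)
    (hpos : ∀ r ∈ Ici r₀, 0 < Lt r) (hdiff : DifferentiableOn ℝ Lt (Ici r₀))
    (hratio : ∀ r ∈ Ici r₀, ζ * (-derivWithin Lt (Ici r₀) r) ≤ r * Lt r) :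
    MonotoneOn (fun r => Real.log (Lt r) + r ^ 2 / (2 * ζ)) (Ici r₀) := by
  have hder : ∀ x ∈ interior (Ici r₀), HasDerivAt (fun r => Real.log (Lt r) + r ^ 2 / (2 * ζ))
      (derivWithin Lt (Ici r₀) x / Lt x + x / ζ) x := by
    intro x hx
    have hx' : x ∈ Ici r₀ := interior_subset hx
    have h1 : HasDerivAt Lt (derivWithin Lt (Ici r₀) x) x :=
      (hdiff x hx').hasDerivWithinAt.hasDerivAt (mem_interior_iff_mem_nhds.1 hx)
    have h2 := (h1.log (hpos x hx').ne').add ((hasDerivAt_pow 2 x).div_const (2 * ζ))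
    refine h2.congr_deriv ?_
    field_simp
    simp only [Nat.cast_ofNat, Nat.add_one_sub_one, pow_one]
    ring
  refine monotoneOn_of_deriv_nonneg (convex_Ici r₀) ?_ ?_ fun x hx => ?_
  · exact (hdiff.continuousOn.log fun x hx => (hpos x hx).ne').add (by fun_prop)
  · exact fun x hx => (hder x hx).differentiableAt.differentiableWithinAt
  · rw [(hder x hx).deriv]
    have hx' : x ∈ Ici r₀ := interior_subset hx
    have h3 := hratio x hx'
    have h4 := hpos x hx'
    rw [div_add_div _ _ h4.ne' hζ.ne']
    refine div_nonneg ?_ (by positivity)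
    linarith

variable {Lt : ℝ → ℝ} {r₀ ζ : ℝ}

lemma le_integral_mul_lossTransform (hμ : IsFadingLaw μ) (hL : IsFeasiblePathLoss ν L L₀)
    (hr₀ : 0 ≤ r₀) (hζ : 0 < ζ)
    (hpos : ∀ r ∈ Ici r₀, 0 < Lt r) (hanti : AntitoneOn Lt (Ici r₀))
    (hdiff : DifferentiableOn ℝ Lt (Ici r₀))
    (hle : ∀ r ∈ Ici r₀, ∀ᵐ s ∂ν, Lt r ≤ L r s)
    (hratio : ∀ r ∈ Ici r₀, ζ * (-derivWithin Lt (Ici r₀) r) ≤ r * Lt r)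
    {t r : ℝ} (ht : 0 < t) (hr : r₀ ≤ r) (htr : 1 ≤ t * Lt r) :
    (∫ h, (1 - Real.exp (-h)) ∂μ) * ζ * Real.log (t * Lt r) ≤
      ∫ x in Ioi r, x * lossTransform μ ν L t x := by
  set c := ∫ h, (1 - Real.exp (-h)) ∂μ with hc
  have hr0 : 0 ≤ r := hr₀.trans hr
  have hlog : 0 ≤ Real.log (t * Lt r) := Real.log_nonneg htr
  -- The farthest distance at which the ratio hypothesis still guarantees `t Lt ≥ 1`: up to `R`,
  -- `log Lt` drops by at most `(R² - r²)/(2ζ) = log(t Lt r)`.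
  set R := Real.sqrt (r ^ 2 + 2 * ζ * Real.log (t * Lt r)) with hR
  have hRsq : R ^ 2 = r ^ 2 + 2 * ζ * Real.log (t * Lt r) := Real.sq_sqrt (by positivity)
  have hrR : r ≤ R := Real.le_sqrt_of_sq_le (by
    have : 0 ≤ 2 * ζ * Real.log (t * Lt r) := by positivity
    linarith)
  have hRm : R ∈ Ici r₀ := hr.trans hrR
  have hLr := hpos r hr
  have hLR := hpos R hRm
  have htR : 1 ≤ t * Lt R := by
    have h1 := log_add_sq_monotoneOn hζ hpos hdiff hratio hr hRm hrR
    simp only [hRsq] at h1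
    have h2 : (r ^ 2 + 2 * ζ * Real.log (t * Lt r)) / (2 * ζ) =
        r ^ 2 / (2 * ζ) + Real.log (t * Lt r) := by
      field_simp
    rw [h2, Real.log_mul ht.ne' hLr.ne'] at h1
    have h3 : 0 ≤ Real.log (t * Lt R) := by
      rw [Real.log_mul ht.ne' hLR.ne']
      linarith
    by_contra! hlt
    have := Real.log_neg (by positivity) hlt
    linarith
  have hint := (integrableOn_mul_lossTransform hμ hL ht.le).mono_set (Ioi_subset_Ioi hr0)
  calc c * ζ * Real.log (t * Lt r) = c * ((R ^ 2 - r ^ 2) / 2) := by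
        rw [hRsq]
        ring
    _ = ∫ x in r..R, c * x := by
        rw [intervalIntegral.integral_const_mul, integral_id]
    _ = ∫ x in Ioc r R, c * x := intervalIntegral.integral_of_le hrR
    _ ≤ ∫ x in Ioc r R, x * lossTransform μ ν L t x := by
        refine setIntegral_mono_on ?_ (hint.mono_set Ioc_subset_Ioi_self) measurableSet_Ioc
          fun x hx => ?_
        · exact (Continuous.integrableOn_Icc (by fun_prop)).mono_set Ioc_subset_Icc_self
        · have hx0 : 0 ≤ x := hr0.trans hx.1.le
          have hxm : x ∈ Ici r₀ := hr.trans hx.1.le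
          have h1 : Lt R ≤ Lt x := hanti hxm hRm hx.2
          have h2 : 1 ≤ t * Lt x := htR.trans (by gcongr)
          rw [mul_comm c]
          exact mul_le_mul_of_nonneg_left (le_lossTransform hμ hL ht.le hx0 (hle x hxm) h2) hx0
    _ ≤ _ := by
        refine setIntegral_mono_set hint ?_ Ioc_subset_Ioi_self.eventuallyLE
        filter_upwards [ae_restrict_mem measurableSet_Ioi] with x hx
        have hx0 : 0 ≤ x := hr0.trans (le_of_lt hx)
        exact mul_nonneg hx0 (lossTransform_nonneg hμ hL ht.le hx0)

lemma setLIntegral_Ioi_cauchy {l : ℝ} (hl : 0 < l) :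
    ∫⁻ t in Ioi (0 : ℝ), ENNReal.ofReal (l⁻¹ * (2 * (1 + (l * t) ^ 2)⁻¹)) =
      ENNReal.ofReal (Real.pi / l ^ 2) := by
  have h1 := lintegral_Ioi_eq_mul_lintegral_comp_mul hl
    (fun x => ENNReal.ofReal (l⁻¹ * (2 * (1 + x ^ 2)⁻¹)))
  have h2 : ∫⁻ x in Ioi (0 : ℝ), ENNReal.ofReal (l⁻¹ * (2 * (1 + x ^ 2)⁻¹)) =
      ENNReal.ofReal (Real.pi / l) := by
    rw [← ofReal_integral_eq_lintegral_ofReal, integral_const_mul, integral_const_mul,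
      integral_Ioi_inv_one_add_sq, Real.arctan_zero]
    · congr 1
      ring
    · exact ((integrable_inv_one_add_sq.integrableOn).const_mul 2).const_mul l⁻¹
    · exact ae_of_all _ fun x => by
        simp only [Pi.zero_apply]
        positivity
  rw [h2] at h1
  have h3 : ENNReal.ofReal l⁻¹ * ENNReal.ofReal l = 1 := by
    rw [← ENNReal.ofReal_mul (by positivity), inv_mul_cancel₀ hl.ne', ENNReal.ofReal_one]
  rw [← one_mul (∫⁻ t in Ioi (0 : ℝ), _), ← h3, mul_assoc, ← h1,
    ← ENNReal.ofReal_mul (by positivity)]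
  congr 1
  field_simp

/-- With `y = Lt (max r r₀) · t`, the exponential is at most `1`, and at most `y⁻³` when `y ≥ 1`.
The constant `3` spends one power on the factor `t` and leaves the integrable `y⁻²`; both cases fit
under the Cauchy density `2/(1 + y²)`. For `r < r₀` the loss integral is cut down to start at `r₀`.
-/
lemma mul_exp_neg_integral_le (hμ : IsFadingLaw μ) (hL : IsFeasiblePathLoss ν L L₀)
    (hr₀ : 0 ≤ r₀) (hζ : 0 < ζ)
    (hpos : ∀ r ∈ Ici r₀, 0 < Lt r) (hanti : AntitoneOn Lt (Ici r₀))
    (hdiff : DifferentiableOn ℝ Lt (Ici r₀))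
    (hle : ∀ r ∈ Ici r₀, ∀ᵐ s ∂ν, Lt r ≤ L r s)
    (hratio : ∀ r ∈ Ici r₀, ζ * (-derivWithin Lt (Ici r₀) r) ≤ r * Lt r)
    {lam : ℝ} (hlam : 0 ≤ lam)
    (hlarge : 3 ≤ 2 * Real.pi * lam * ((∫ h, (1 - Real.exp (-h)) ∂μ) * ζ))
    {t r : ℝ} (ht : 0 < t) (hr : 0 ≤ r) :
    t * Real.exp (-(2 * Real.pi * lam * ∫ x in Ioi r, x * lossTransform μ ν L t x)) ≤
      (Lt (max r r₀))⁻¹ * (2 * (1 + (Lt (max r r₀) * t) ^ 2)⁻¹) := by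
  have hpi := Real.pi_pos
  have hm : max r r₀ ∈ Ici r₀ := mem_Ici.2 (le_max_right r r₀)
  have hm0 : 0 ≤ max r r₀ := hr.trans (le_max_left _ _)
  set l := Lt (max r r₀) with hl
  have hl0 : 0 < l := hpos _ hm
  set J := ∫ x in Ioi r, x * lossTransform μ ν L t x with hJ
  have hnn : ∀ x, 0 ≤ x → 0 ≤ x * lossTransform μ ν L t x := fun x hx =>
    mul_nonneg hx (lossTransform_nonneg hμ hL ht.le hx)
  have hJ0 : 0 ≤ J := setIntegral_nonneg measurableSet_Ioi fun x hx =>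
    hnn x (hr.trans (le_of_lt hx))
  have hJm : ∫ x in Ioi (max r r₀), x * lossTransform μ ν L t x ≤ J := by
    refine setIntegral_mono_set
      ((integrableOn_mul_lossTransform hμ hL ht.le).mono_set (Ioi_subset_Ioi hr)) ?_
      (Ioi_subset_Ioi (le_max_left _ _)).eventuallyLE
    filter_upwards [ae_restrict_mem measurableSet_Ioi] with x hx
    exact hnn x (hr.trans (le_of_lt hx))
  have hexp1 : Real.exp (-(2 * Real.pi * lam * J)) ≤ 1 :=
    Real.exp_le_one_iff.2 (neg_nonpos.2 (by positivity))
  set y := l * t with hy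
  have hy0 : 0 < y := by positivity
  have key : y * Real.exp (-(2 * Real.pi * lam * J)) ≤ 2 * (1 + y ^ 2)⁻¹ := by
    rw [← div_eq_mul_inv, le_div_iff₀ (by positivity)]
    rcases le_total y 1 with h1 | h1
    · have h2 : y * Real.exp (-(2 * Real.pi * lam * J)) ≤ 1 * 1 :=
        mul_le_mul h1 hexp1 (Real.exp_pos _).le zero_le_one
      have h3 : 1 + y ^ 2 ≤ 2 := by nlinarith
      have h4 : 0 ≤ y * Real.exp (-(2 * Real.pi * lam * J)) := by positivity
      nlinarith
    · have h2 := le_integral_mul_lossTransform hμ hL hr₀ hζ hpos hanti hdiff hle hratio ht hm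
        (by rw [← hl, mul_comm]; exact h1)
      rw [← hl, mul_comm t l, ← hy] at h2
      have hlog : 0 ≤ Real.log y := Real.log_nonneg h1
      have h3 : 3 * Real.log y ≤ 2 * Real.pi * lam * J := by
        calc 3 * Real.log y
            ≤ 2 * Real.pi * lam * ((∫ h, (1 - Real.exp (-h)) ∂μ) * ζ) * Real.log y := by gcongr
          _ = 2 * Real.pi * lam * ((∫ h, (1 - Real.exp (-h)) ∂μ) * ζ * Real.log y) := by ring
          _ ≤ _ := by
            have := h2.trans hJm
            gcongr
      have h4 : Real.exp (-(2 * Real.pi * lam * J)) ≤ (y ^ 3)⁻¹ := by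
        have h5 : (y ^ 3)⁻¹ = Real.exp (-(3 * Real.log y)) := by
          rw [Real.exp_neg, mul_comm, Real.exp_mul, Real.exp_log hy0]
          norm_cast
        rw [h5]
        exact Real.exp_le_exp.2 (neg_le_neg h3)
      calc y * Real.exp (-(2 * Real.pi * lam * J)) * (1 + y ^ 2)
          ≤ y * (y ^ 3)⁻¹ * (1 + y ^ 2) := by gcongr
        _ = (1 + y ^ 2) / y ^ 2 := by field_simp
        _ ≤ 2 := by
          rw [div_le_iff₀ (by positivity)]
          nlinarith
  have h6 : t = l⁻¹ * y := by
    rw [hy]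
    field_simp
  calc t * Real.exp (-(2 * Real.pi * lam * J)) = l⁻¹ * (y * Real.exp (-(2 * Real.pi * lam * J))) := by
        rw [← mul_assoc, ← h6]
    _ ≤ _ := by gcongr

theorem firstCondition_of_lower_bound (hμ : IsFadingLaw μ) (hL : IsFeasiblePathLoss ν L L₀)
    {lamc : ℝ} (hr₀ : 0 ≤ r₀) (hζ : 0 < ζ) (hlamc : 0 ≤ lamc)
    (hpos : ∀ r ∈ Ici r₀, 0 < Lt r) (hanti : AntitoneOn Lt (Ici r₀))
    (hdiff : DifferentiableOn ℝ Lt (Ici r₀))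
    (hle : ∀ r ∈ Ici r₀, ∀ᵐ s ∂ν, Lt r ≤ L r s)
    (hratio : ∀ r ∈ Ici r₀, ζ * (-derivWithin Lt (Ici r₀) r) ≤ r * Lt r)
    (hint : ∀ lam : ℝ, lamc < lam →
      IntegrableOn (fun r => r / Lt r ^ 2 * Real.exp (-(Real.pi * lam * r ^ 2))) (Ici r₀)) :
    FirstCondition μ ν L := by
  have hpi := Real.pi_pos
  set c := ∫ h, (1 - Real.exp (-h)) ∂μ with hc
  have hc0 : 0 < c := integral_one_sub_exp_neg_pos hμ
  -- The first entry makes `lamc < lam` strict, as the integrability hypothesis requires; the second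
  -- makes the decay exponent `2πλcζ` at least `3`.
  refine ⟨max (lamc + 1) (3 / (2 * Real.pi * (c * ζ))), le_max_of_le_left (by linarith),
    fun lam hlam => ?_⟩
  have hlam1 : lamc < lam := by linarith [(le_max_left _ _).trans hlam]
  have hlam0 : 0 < lam := hlamc.trans_lt hlam1
  have hlarge : 3 ≤ 2 * Real.pi * lam * (c * ζ) := by
    have := (le_max_right _ _).trans hlam
    rw [div_le_iff₀ (by positivity)] at this
    linarith
  set A : ℝ → ENNReal := fun r =>
    ENNReal.ofReal (2 * Real.pi * lam * r * Real.exp (-(Real.pi * lam * r ^ 2))) with hA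
  have hswap : momentIntegral μ ν L lam =
      ∫⁻ r in Ioi (0 : ℝ), ∫⁻ t in Ioi (0 : ℝ), ENNReal.ofReal (2 * Real.pi * lam * r * t *
        Real.exp (-lossExponent μ ν L lam t r)) := by
    rw [lintegral_lintegral_swap]
    · rw [momentIntegral]
      simp only [lossExponent, lossTransform, neg_add']
    · refine Measurable.aemeasurable ?_
      have h1 : Measurable fun p : ℝ × ℝ => lossExponent μ ν L lam p.2 p.1 :=
        (measurable_lossExponent hμ hL).comp measurable_swap
      simp only [Function.uncurry_def]
      fun_prop
  -- Integrating in `t` first produces the factor `Lt⁻²` that the integrability hypothesis can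
  -- absorb.
  have hinner : ∀ r ∈ Ioi (0 : ℝ), ∫⁻ t in Ioi (0 : ℝ), ENNReal.ofReal (2 * Real.pi * lam * r * t *
        Real.exp (-lossExponent μ ν L lam t r)) ≤
      A r * ENNReal.ofReal (Real.pi / Lt (max r r₀) ^ 2) := by
    intro r hr
    have hr0 : (0 : ℝ) < r := hr
    rw [← setLIntegral_Ioi_cauchy (hpos _ (mem_Ici.2 (le_max_right r r₀))), hA,
      ← lintegral_const_mul' _ _ ENNReal.ofReal_ne_top]
    refine setLIntegral_mono' measurableSet_Ioi fun t ht => ?_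
    have ht0 : (0 : ℝ) < t := ht
    rw [← ENNReal.ofReal_mul (by positivity)]
    refine ENNReal.ofReal_le_ofReal ?_
    have h1 := mul_exp_neg_integral_le hμ hL hr₀ hζ hpos hanti hdiff hle hratio hlam0.le hlarge
      ht0 hr0.le
    calc _ = 2 * Real.pi * lam * r * Real.exp (-(Real.pi * lam * r ^ 2)) *
          (t * Real.exp (-(2 * Real.pi * lam * ∫ x in Ioi r, x * lossTransform μ ν L t x))) := by
          rw [lossExponent, neg_add, Real.exp_add]
          ring
      _ ≤ _ := by gcongr
  rw [hswap]
  refine (setLIntegral_mono' measurableSet_Ioi hinner).trans_lt ?_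
  -- Below `r₀` the factor is the constant `π / Lt r₀ ^ 2` and the Rayleigh density has finite mass;
  -- above `r₀` the integral is a multiple of the assumed one.
  rw [← Ioc_union_Ioi_eq_Ioi hr₀, lintegral_union measurableSet_Ioi
    (Set.disjoint_left.2 fun x hx hx' => not_lt.2 hx.2 hx')]
  refine ENNReal.add_lt_top.2 ⟨?_, ?_⟩
  · have h1 : ∫⁻ r in Ioc 0 r₀, A r * ENNReal.ofReal (Real.pi / Lt (max r r₀) ^ 2) =
        (∫⁻ r in Ioc 0 r₀, A r) * ENNReal.ofReal (Real.pi / Lt r₀ ^ 2) := by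
      rw [← lintegral_mul_const' _ _ ENNReal.ofReal_ne_top]
      refine setLIntegral_congr_fun measurableSet_Ioc fun r hr => ?_
      simp only [max_eq_right hr.2]
    rw [h1]
    refine ENNReal.mul_lt_top ?_ ENNReal.ofReal_lt_top
    refine (lintegral_mono_set Ioc_subset_Ioi_self).trans_lt ?_
    rw [hA, lintegral_rayleigh hlam0]
    exact ENNReal.one_lt_top
  · have h2 := (((hint lam hlam1).mono_set Ioi_subset_Ici_self).const_mul
      (2 * Real.pi * lam * Real.pi)).lintegral_lt_top
    refine (lintegral_mono_ae ?_).trans_lt h2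
    filter_upwards [ae_restrict_mem measurableSet_Ioi] with r hr
    have hr' : r₀ < r := hr
    have hr0 : 0 < r := hr₀.trans_lt hr'
    rw [max_eq_left hr'.le, hA, ← ENNReal.ofReal_mul (by positivity)]
    refine ENNReal.ofReal_le_ofReal (le_of_eq ?_)
    ring

end FirstCondition

/-! ### The limit of high base station density -/

section Asymptotics

lemma tendsto_mul_one_sub_exp_neg_div {y : ℝ} (hy : 0 ≤ y) :
    Tendsto (fun n : ℝ => n * (1 - Real.exp (-(y / n)))) atTop (𝓝 y) := by
  have h1 : Tendsto (fun n : ℝ => y / (1 + y / n)) atTop (𝓝 y) := by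
    have h2 : Tendsto (fun n : ℝ => 1 + y / n) atTop (𝓝 1) := by
      simpa using (tendsto_const_nhds.div_atTop tendsto_id : Tendsto (fun n : ℝ => y / n) atTop
        (𝓝 0)).const_add 1
    have h3 := (tendsto_const_nhds (x := y)).div h2 one_ne_zero
    rw [div_one] at h3
    exact h3
  refine tendsto_of_tendsto_of_tendsto_of_le_of_le' h1 tendsto_const_nhds ?_ ?_
  · filter_upwards [eventually_gt_atTop 0] with n hn
    have hz : 0 ≤ y / n := by positivity
    have h3 : Real.exp (-(y / n)) ≤ (1 + y / n)⁻¹ := by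
      rw [Real.exp_neg]
      exact inv_anti₀ (by positivity) (by linarith [Real.add_one_le_exp (y / n)])
    calc y / (1 + y / n) = n * (1 - (1 + y / n)⁻¹) := by
          field_simp
          ring
      _ ≤ _ := by gcongr
  · filter_upwards [eventually_gt_atTop 0] with n hn
    calc n * (1 - Real.exp (-(y / n))) ≤ n * (y / n) := by
          have := one_sub_exp_neg_le (y / n)
          gcongr
      _ = y := by field_simp

lemma tendsto_mul_integral_one_sub_exp {α : Type*} [MeasurableSpace α] {m : Measure α}
    {Y : α → ℝ} (hY : Integrable Y m) (hY0 : ∀ᵐ a ∂m, 0 ≤ Y a) :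
    Tendsto (fun n : ℝ => n * ∫ a, (1 - Real.exp (-(Y a / n))) ∂m) atTop (𝓝 (∫ a, Y a ∂m)) := by
  simp_rw [← integral_const_mul]
  refine tendsto_integral_filter_of_dominated_convergence Y ?_ ?_ hY ?_
  · refine Eventually.of_forall fun n => ?_
    have := hY.aestronglyMeasurable.aemeasurable
    exact AEMeasurable.aestronglyMeasurable (by fun_prop)
  · filter_upwards [eventually_gt_atTop 0] with n hn
    filter_upwards [hY0] with a ha
    have h1 : 0 ≤ Y a / n := by positivity
    have h2 : Real.exp (-(Y a / n)) ≤ 1 := Real.exp_le_one_iff.2 (by linarith)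
    rw [Real.norm_of_nonneg (mul_nonneg hn.le (by linarith))]
    calc n * (1 - Real.exp (-(Y a / n))) ≤ n * (Y a / n) := by
          have := one_sub_exp_neg_le (Y a / n)
          gcongr
      _ = Y a := by field_simp
  · filter_upwards [hY0] with a ha
    exact tendsto_mul_one_sub_exp_neg_div ha

/-- Convexity of `exp`: the point `-y/b` lies between `-y/a` and `0`, with weight `a/b` on the
former. -/
lemma mul_one_sub_exp_neg_div_mono {y a b : ℝ} (ha : 0 < a) (hab : a ≤ b) :
    a * (1 - Real.exp (-(y / a))) ≤ b * (1 - Real.exp (-(y / b))) := by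
  have hb : 0 < b := ha.trans_le hab
  have h1 := convexOn_exp.2 (mem_univ (-(y / a))) (mem_univ 0)
    (show 0 ≤ a / b by positivity) (sub_nonneg.2 ((div_le_one hb).2 hab)) (add_sub_cancel _ _)
  have h2 : (a / b) • (-(y / a)) + (1 - a / b) • (0 : ℝ) = -(y / b) := by
    simp only [smul_eq_mul]
    field_simp
    ring
  rw [h2] at h1
  simp only [smul_eq_mul, Real.exp_zero, mul_one] at h1
  have h3 : b * Real.exp (-(y / b)) ≤ b * (a / b * Real.exp (-(y / a)) + (1 - a / b)) := by
    gcongr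
  have h4 : b * (a / b * Real.exp (-(y / a)) + (1 - a / b)) =
      a * Real.exp (-(y / a)) + b - a := by
    field_simp
    ring
  linarith

lemma abs_exp_neg_sub_exp_neg_le {a b : ℝ} (ha : 0 ≤ a) (hb : 0 ≤ b) :
    |Real.exp (-a) - Real.exp (-b)| ≤ |a - b| := by
  wlog hab : a ≤ b generalizing a b
  · rw [abs_sub_comm, abs_sub_comm a b]
    exact this hb ha (le_of_not_ge hab)
  have h1 : Real.exp (-b) ≤ Real.exp (-a) := Real.exp_le_exp.2 (by linarith)
  have h4 : Real.exp (-b) = Real.exp (-a) * Real.exp (-(b - a)) := by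
    rw [← Real.exp_add]
    congr 1
    ring
  have h5 := Real.add_one_le_exp (-(b - a))
  have h6 : Real.exp (-a) ≤ 1 := Real.exp_le_one_iff.2 (by linarith)
  have h7 := Real.exp_pos (-a)
  rw [abs_of_nonneg (by linarith), abs_sub_comm, abs_of_nonneg (by linarith), h4]
  nlinarith

variable {S : Type*} [MeasurableSpace S] {μ : Measure ℝ} {ν : Measure S} {L : ℝ → S → ℝ} {L₀ : ℝ}

lemma IsFeasiblePathLoss.loss_zero_nonneg (hL : IsFeasiblePathLoss ν L L₀) : 0 ≤ L₀ := by
  have := hL.prob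
  obtain ⟨s, h1, h2⟩ := ((hL.nonneg 0 le_rfl).and (hL.le_at_zero 0 le_rfl)).exists
  exact h1.trans h2

lemma meanLoss_le (hL : IsFeasiblePathLoss ν L L₀) {x : ℝ} (hx : 0 ≤ x) :
    meanLoss ν L x ≤ L₀ := by
  have := hL.prob
  have h1 : ∫ s, L x s ∂ν ≤ ∫ _, L₀ ∂ν :=
    integral_mono_ae (integrable_loss hL hx) (integrable_const _) (hL.le_at_zero x hx)
  simpa [meanLoss] using h1

/-- Since `0 ≤ L ≤ L₀`, convergence in probability improves to convergence in mean: the difference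
is at most `ε/2`, except on an event of small probability where it is at most `L₀`. -/
lemma tendsto_integral_abs_loss_sub (hL : IsFeasiblePathLoss ν L L₀)
    (h : TendstoInMeasure ν L (𝓝[>] (0 : ℝ)) (fun _ => L₀)) :
    Tendsto (fun r => ∫ s, |L r s - L₀| ∂ν) (𝓝[>] 0) (𝓝 0) := by
  have := hL.prob
  have hL0 := hL.loss_zero_nonneg
  rw [tendstoInMeasure_iff_measureReal_dist] at h
  rw [Metric.tendsto_nhds]
  intro ε hε
  have hδ : 0 < ε / 2 := by positivity
  have h1 := (h (ε / 2) hδ).const_mul L₀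
  rw [mul_zero] at h1
  filter_upwards [h1.eventually_lt_const hδ, self_mem_nhdsWithin] with r hr hr0
  have hr0' : (0 : ℝ) ≤ r := le_of_lt hr0
  have hLm := hL.measurable_apply r
  have hB : MeasurableSet {s | ε / 2 ≤ dist (L r s) L₀} :=
    measurableSet_le measurable_const (hLm.dist measurable_const)
  rw [Real.dist_eq, sub_zero, abs_of_nonneg (integral_nonneg fun s => abs_nonneg _)]
  have h2 : ∫ s, |L r s - L₀| ∂ν ≤
      ∫ s, (ε / 2 + {s | ε / 2 ≤ dist (L r s) L₀}.indicator (fun _ => L₀) s) ∂ν := by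
    refine integral_mono_ae ((integrable_loss hL hr0').sub (integrable_const _)).abs
      ((integrable_const _).add ((integrable_const _).indicator hB)) ?_
    filter_upwards [hL.nonneg r hr0', hL.le_at_zero r hr0'] with s hs1 hs2
    by_cases hs : ε / 2 ≤ dist (L r s) L₀
    · rw [indicator_of_mem (s := {s | ε / 2 ≤ dist (L r s) L₀}) hs, abs_sub_comm,
        abs_of_nonneg (by linarith)]
      linarith
    · rw [indicator_of_notMem (s := {s | ε / 2 ≤ dist (L r s) L₀}) hs, add_zero]
      exact (not_le.1 hs).le
  rw [integral_add (integrable_const _) ((integrable_const _).indicator hB),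
    integral_indicator_const _ hB] at h2
  simp only [integral_const, probReal_univ, smul_eq_mul] at h2
  linarith

lemma abs_lossTransform_sub_le (hμ : IsFadingLaw μ) (hL : IsFeasiblePathLoss ν L L₀) {t x : ℝ}
    (ht : 0 ≤ t) (hx : 0 ≤ x) :
    |lossTransform μ ν L t x - ∫ p : ℝ × S, (1 - Real.exp (-(p.1 * t * L₀))) ∂(μ.prod ν)| ≤
      t * ∫ s, |L x s - L₀| ∂ν := by
  have := hμ.prob
  have := hL.prob
  have hL0 := hL.loss_zero_nonneg
  have hint0 : Integrable (fun p : ℝ × S => 1 - Real.exp (-(p.1 * t * L₀))) (μ.prod ν) := by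
    refine Integrable.of_bound (C := 1) (by fun_prop) ?_
    filter_upwards [ae_nonneg_fading_and_loss hμ hL hx] with p hp
    have h1 : 0 ≤ p.1 * t * L₀ := mul_nonneg (mul_nonneg hp.1 ht) hL0
    have h2 : Real.exp (-(p.1 * t * L₀)) ≤ 1 := Real.exp_le_one_iff.2 (by linarith)
    have h3 := Real.exp_pos (-(p.1 * t * L₀))
    rw [Real.norm_of_nonneg (by linarith)]
    linarith
  have hd : Integrable (fun p : ℝ × S => p.1 * |L x p.2 - L₀|) (μ.prod ν) :=
    hμ.integrable.mul_prod ((integrable_loss hL hx).sub (integrable_const _)).abs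
  have h4 : ∫ p : ℝ × S, t * (p.1 * |L x p.2 - L₀|) ∂(μ.prod ν) = t * ∫ s, |L x s - L₀| ∂ν := by
    rw [integral_const_mul, integral_prod_mul (fun h : ℝ => h) (fun s => |L x s - L₀|),
      hμ.mean_one, one_mul]
  rw [← h4, lossTransform, ← integral_sub (integrable_one_sub_exp hμ hL ht hx) hint0]
  refine (abs_integral_le_integral_abs).trans (integral_mono_of_nonneg
    (ae_of_all _ fun p => abs_nonneg _) (hd.const_mul t) ?_)
  filter_upwards [ae_nonneg_fading_and_loss hμ hL hx] with p hp
  have h5 : 0 ≤ p.1 * t := mul_nonneg hp.1 ht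
  have h6 := abs_exp_neg_sub_exp_neg_le (mul_nonneg h5 hL0) (mul_nonneg h5 hp.2.1)
  calc |1 - Real.exp (-(p.1 * t * L x p.2)) - (1 - Real.exp (-(p.1 * t * L₀)))|
      = |Real.exp (-(p.1 * t * L₀)) - Real.exp (-(p.1 * t * L x p.2))| := by
        congr 1
        ring
    _ ≤ |p.1 * t * L₀ - p.1 * t * L x p.2| := h6
    _ = t * (p.1 * |L x p.2 - L₀|) := by
        rw [← mul_sub, abs_mul, abs_of_nonneg h5, abs_sub_comm]
        ring

/-- Two limits are decoupled. Replacing `L` by `L₀` costs at most `E|L - L₀|` at distance `r/√λ`,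
uniformly in `t` after division by `t`; with the constant loss `L₀`, the quotient is a difference
quotient at `t = 0` with limit `L₀ E[h] = L₀`. -/
lemma tendsto_lossTransform_div (hμ : IsFadingLaw μ) (hL : IsFeasiblePathLoss ν L L₀)
    (h : TendstoInMeasure ν L (𝓝[>] (0 : ℝ)) (fun _ => L₀)) {s r : ℝ} (hs : 0 < s) (hr : 0 < r) :
    Tendsto (fun lam : ℝ => lossTransform μ ν L (lam⁻¹ * s) ((Real.sqrt lam)⁻¹ * r) /
      (lam⁻¹ * s)) atTop (𝓝 L₀) := by
  have := hμ.prob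
  have := hL.prob
  have hL0 := hL.loss_zero_nonneg
  have hint : Integrable (fun p : ℝ × S => p.1 * (s * L₀)) (μ.prod ν) :=
    (hμ.integrable.comp_fst ν).mul_const _
  have h1 := tendsto_mul_integral_one_sub_exp hint (by
    filter_upwards [Measure.quasiMeasurePreserving_fst.ae hμ.nonneg] with p hp
    exact mul_nonneg hp (by positivity))
  have hval : ∫ p : ℝ × S, p.1 * (s * L₀) ∂(μ.prod ν) = s * L₀ := by
    rw [integral_mul_const, integral_fun_fst (fun h : ℝ => h), hμ.mean_one]
    simp
  rw [hval] at h1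
  have h2 : Tendsto (fun lam : ℝ => (∫ p : ℝ × S, (1 - Real.exp (-(p.1 * (lam⁻¹ * s) * L₀)))
      ∂(μ.prod ν)) / (lam⁻¹ * s)) atTop (𝓝 L₀) := by
    have h3 := h1.div_const s
    rw [mul_div_cancel_left₀ _ hs.ne'] at h3
    refine h3.congr' ?_
    filter_upwards [eventually_gt_atTop 0] with lam hlam
    have h4 : ∀ p : ℝ × S, p.1 * (s * L₀) / lam = p.1 * (lam⁻¹ * s) * L₀ := fun p => by
      field_simp
    simp_rw [h4]
    generalize ∫ p : ℝ × S, (1 - Real.exp (-(p.1 * (lam⁻¹ * s) * L₀))) ∂(μ.prod ν) = z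
    field_simp
  have hx : Tendsto (fun lam : ℝ => (Real.sqrt lam)⁻¹ * r) atTop (𝓝[>] 0) := by
    refine tendsto_nhdsWithin_iff.2 ⟨?_, ?_⟩
    · simpa using (tendsto_inv_atTop_zero.comp Real.tendsto_sqrt_atTop).mul_const r
    · filter_upwards [eventually_gt_atTop 0] with lam hlam
      have := Real.sqrt_pos.2 hlam
      exact mem_Ioi.2 (by positivity)
  have h5 := (tendsto_integral_abs_loss_sub hL h).comp hx
  have h6 : Tendsto (fun lam : ℝ =>
      lossTransform μ ν L (lam⁻¹ * s) ((Real.sqrt lam)⁻¹ * r) / (lam⁻¹ * s) -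
        (∫ p : ℝ × S, (1 - Real.exp (-(p.1 * (lam⁻¹ * s) * L₀))) ∂(μ.prod ν)) / (lam⁻¹ * s))
      atTop (𝓝 0) := by
    refine squeeze_zero_norm' ?_ h5
    filter_upwards [eventually_gt_atTop 0] with lam hlam
    have ht : 0 < lam⁻¹ * s := by positivity
    have h7 := abs_lossTransform_sub_le hμ hL ht.le
      (show 0 ≤ (Real.sqrt lam)⁻¹ * r by positivity)
    rw [← sub_div, Real.norm_eq_abs, abs_div, abs_of_pos ht, div_le_iff₀ ht, mul_comm _ (lam⁻¹ * s)]
    exact h7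
  simpa using h6.add h2

lemma lossTransform_div_le (hμ : IsFadingLaw μ) (hL : IsFeasiblePathLoss ν L L₀) {t x : ℝ}
    (ht : 0 < t) (hx : 0 ≤ x) : lossTransform μ ν L t x / t ≤ L₀ := by
  rw [div_le_iff₀ ht, mul_comm]
  refine (lossTransform_le hμ hL ht.le hx).trans ?_
  have := meanLoss_le hL hx
  gcongr

lemma mul_lossTransform_mono (hμ : IsFadingLaw μ) (hL : IsFeasiblePathLoss ν L L₀)
    {s x a b : ℝ} (hs : 0 ≤ s) (hx : 0 ≤ x) (ha : 0 < a) (hab : a ≤ b) :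
    a * lossTransform μ ν L (a⁻¹ * s) x ≤ b * lossTransform μ ν L (b⁻¹ * s) x := by
  have hb : 0 < b := ha.trans_le hab
  rw [lossTransform, lossTransform, ← integral_const_mul, ← integral_const_mul]
  refine integral_mono_ae ((integrable_one_sub_exp hμ hL (by positivity) hx).const_mul a)
    ((integrable_one_sub_exp hμ hL (by positivity) hx).const_mul b) ?_
  refine ae_of_all _ fun p => ?_
  have h2 : ∀ c : ℝ, p.1 * (c⁻¹ * s) * L x p.2 = p.1 * s * L x p.2 / c := fun c => by ring
  simp only [h2]
  exact mul_one_sub_exp_neg_div_mono ha hab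

lemma tendsto_mul_lossTransform (hμ : IsFadingLaw μ) (hL : IsFeasiblePathLoss ν L L₀)
    {s x : ℝ} (hs : 0 ≤ s) (hx : 0 ≤ x) :
    Tendsto (fun lam : ℝ => lam * lossTransform μ ν L (lam⁻¹ * s) x) atTop
      (𝓝 (s * meanLoss ν L x)) := by
  have := hμ.prob
  have := hL.prob
  have h1 := tendsto_mul_integral_one_sub_exp ((integrable_fading_mul_loss hμ hL hx).const_mul s)
    (by
      filter_upwards [ae_nonneg_fading_and_loss hμ hL hx] with p hp
      exact mul_nonneg hs (mul_nonneg hp.1 hp.2.1))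
  rw [integral_const_mul, integral_fading_mul_loss hμ] at h1
  refine h1.congr fun lam => ?_
  rw [lossTransform]
  congr 2
  ext p
  congr 3
  ring

/-- The exponent in the scaling in which the serving distance and the interference have limits. -/
def scaledExponent (μ : Measure ℝ) (ν : Measure S) (L : ℝ → S → ℝ) (lam s r : ℝ) : ℝ :=
  lossExponent μ ν L lam (lam⁻¹ * s) ((Real.sqrt lam)⁻¹ * r)

lemma scaledExponent_eq {lam : ℝ} (hlam : 0 < lam) (s r : ℝ) :
    scaledExponent μ ν L lam s r = Real.pi * r ^ 2 + 2 * Real.pi *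
      ∫ x in Ioi ((Real.sqrt lam)⁻¹ * r), x * (lam * lossTransform μ ν L (lam⁻¹ * s) x) := by
  have h1 : ∫ x in Ioi ((Real.sqrt lam)⁻¹ * r), x * (lam * lossTransform μ ν L (lam⁻¹ * s) x) =
      lam * ∫ x in Ioi ((Real.sqrt lam)⁻¹ * r), x * lossTransform μ ν L (lam⁻¹ * s) x := by
    rw [← integral_const_mul]
    congr 1
    ext x
    ring
  rw [scaledExponent, lossExponent, h1, mul_pow, inv_pow, Real.sq_sqrt hlam.le]
  field_simp

/-- As the intensity grows, the rescaled integrand increases and the lower limit `r/√λ` moves down.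
This is the source of the dominating function in the final limit. -/
lemma scaledExponent_mono (hμ : IsFadingLaw μ) (hL : IsFeasiblePathLoss ν L L₀)
    {a b s r : ℝ} (ha : 0 < a) (hab : a ≤ b) (hs : 0 ≤ s) (hr : 0 ≤ r) :
    scaledExponent μ ν L a s r ≤ scaledExponent μ ν L b s r := by
  have hb : 0 < b := ha.trans_le hab
  have hpi := Real.pi_pos
  have hsa := Real.sqrt_pos.2 ha
  have hsb := Real.sqrt_pos.2 hb
  have hint : ∀ c, 0 < c → IntegrableOn
      (fun x => x * (c * lossTransform μ ν L (c⁻¹ * s) x)) (Ioi 0) := fun c hc => by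
    refine ((integrableOn_mul_lossTransform hμ hL
      (show 0 ≤ c⁻¹ * s by positivity)).const_mul c).congr (ae_of_all _ fun x => ?_)
    simp only
    ring
  rw [scaledExponent_eq ha, scaledExponent_eq hb]
  have h1 : (Real.sqrt b)⁻¹ * r ≤ (Real.sqrt a)⁻¹ * r := by gcongr
  have h2 : 0 ≤ (Real.sqrt b)⁻¹ * r := by positivity
  have h3 : ∫ x in Ioi ((Real.sqrt a)⁻¹ * r), x * (a * lossTransform μ ν L (a⁻¹ * s) x) ≤
      ∫ x in Ioi ((Real.sqrt b)⁻¹ * r), x * (b * lossTransform μ ν L (b⁻¹ * s) x) := by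
    refine (setIntegral_mono_on ((hint a ha).mono_set (Ioi_subset_Ioi (h2.trans h1)))
      ((hint b hb).mono_set (Ioi_subset_Ioi (h2.trans h1))) measurableSet_Ioi
      fun x hx => ?_).trans (setIntegral_mono_set ((hint b hb).mono_set (Ioi_subset_Ioi h2)) ?_
        (Ioi_subset_Ioi h1).eventuallyLE)
    · have hx0 : 0 ≤ x := (h2.trans h1).trans (le_of_lt hx)
      exact mul_le_mul_of_nonneg_left (mul_lossTransform_mono hμ hL hs hx0 ha hab) hx0
    · filter_upwards [ae_restrict_mem measurableSet_Ioi] with x hx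
      have hx0 : 0 ≤ x := h2.trans (le_of_lt hx)
      exact mul_nonneg hx0 (mul_nonneg hb.le
        (lossTransform_nonneg hμ hL (show 0 ≤ b⁻¹ * s by positivity) hx0))
  gcongr

/-- `λ φ_{s/λ}(x)` tends to `s E[L(x)]` and is dominated by it, while the lower limit of integration
tends to zero. In the limit the variables `r` and `s` separate. -/
lemma tendsto_scaledExponent (hμ : IsFadingLaw μ) (hL : IsFeasiblePathLoss ν L L₀)
    {s r : ℝ} (hs : 0 ≤ s) (hr : 0 ≤ r) :
    Tendsto (fun lam => scaledExponent μ ν L lam s r) atTop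
      (𝓝 (Real.pi * r ^ 2 + 2 * Real.pi * (s * gamma ν L))) := by
  have h0 : Tendsto (fun lam : ℝ => (Real.sqrt lam)⁻¹ * r) atTop (𝓝 0) := by
    simpa using (tendsto_inv_atTop_zero.comp Real.tendsto_sqrt_atTop).mul_const r
  have h1 : Tendsto (fun lam : ℝ => ∫ x in Ioi (0 : ℝ), (Ioi ((Real.sqrt lam)⁻¹ * r)).indicator
      (fun x => x * (lam * lossTransform μ ν L (lam⁻¹ * s) x)) x) atTop
      (𝓝 (∫ x in Ioi (0 : ℝ), s * (x * meanLoss ν L x))) := by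
    refine tendsto_integral_filter_of_dominated_convergence
      (fun x => s * (x * meanLoss ν L x)) ?_ ?_ ((integrableOn_mul_meanLoss hL).const_mul s) ?_
    · refine Eventually.of_forall fun lam => Measurable.aestronglyMeasurable ?_
      have := measurable_lossTransform hμ hL (lam⁻¹ * s)
      exact Measurable.indicator (by fun_prop) measurableSet_Ioi
    · filter_upwards [eventually_gt_atTop 0] with lam hlam
      filter_upwards [ae_restrict_mem measurableSet_Ioi] with x hx
      have hx0 : 0 ≤ x := le_of_lt hx
      have ht : 0 ≤ lam⁻¹ * s := by positivity
      refine (norm_indicator_le_norm_self _ _).trans ?_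
      have h2 := lossTransform_nonneg hμ hL ht hx0
      rw [Real.norm_of_nonneg (by positivity)]
      calc x * (lam * lossTransform μ ν L (lam⁻¹ * s) x)
          ≤ x * (lam * (lam⁻¹ * s * meanLoss ν L x)) := by
            have := lossTransform_le hμ hL ht hx0
            gcongr
        _ = s * (x * meanLoss ν L x) := by
            field_simp
    · filter_upwards [ae_restrict_mem measurableSet_Ioi] with x hx
      have hx0 : 0 ≤ x := le_of_lt hx
      have h2 := (tendsto_mul_lossTransform hμ hL hs hx0).const_mul x
      have h3 : x * (s * meanLoss ν L x) = s * (x * meanLoss ν L x) := by ring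
      rw [h3] at h2
      refine h2.congr' ?_
      filter_upwards [h0.eventually_lt_const hx] with lam hlam
      rw [indicator_of_mem (mem_Ioi.2 hlam)]
  rw [integral_const_mul, integral_mul_meanLoss hL] at h1
  refine ((h1.const_mul (2 * Real.pi)).const_add (Real.pi * r ^ 2)).congr' ?_
  filter_upwards [eventually_gt_atTop 0] with lam hlam
  have h2 : 0 ≤ (Real.sqrt lam)⁻¹ * r := by positivity
  rw [scaledExponent_eq hlam, setIntegral_indicator measurableSet_Ioi, Ioi_inter_Ioi,
    max_eq_right h2]

end Asymptotics

/-! ### Saturation of the average area spectral efficiency -/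

section Saturation

variable {S : Type*} [MeasurableSpace S] {μ : Measure ℝ} {ν : Measure S} {L : ℝ → S → ℝ} {L₀ : ℝ}

lemma measurable_scaledExponent (hμ : IsFadingLaw μ) (hL : IsFeasiblePathLoss ν L L₀) (lam : ℝ) :
    Measurable (fun p : ℝ × ℝ => scaledExponent μ ν L lam p.1 p.2) := by
  have h : Measurable fun p : ℝ × ℝ => (lam⁻¹ * p.1, (Real.sqrt lam)⁻¹ * p.2) := by fun_prop
  exact (measurable_lossExponent (lam := lam) hμ hL).comp h

lemma interferenceLaplace_scaled {lam : ℝ} (hlam : 0 < lam) (s : ℝ) :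
    interferenceLaplace μ ν L lam (lam⁻¹ * s) = ∫⁻ r in Ioi (0 : ℝ), ENNReal.ofReal
      (2 * Real.pi * r * Real.exp (-scaledExponent μ ν L lam s r)) := by
  have hpi := Real.pi_pos
  have hsq := Real.sqrt_pos.2 hlam
  have hb : 0 < (Real.sqrt lam)⁻¹ := by positivity
  rw [interferenceLaplace, lintegral_Ioi_eq_mul_lintegral_comp_mul hb,
    ← lintegral_const_mul' _ _ ENNReal.ofReal_ne_top]
  refine setLIntegral_congr_fun measurableSet_Ioi fun r hr => ?_
  rw [← ENNReal.ofReal_mul hb.le, scaledExponent]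
  congr 1
  have h1 : (Real.sqrt lam)⁻¹ * ((Real.sqrt lam)⁻¹ * lam) = 1 := by
    rw [← mul_assoc, ← mul_inv, Real.mul_self_sqrt hlam.le, inv_mul_cancel₀ hlam.ne']
  calc _ = ((Real.sqrt lam)⁻¹ * ((Real.sqrt lam)⁻¹ * lam)) * (2 * Real.pi * r *
        Real.exp (-lossExponent μ ν L lam (lam⁻¹ * s) ((Real.sqrt lam)⁻¹ * r))) := by ring
    _ = _ := by rw [h1, one_mul]

/-- On `(0, 1]` the Laplace transform is at most one; beyond `1` the factor `t` in the moment
integral only increases the integrand. -/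
lemma lintegral_interferenceLaplace_lt_top (hμ : IsFadingLaw μ) (hL : IsFeasiblePathLoss ν L L₀)
    {lam : ℝ} (hlam : 0 < lam) (hmom : momentIntegral μ ν L lam < ⊤) :
    ∫⁻ t in Ioi (0 : ℝ), interferenceLaplace μ ν L lam t < ⊤ := by
  rw [← Ioc_union_Ioi_eq_Ioi zero_le_one, lintegral_union measurableSet_Ioi
    (Set.disjoint_left.2 fun x hx hx' => not_lt.2 hx.2 hx')]
  refine ENNReal.add_lt_top.2 ⟨?_, ?_⟩
  · calc ∫⁻ t in Ioc (0 : ℝ) 1, interferenceLaplace μ ν L lam t ≤ ∫⁻ _ in Ioc (0 : ℝ) 1, 1 :=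
          setLIntegral_mono' measurableSet_Ioc fun t ht =>
            interferenceLaplace_le_one hμ hL hlam ht.1.le
      _ < ⊤ := by simp
  · refine lt_of_le_of_lt ?_ hmom
    rw [momentIntegral_eq]
    calc ∫⁻ t in Ioi (1 : ℝ), interferenceLaplace μ ν L lam t
        ≤ ∫⁻ t in Ioi (1 : ℝ), ENNReal.ofReal t * interferenceLaplace μ ν L lam t := by
          refine setLIntegral_mono' measurableSet_Ioi fun t ht => ?_
          have ht1 : (1 : ℝ) ≤ t := le_of_lt ht
          conv_lhs => rw [← one_mul (interferenceLaplace μ ν L lam t)]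
          exact mul_le_mul' (ENNReal.one_le_ofReal.2 ht1) le_rfl
      _ ≤ _ := lintegral_mono_set (Ioi_subset_Ioi zero_le_one)

/-- The integrand of the average area spectral efficiency, after scaling. -/
def scaledIntegrand (μ : Measure ℝ) (ν : Measure S) (L : ℝ → S → ℝ) (N₀ lam : ℝ)
    (p : ℝ × ℝ) : ENNReal :=
  ENNReal.ofReal (Real.exp (-(lam⁻¹ * p.1 * N₀)) *
    (lossTransform μ ν L (lam⁻¹ * p.1) ((Real.sqrt lam)⁻¹ * p.2) / (lam⁻¹ * p.1)) *
    (2 * Real.pi * p.2 * Real.exp (-scaledExponent μ ν L lam p.1 p.2)))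

lemma measurable_scaledIntegrand (hμ : IsFadingLaw μ) (hL : IsFeasiblePathLoss ν L L₀)
    (N₀ lam : ℝ) : Measurable (scaledIntegrand μ ν L N₀ lam) := by
  have h1 := measurable_scaledExponent hμ hL lam
  have h2 : Measurable fun p : ℝ × ℝ =>
      lossTransform μ ν L (lam⁻¹ * p.1) ((Real.sqrt lam)⁻¹ * p.2) := by
    have h : Measurable fun p : ℝ × ℝ => (lam⁻¹ * p.1, (Real.sqrt lam)⁻¹ * p.2) := by fun_prop
    exact (measurable_lossTransform_uncurry hμ hL).comp h
  unfold scaledIntegrand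
  fun_prop

/-- The substitution `t = s/λ`, `r = ρ/√λ`: the prefactor `λ` cancels the Jacobian in `t`, and `λ r
dr` becomes `ρ dρ`. -/
lemma lintegral_scaledIntegrand (hμ : IsFadingLaw μ) (hL : IsFeasiblePathLoss ν L L₀)
    {N₀ lam : ℝ} (hlam : 0 < lam) :
    ENNReal.ofReal lam * ∫⁻ t in Ioi (0 : ℝ), ENNReal.ofReal (Real.exp (-(t * N₀)) / t) *
        ∫⁻ r in Ioi (0 : ℝ), ENNReal.ofReal (lossTransform μ ν L t r) * ENNReal.ofReal
          (2 * Real.pi * lam * r * Real.exp (-lossExponent μ ν L lam t r)) =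
      ∫⁻ p, scaledIntegrand μ ν L N₀ lam p
        ∂((volume.restrict (Ioi (0 : ℝ))).prod (volume.restrict (Ioi (0 : ℝ)))) := by
  have hpi := Real.pi_pos
  have hsq := Real.sqrt_pos.2 hlam
  have hb : 0 < (Real.sqrt lam)⁻¹ := by positivity
  have hinv : 0 < lam⁻¹ := by positivity
  rw [lintegral_prod _ (measurable_scaledIntegrand hμ hL N₀ lam).aemeasurable,
    lintegral_Ioi_eq_mul_lintegral_comp_mul hinv, ← mul_assoc, ← ENNReal.ofReal_mul hlam.le,
    mul_inv_cancel₀ hlam.ne', ENNReal.ofReal_one, one_mul]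
  refine setLIntegral_congr_fun measurableSet_Ioi fun s hs => ?_
  have hs0 : (0 : ℝ) < s := hs
  have ht : 0 < lam⁻¹ * s := by positivity
  rw [lintegral_Ioi_eq_mul_lintegral_comp_mul hb, ← mul_assoc,
    ← ENNReal.ofReal_mul (by positivity), ← lintegral_const_mul' _ _ ENNReal.ofReal_ne_top]
  refine setLIntegral_congr_fun measurableSet_Ioi fun r hr => ?_
  have hr0 : (0 : ℝ) < r := hr
  have hx : 0 ≤ (Real.sqrt lam)⁻¹ * r := by positivity
  have hφ := lossTransform_nonneg hμ hL ht.le hx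
  rw [← ENNReal.ofReal_mul hφ, ← ENNReal.ofReal_mul (by positivity), scaledIntegrand,
    scaledExponent]
  congr 1
  have h1 : (Real.sqrt lam)⁻¹ * ((Real.sqrt lam)⁻¹ * lam) = 1 := by
    rw [← mul_assoc, ← mul_inv, Real.mul_self_sqrt hlam.le, inv_mul_cancel₀ hlam.ne']
  calc _ = ((Real.sqrt lam)⁻¹ * ((Real.sqrt lam)⁻¹ * lam)) * (Real.exp (-(lam⁻¹ * s * N₀)) *
      (lossTransform μ ν L (lam⁻¹ * s) ((Real.sqrt lam)⁻¹ * r) / (lam⁻¹ * s)) *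
      (2 * Real.pi * r *
        Real.exp (-lossExponent μ ν L lam (lam⁻¹ * s) ((Real.sqrt lam)⁻¹ * r)))) := by ring
    _ = _ := by rw [h1, one_mul]

lemma tendsto_lintegral_scaledIntegrand (hμ : IsFadingLaw μ) (hL : IsFeasiblePathLoss ν L L₀)
    (h : TendstoInMeasure ν L (𝓝[>] (0 : ℝ)) (fun _ => L₀)) {N₀ : ℝ} (hN₀ : 0 ≤ N₀)
    {lam₁ : ℝ} (hlam₁ : 0 < lam₁) (hmom : momentIntegral μ ν L lam₁ < ⊤) :
    Tendsto (fun lam => ∫⁻ p, scaledIntegrand μ ν L N₀ lam p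
        ∂((volume.restrict (Ioi (0 : ℝ))).prod (volume.restrict (Ioi (0 : ℝ))))) atTop
      (𝓝 (ENNReal.ofReal (L₀ / (2 * Real.pi * gamma ν L)))) := by
  have hpi := Real.pi_pos
  have hγ := hL.gamma_pos
  have hL0 := hL.loss_zero_nonneg
  set m := (volume.restrict (Ioi (0 : ℝ))).prod (volume.restrict (Ioi (0 : ℝ))) with hm
  have hpos : ∀ᵐ p ∂m, 0 < p.1 ∧ 0 < p.2 := by
    rw [hm, Measure.prod_restrict]
    filter_upwards [ae_restrict_mem (measurableSet_Ioi.prod measurableSet_Ioi)] with p hp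
    exact ⟨hp.1, hp.2⟩
  set lim : ℝ × ℝ → ENNReal := fun p => ENNReal.ofReal (L₀ * (2 * Real.pi * p.2 *
    Real.exp (-(Real.pi * p.2 ^ 2 + 2 * Real.pi * (p.1 * gamma ν L))))) with hlim
  -- The limit is a product: a Rayleigh density of total mass one in `ρ`, and an exponential in `s`
  -- with integral `1/(2πγ)`.
  have hlimint : ∫⁻ p, lim p ∂m = ENNReal.ofReal (L₀ / (2 * Real.pi * gamma ν L)) := by
    rw [hm, lintegral_prod _ (Measurable.aemeasurable (by fun_prop))]
    have h1 : ∀ s ∈ Ioi (0 : ℝ), ∫⁻ r in Ioi (0 : ℝ), lim (s, r) =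
        ENNReal.ofReal L₀ * ENNReal.ofReal (Real.exp (-(s * (2 * Real.pi * gamma ν L)))) := by
      intro s _
      have h2 := lintegral_rayleigh one_pos
      rw [← ENNReal.ofReal_mul hL0, ← mul_one (ENNReal.ofReal _), ← h2,
        ← lintegral_const_mul' _ _ ENNReal.ofReal_ne_top]
      refine setLIntegral_congr_fun measurableSet_Ioi fun r hr => ?_
      rw [← ENNReal.ofReal_mul (by positivity)]
      simp only [hlim]
      congr 1
      rw [neg_add, Real.exp_add, mul_one, mul_one]
      have h3 : s * (2 * Real.pi * gamma ν L) = 2 * Real.pi * (s * gamma ν L) := by ring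
      rw [h3]
      ring
    rw [setLIntegral_congr_fun measurableSet_Ioi h1,
      lintegral_const_mul' _ _ ENNReal.ofReal_ne_top, lintegral_Ioi_exp_neg_mul (by positivity),
      ← ENNReal.ofReal_mul hL0]
    rfl
  rw [← hlimint]
  -- The majorant freezes the exponent at the intensity `lam₁`, bounds `φ_t/t` by `L₀` and the noise
  -- factor by `1`.
  refine tendsto_lintegral_filter_of_dominated_convergence
    (fun p => ENNReal.ofReal L₀ * ENNReal.ofReal
      (2 * Real.pi * p.2 * Real.exp (-scaledExponent μ ν L lam₁ p.1 p.2)))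
    (Eventually.of_forall fun lam => measurable_scaledIntegrand hμ hL N₀ lam) ?_ ?_ ?_
  · filter_upwards [eventually_ge_atTop lam₁] with lam hlam
    have hlam0 : 0 < lam := hlam₁.trans_le hlam
    filter_upwards [hpos] with p hp
    obtain ⟨hp1, hp2⟩ := hp
    have ht : 0 < lam⁻¹ * p.1 := by positivity
    have hx : 0 ≤ (Real.sqrt lam)⁻¹ * p.2 := by positivity
    have h1 := lossTransform_div_le hμ hL ht hx
    have h2 : 0 ≤ lossTransform μ ν L (lam⁻¹ * p.1) ((Real.sqrt lam)⁻¹ * p.2) / (lam⁻¹ * p.1) :=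
      div_nonneg (lossTransform_nonneg hμ hL ht.le hx) ht.le
    have h3 : Real.exp (-(lam⁻¹ * p.1 * N₀)) ≤ 1 :=
      Real.exp_le_one_iff.2 (neg_nonpos.2 (by positivity))
    have h4 := scaledExponent_mono hμ hL hlam₁ hlam hp1.le hp2.le
    rw [← ENNReal.ofReal_mul hL0, scaledIntegrand]
    refine ENNReal.ofReal_le_ofReal ?_
    have h5 : Real.exp (-(lam⁻¹ * p.1 * N₀)) *
        (lossTransform μ ν L (lam⁻¹ * p.1) ((Real.sqrt lam)⁻¹ * p.2) / (lam⁻¹ * p.1)) ≤ L₀ := by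
      calc _ ≤ 1 * (lossTransform μ ν L (lam⁻¹ * p.1) ((Real.sqrt lam)⁻¹ * p.2) /
            (lam⁻¹ * p.1)) := by gcongr
        _ ≤ L₀ := by rwa [one_mul]
    gcongr
  · have h1 : ∫⁻ p, ENNReal.ofReal (2 * Real.pi * p.2 *
        Real.exp (-scaledExponent μ ν L lam₁ p.1 p.2)) ∂m =
        ENNReal.ofReal lam₁ * ∫⁻ t in Ioi (0 : ℝ), interferenceLaplace μ ν L lam₁ t := by
      have h2 := measurable_scaledExponent hμ hL lam₁
      have h3 := lintegral_Ioi_eq_mul_lintegral_comp_mul (inv_pos.2 hlam₁)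
        (interferenceLaplace μ ν L lam₁)
      rw [hm, lintegral_prod _ (Measurable.aemeasurable (by fun_prop)), h3, ← mul_assoc,
        ← ENNReal.ofReal_mul hlam₁.le, mul_inv_cancel₀ hlam₁.ne', ENNReal.ofReal_one, one_mul]
      exact lintegral_congr fun s => (interferenceLaplace_scaled hlam₁ s).symm
    rw [lintegral_const_mul' _ _ ENNReal.ofReal_ne_top, h1]
    exact ENNReal.mul_ne_top ENNReal.ofReal_ne_top (ENNReal.mul_ne_top ENNReal.ofReal_ne_top
      (lintegral_interferenceLaplace_lt_top hμ hL hlam₁ hmom).ne)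
  · filter_upwards [hpos] with p hp
    obtain ⟨hp1, hp2⟩ := hp
    have h1 : Tendsto (fun lam : ℝ => Real.exp (-(lam⁻¹ * p.1 * N₀))) atTop (𝓝 1) := by
      have h2 := ((tendsto_inv_atTop_zero (𝕜 := ℝ)).mul_const p.1).mul_const N₀
      have h3 : Tendsto (fun lam : ℝ => Real.exp (-(lam⁻¹ * p.1 * N₀))) atTop
          (𝓝 (Real.exp (-(0 * p.1 * N₀)))) := (Real.continuous_exp.tendsto _).comp h2.neg
      simpa using h3
    have h4 := tendsto_lossTransform_div hμ hL h hp1 hp2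
    have h5 := (Real.continuous_exp.tendsto _).comp
      (tendsto_scaledExponent hμ hL hp1.le hp2.le).neg
    have h6 := (h1.mul h4).mul (h5.const_mul (2 * Real.pi * p.2))
    rw [one_mul] at h6
    exact ENNReal.tendsto_ofReal h6

theorem tendsto_averageASE (hμ : IsFadingLaw μ) (hL : IsFeasiblePathLoss ν L L₀)
    (hfirst : FirstCondition μ ν L)
    (hlim : TendstoInMeasure ν L (𝓝[>] (0 : ℝ)) (fun _ => L₀)) {N₀ : ℝ} (hN₀ : 0 ≤ N₀)
    {Ω : ℝ → Type*} [∀ lam, MeasurableSpace (Ω lam)] {P : ∀ lam, Measure (Ω lam)}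
    {X : ∀ lam, ℕ → Ω lam → Plane} {h : ∀ lam, ℕ → Ω lam → ℝ} {σ : ∀ lam, ℕ → Ω lam → S}
    (hN : ∀ lam : ℝ, 0 < lam → IsNetwork μ ν lam (P lam) (X lam) (h lam) (σ lam)) :
    Tendsto (fun lam : ℝ => averageASE L N₀ lam (P lam) (X lam) (h lam) (σ lam)) atTop
      (𝓝 (ENNReal.ofReal (L₀ / (2 * Real.pi * Real.log 2 * gamma ν L)))) := by
  obtain ⟨lamc, hlamc, hmom⟩ := hfirst
  have hlog2 : 0 < Real.log 2 := Real.log_pos one_lt_two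
  -- The reference intensity is `lamc + 1` because `lamc` itself may be zero and domination needs a
  -- positive one.
  have h1 := ENNReal.Tendsto.const_mul (a := ENNReal.ofReal (Real.log 2)⁻¹)
    (tendsto_lintegral_scaledIntegrand hμ hL hlim hN₀
      (show 0 < lamc + 1 by linarith) (hmom _ (by linarith))) (Or.inr ENNReal.ofReal_ne_top)
  have h2 : (Real.log 2)⁻¹ * (L₀ / (2 * Real.pi * gamma ν L)) =
      L₀ / (2 * Real.pi * Real.log 2 * gamma ν L) := by
    have := Real.pi_pos
    have := hL.gamma_pos
    field_simp
  rw [← ENNReal.ofReal_mul (by positivity), h2] at h1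
  refine h1.congr' ?_
  filter_upwards [eventually_ge_atTop lamc, eventually_gt_atTop 0] with lam hlam hlam0
  rw [(hN lam hlam0).averageASE_eq hμ hL hlam0 (hmom lam hlam) hN₀,
    ← lintegral_scaledIntegrand hμ hL hlam0]
  ring

end Saturation

end CellularNetwork

end

theorem corollary5 {S : Type*} [MeasurableSpace S]
    (μ : Measure ℝ) (hμ : CellularNetwork.IsFadingLaw μ)
    (ν : Measure S) (L : ℝ → S → ℝ) (L₀ : ℝ)
    (hL : CellularNetwork.IsFeasiblePathLoss ν L L₀)
    (r₀ ζ lamc : ℝ) (hr₀ : 0 ≤ r₀) (hζ : 0 < ζ) (hlamc : 0 ≤ lamc)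
    -- the lower bound for the path loss: positive, decreasing and differentiable on `[r₀, ∞)`
    (Lt : ℝ → ℝ) (hLt_pos : ∀ r ∈ Ici r₀, 0 < Lt r)
    (hLt_anti : AntitoneOn Lt (Ici r₀))
    (hLt_diff : DifferentiableOn ℝ Lt (Ici r₀))
    -- `Lt(r) ≤ L(r)` on `[r₀, ∞)`
    (hLt_le : ∀ r ∈ Ici r₀, ∀ᵐ s ∂ν, Lt r ≤ L r s)
    -- `r Lt(r) / (-Lt'(r)) ≥ ζ` on `[r₀, ∞)`, the quotient being read as `+∞` where `Lt'(r) = 0`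
    (hLt_ratio : ∀ r ∈ Ici r₀, ζ * (-derivWithin Lt (Ici r₀) r) ≤ r * Lt r)
    -- `∫ r Lt(r)⁻² exp(-π λ₀ r²) dr` over `[r₀, ∞)` is finite for all `λ₀ > lamc`
    (hLt_int : ∀ lam : ℝ, lamc < lam →
      IntegrableOn (fun r => r / Lt r ^ 2 * Real.exp (-(Real.pi * lam * r ^ 2))) (Ici r₀)) :
    -- the first sufficient condition
    CellularNetwork.FirstCondition μ ν L ∧
    -- saturation of the average area spectral efficiency
    ((TendstoInMeasure ν L (𝓝[>] (0 : ℝ)) (fun _ => L₀)) →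
      ∀ (N₀ : ℝ), 0 ≤ N₀ →
      ∀ (Ω : ℝ → Type*) [∀ lam, MeasurableSpace (Ω lam)] (P : ∀ lam, Measure (Ω lam))
        (X : ∀ lam, ℕ → Ω lam → CellularNetwork.Plane)
        (h : ∀ lam, ℕ → Ω lam → ℝ) (σ : ∀ lam, ℕ → Ω lam → S),
        (∀ lam : ℝ, 0 < lam →
          CellularNetwork.IsNetwork μ ν lam (P lam) (X lam) (h lam) (σ lam)) →
        Tendsto
          (fun lam : ℝ =>
            CellularNetwork.averageASE L N₀ lam (P lam) (X lam) (h lam) (σ lam))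
          atTop
          (𝓝 (ENNReal.ofReal
            (L₀ / (2 * Real.pi * Real.log 2 * CellularNetwork.gamma ν L))))) := by
  have hfirst := CellularNetwork.firstCondition_of_lower_bound hμ hL hr₀ hζ hlamc hLt_pos hLt_anti
    hLt_diff hLt_le hLt_ratio hLt_int
  exact ⟨hfirst, fun hlim N₀ hN₀ Ω _ P X h σ hN =>
    CellularNetwork.tendsto_averageASE hμ hL hfirst hlim hN₀ hN⟩
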